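/- Let $S\subseteq\mathbb R^n$ carry a finite nonzero measure $\nu$. On a probability space with expectation $E$ let, for every $N\ge1$, $H_N=(H_N(\sigma))_{\sigma\in S^N}$ be a Gaussian process, jointly measurable in $\sigma$ and the disorder, with mean $b_N(\sigma)$ and covariance $c_N(\sigma,\sigma')$. Let $k\in\mathbb N$, let $g,f:\mathbb R^k\to\mathbb R$ be of class $C^1$ with $f$ convex, let $M,C,C'$ be constants, and let $m_N=(m_N^{(1)},\dots,m_N^{(k)})$ and $Q_N=(Q_N^{(1)},\dots,Q_N^{(k)})$ be measurable functions on $S^N$ and $S^N\times S^N$ such that for all $N\ge 1$, all $i$ and all $\sigma,\sigma'\in S^N$ - $\left|\frac{b_N(\sigma)}N-g(m_N(\sigma))\right|\le \frac{C'}N$ and $|m^{(i)}_N(\sigma)|\le M$; - $\left|\frac{c_N(\sigma,\sigma')}N-f(Q_N(\sigma,\sigma'))\right|\le \frac{C}N$ and $|Q^{(i)}_N(\sigma,\sigma)|\le M$; - if $N=N_1+N_2$ with $N_1,N_2\ge1$, and $\sigma=(\sigma^{(1)},\sigma^{(2)})$, $\sigma'=(\sigma'^{(1)},\sigma'^{(2)})$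 with $\sigma^{(j)},\sigma'^{(j)}\in S^{N_j}$, then $N m^{(i)}_N(\sigma)=N_1m^{(i)}_{N_1}(\sigma^{(1)})+N_2m^{(i)}_{N_2}(\sigma^{(2)})$ and $N Q^{(i)}_N(\sigma,\sigma')=N_1Q^{(i)}_{N_1}(\sigma^{(1)},\sigma'^{(1)})+N_2Q^{(i)}_{N_2}(\sigma^{(2)},\sigma'^{(2)})$. For $\beta>0$ let $Z_N(\beta)=\int_{S^N}e^{-\beta H_N(\sigma)}\,\nu(d\sigma_1)\cdots\nu(d\sigma_N)$. Then $0<Z_N(\beta)<\infty$ almost surely, $\ln Z_N(\beta)$ is integrable, and with $f_N(\beta)=-\frac1{N\beta}E\ln Z_N(\beta)$ there is a function $\beta\mapsto f_\infty(\beta)\in\mathbb R$ such that for every $\beta>0$: 1. $\lim_{N\to\infty}f_N(\beta)=f_\infty(\beta)$; 2. $\lim_{N\to\infty}-\frac1{N\beta}\ln Z_N(\beta)=f_\infty(\beta)$ almost surely; 3. with $L=\max_{|x_i|\le M\,\forall i}|f(x_1,\dots,x_k)|$, for all $N\ge1$ and $u>0$, $$P\left(\left|-\frac1{N\beta}\ln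 Z_N(\beta)-f_N(\beta)\right|\ge u\right)\le 2\exp\left(-\frac{Nu^2}{2L_N}\right),\qquad L_N=L+\frac CN .$$ Moreover, for every $N$ such that $c_N(\sigma,\sigma)\le NL$ for all $\sigma\in S^N$ (in particular if $c_N=N f(Q_N)$ exactly), this bound holds with $L_N=L$. If $L_N=0$, the right-hand side is read as $0$. -/

import Mathlib

open MeasureTheory ProbabilityTheory Filter Topology

noncomputable section

namespace SpinGlass

/-- Configurations of `N` spins with values in `S ⊆ ℝⁿ`. -/
abbrev Config {n : ℕ} (S : Set (EuclideanSpace ℝ (Fin n))) (N : ℕ) : Type := Fin N → S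

/-- A family of functions of the configuration, one for each system size `N`, such that `N` times
the `N`-th one is additive when the system is cut into two blocks of consecutive spins. -/
def IsSizeAdditive {n : ℕ} {S : Set (EuclideanSpace ℝ (Fin n))}
    (m : (N : ℕ) → Config S N → ℝ) : Prop :=
  ∀ N₁ N₂ : ℕ, 1 ≤ N₁ → 1 ≤ N₂ → ∀ (σ₁ : Config S N₁) (σ₂ : Config S N₂),
    ((N₁ + N₂ : ℕ) : ℝ) * m (N₁ + N₂) (Fin.append σ₁ σ₂) =
      (N₁ : ℝ) * m N₁ σ₁ + (N₂ : ℝ) * m N₂ σ₂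

/-- The same for functions of two configurations, both cut at the same place. -/
def IsSizeAdditive₂ {n : ℕ} {S : Set (EuclideanSpace ℝ (Fin n))}
    (Q : (N : ℕ) → Config S N → Config S N → ℝ) : Prop :=
  ∀ N₁ N₂ : ℕ, 1 ≤ N₁ → 1 ≤ N₂ →
    ∀ (σ₁ τ₁ : Config S N₁) (σ₂ τ₂ : Config S N₂),
    ((N₁ + N₂ : ℕ) : ℝ) * Q (N₁ + N₂) (Fin.append σ₁ σ₂) (Fin.append τ₁ τ₂) =
      (N₁ : ℝ) * Q N₁ σ₁ τ₁ + (N₂ : ℝ) * Q N₂ σ₂ τ₂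

section

variable {n : ℕ} {S : Set (EuclideanSpace ℝ (Fin n))} {Ω : Type*}

/-- The Boltzmann factor `exp (-β H_N(σ, J))`. -/
def boltzmannFactor (H : (N : ℕ) → Config S N → Ω → ℝ) (β : ℝ) (N : ℕ) (ω : Ω)
    (σ : Config S N) : ℝ :=
  Real.exp (-β * H N σ ω)

/-- The partition function: the integral of the Boltzmann factor against `ν(dσ₁)⋯ν(dσ_N)`. -/
def partitionFunction (ν : Measure S) [SigmaFinite ν] (H : (N : ℕ) → Config S N → Ω → ℝ)
    (β : ℝ) (N : ℕ) (ω : Ω) : ℝ :=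
  ∫ σ : Config S N, boltzmannFactor H β N ω σ ∂(Measure.pi fun _ : Fin N => ν)

/-- The disorder dependent free energy per site `-(1/(Nβ)) log Z_N`. -/
def freeEnergy (ν : Measure S) [SigmaFinite ν] (H : (N : ℕ) → Config S N → Ω → ℝ)
    (β : ℝ) (N : ℕ) (ω : Ω) : ℝ :=
  -(1 / ((N : ℝ) * β)) * Real.log (partitionFunction ν H β N ω)

/-- The quenched free energy per site `-(1/(Nβ)) E log Z_N`. -/
def quenchedFreeEnergy [MeasurableSpace Ω] (P : Measure Ω) (ν : Measure S) [SigmaFinite ν]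
    (H : (N : ℕ) → Config S N → Ω → ℝ) (β : ℝ) (N : ℕ) : ℝ :=
  -(1 / ((N : ℝ) * β)) * ∫ ω, Real.log (partitionFunction ν H β N ω) ∂P

end

/-- The maximum of `|f|` over the cube `|x_i| ≤ M` (attained when `f` is continuous). -/
def maxAbsOnCube {k : ℕ} (f : (Fin k → ℝ) → ℝ) (M : ℝ) : ℝ :=
  sSup ((fun x => |f x|) '' {x : Fin k → ℝ | ∀ i, |x i| ≤ M})

/-- The Gaussian bound `2 exp (-N u² / (2 L))` for deviations of size `u > 0`; for `L = 0` it is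
read as its limit `0` (Lean's division by zero would make it the void bound `2`). -/
def gaussianTail (N : ℕ) (L u : ℝ) : ℝ :=
  if L = 0 then 0 else 2 * Real.exp (-((N : ℝ) * u ^ 2 / (2 * L)))

end SpinGlass

end

/-!
Let `X = -β H_N`. Interpolating between two Gaussian processes, the means along a segment and the
fluctuations along a quarter of a circle, changes the expected logarithm of the partition function
at a rate given, after Gaussian integration by parts, by Gibbs averages of the cumulants
`E X + Var X / 2` and of the off-diagonal covariances. Since `f` is convex, the covariances of a
concatenation are, up to a constant, at most those of independent blocks. The comparison needs the
cumulants to agree, so it is applied to the compensated process `X - (E X + Var X / 2)`, whose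
expected log-partition function is superadditive up to a constant.

The compensator is a function of the magnetizations and self-overlaps, which are nearly constant on
small cells. Between a cell and the whole configuration space the quenched free energy can be
compared because finitely many cells suffice and the logarithm of the partition function of each
cell is sub-Gaussian with variance proxy of order `N`: passing to the largest cell costs only
`O(√N)`. A version of Fekete's lemma then gives the limit. The same Gaussian
concentration yields the fluctuation bound and, with Borel–Cantelli, almost sure convergence.
-/

open scoped NNReal

namespace SpinGlass

section Stein

theorem integral_sub_mul_gaussianReal (m : ℝ) (v : ℝ≥0) {h h' : ℝ → ℝ}
    (hderiv : ∀ x, HasDerivAt h (h' x) x) (hh : MemLp h 2 (gaussianReal m v))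
    (hh' : Integrable h' (gaussianReal m v)) :
    ∫ x, (x - m) * h x ∂(gaussianReal m v) = v * ∫ x, h' x ∂(gaussianReal m v) := by
  rcases eq_or_ne v 0 with rfl | hv
  · simp
  have hv0 : (v : ℝ) ≠ 0 := by exact_mod_cast hv
  have hpdf : ∀ x, HasDerivAt (gaussianPDFReal m v) (-((x - m) / v) * gaussianPDFReal m v x) x := by
    intro x
    have hexp : HasDerivAt (fun y => -(y - m) ^ 2 / (2 * (v : ℝ))) (-((x - m) / v)) x := by
      refine ((((hasDerivAt_id x).sub_const m).pow 2).neg.div_const (2 * (v : ℝ))).congr_deriv ?_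
      simp only [id]
      field
    exact (hexp.exp.const_mul _).congr_deriv (by simp only [gaussianPDFReal]; ring)
  have hint : ∀ {φ : ℝ → ℝ}, Integrable φ (gaussianReal m v) →
      Integrable (fun x => gaussianPDFReal m v x * φ x) := fun {φ} hφ => by
    rw [gaussianReal_of_var_ne_zero m hv, integrable_withDensity_iff_integrable_smul'
      (measurable_gaussianPDF m v) (ae_of_all _ fun _ => gaussianPDF_lt_top)] at hφ
    simpa only [toReal_gaussianPDF, smul_eq_mul] using hφ
  have hxh : Integrable (fun x => (x - m) * h x) (gaussianReal m v) :=
    ((memLp_id_gaussianReal' 2 (by simp)).sub (memLp_const m)).integrable_mul hh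
  have hparts := integral_mul_deriv_eq_deriv_mul_of_integrable (u := h) (u' := h')
    (v := gaussianPDFReal m v) (fun x _ => hderiv x) (fun x _ => hpdf x)
    (((hint hxh).const_mul (-(v : ℝ)⁻¹)).congr (ae_of_all _ fun x => by
      simp only [Pi.mul_apply]; ring))
    ((hint hh').congr (ae_of_all _ fun x => by simp only [Pi.mul_apply]; ring))
    ((hint (hh.integrable one_le_two)).congr (ae_of_all _ fun x => by
      simp only [Pi.mul_apply]; ring))
  simp only [integral_gaussianReal_eq_integral_smul hv, smul_eq_mul]
  calc ∫ x, gaussianPDFReal m v x * ((x - m) * h x)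
      = -v * ∫ x, h x * (-((x - m) / v) * gaussianPDFReal m v x) := by
        rw [← integral_const_mul]
        congr with x
        field
    _ = v * ∫ x, gaussianPDFReal m v x * h' x := by
        rw [hparts, neg_mul_neg]
        simp only [mul_comm]

variable {E : Type*} [NormedAddCommGroup E] [NormedSpace ℝ E] [MeasurableSpace E] [BorelSpace E]
  [CompleteSpace E] [SecondCountableTopology E]

/-- Resampling the value of `L`: the point `x` is the sum of `x - (L x / Var L) • v`, which is
independent of `L x`, and of a multiple of the covariance direction `v` of `L`. -/
theorem measurePreserving_add_smul_covariance (γ : Measure E) [IsGaussian γ]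
    {L : StrongDual ℝ E} {v : E} (hv : ∀ L' : StrongDual ℝ E, L' v = cov[L, L'; γ])
    (hL : Var[L; γ] ≠ 0) :
    MeasurePreserving (fun p : E × ℝ => p.1 + ((p.2 - L p.1) / Var[L; γ]) • v)
      (γ.prod (gaussianReal γ[L] Var[L; γ].toNNReal)) γ := by
  set A : E →L[ℝ] E := ContinuousLinearMap.id ℝ E - ((Var[L; γ])⁻¹ • L).smulRight v with hA
  have hAx : ∀ x, A x = x - (L x / Var[L; γ]) • v := fun x => by
    simp [hA, div_eq_inv_mul]
  have hLA : ∀ L₁ : StrongDual ℝ E, ⇑(L₁ ∘L A) = ⇑L₁ - (L₁ v / Var[L; γ]) • ⇑L := fun L₁ => by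
    ext x
    simp only [ContinuousLinearMap.comp_apply, hAx, map_sub, map_smul, Pi.sub_apply, Pi.smul_apply,
      smul_eq_mul]
    ring
  have hindep : IndepFun A L γ := by
    refine HasGaussianLaw.indepFun_of_covariance_strongDual
      (IsGaussian.hasGaussianLaw_id.map (A.prod L)) fun L₁ L₂ => ?_
    have hL₂ : ⇑L₂ ∘ ⇑L = L₂ 1 • ⇑L := by
      ext x
      simpa [mul_comm] using L₂.map_smul (L x) 1
    have hmem : ∀ L' : StrongDual ℝ E, MemLp L' 2 γ := fun L' =>
      IsGaussian.memLp_dual γ L' 2 (by simp)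
    rw [hL₂, covariance_smul_right, ← ContinuousLinearMap.coe_comp, hLA,
      covariance_sub_left (hmem L₁) ((hmem L).const_smul _) (hmem L), covariance_smul_left,
      covariance_comm, ← hv, covariance_self L.measurable.aemeasurable, div_mul_cancel₀ _ hL,
      sub_self, mul_zero]
  have hsum : MeasurePreserving (fun p : E × ℝ => p.1 + (p.2 / Var[L; γ]) • v)
      ((γ.map A).prod (γ.map L)) γ := by
    refine ⟨by fun_prop, ?_⟩
    rw [← (indepFun_iff_map_prod_eq_prod_map_map A.measurable.aemeasurable
      L.measurable.aemeasurable).1 hindep, Measure.map_map (by fun_prop) (by fun_prop)]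
    convert Measure.map_id using 2
    ext x
    simp [hAx]
  rw [← IsGaussian.map_eq_gaussianReal L]
  convert hsum.comp ((A.measurable.measurePreserving γ).prod (MeasurePreserving.id (γ.map L)))
    using 2 with p
  simp only [Function.comp_apply, Prod.map_fst, Prod.map_snd, hAx, id_eq, sub_div, sub_smul]
  abel

theorem integral_sub_mul_eq_zero_of_variance_eq_zero {Ω : Type*} [MeasurableSpace Ω]
    {μ : Measure Ω} [IsFiniteMeasure μ] {X : Ω → ℝ} (hX : MemLp X 2 μ) (h : Var[X; μ] = 0)
    (Y : Ω → ℝ) : ∫ ω, (X ω - μ[X]) * Y ω ∂μ = 0 := by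
  refine integral_eq_zero_of_ae ?_
  filter_upwards [ae_eq_integral_of_variance_eq_zero hX h] with ω hω
  simp [hω]

theorem integral_eq_integral_integral_of_measurePreserving {α β δ : Type*} [MeasurableSpace α]
    [MeasurableSpace β] [MeasurableSpace δ] {μ : Measure α} [SFinite μ] {ν : Measure β} [SFinite ν]
    {ρ : Measure δ} {Φ : α × β → δ} (hΦ : MeasurePreserving Φ (μ.prod ν) ρ) {φ : δ → ℝ}
    (hφ : Integrable φ ρ) : ∫ z, φ z ∂ρ = ∫ x, ∫ y, φ (Φ (x, y)) ∂ν ∂μ := by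
  rw [← integral_prod (fun p => φ (Φ p)) (hΦ.integrable_comp_of_integrable hφ)]
  conv_lhs => rw [← hΦ.map_eq]
  exact integral_map hΦ.aemeasurable (hΦ.map_eq.symm ▸ hφ.1)

/-- **Gaussian integration by parts**: resampling the value of `L` reduces it to one dimension. -/
theorem integral_sub_mul_eq_integral_lineDeriv (γ : Measure E) [IsGaussian γ]
    {L : StrongDual ℝ E} {v : E} (hv : ∀ L' : StrongDual ℝ E, L' v = cov[L, L'; γ])
    {h h' : E → ℝ} (hderiv : ∀ x, HasLineDerivAt ℝ h (h' x) x v) (hh : MemLp h 2 γ)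
    (hh' : Integrable h' γ) :
    ∫ x, (L x - γ[L]) * h x ∂γ = ∫ x, h' x ∂γ := by
  have hLmem : MemLp L 2 γ := IsGaussian.memLp_dual γ L 2 (by simp)
  rcases eq_or_ne Var[L; γ] 0 with hL | hL
  · have hmul := integral_sub_mul_eq_zero_of_variance_eq_zero hLmem hL
    obtain rfl : v = 0 := (SeparatingDual.eq_zero_iff_forall_dual_eq_zero (R := ℝ) v).2 fun L' => by
      rw [hv]
      exact hmul _
    simp [hmul, fun x => (hderiv x).unique hasLineDerivAt_zero]
  have hLh : Integrable (fun x => (L x - γ[L]) * h x) γ :=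
    (hLmem.sub (memLp_const _)).integrable_mul hh
  set s := Var[L; γ] with hs
  set G := gaussianReal γ[L] s.toNNReal
  set Φ : E × ℝ → E := fun p => p.1 + ((p.2 - L p.1) / s) • v with hΦ
  have hpres : MeasurePreserving Φ (γ.prod G) γ := measurePreserving_add_smul_covariance γ hv hL
  have hLΦ : ∀ p, L (Φ p) = p.2 := fun p => by
    simp [hΦ, hv, covariance_self L.measurable.aemeasurable, ← hs, div_mul_cancel₀ _ hL]
  have hslice : ∀ y t, HasDerivAt (fun t => h (Φ (y, t))) (h' (Φ (y, t)) / s) t := fun y t => by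
    have hline : HasDerivAt (fun r => h (Φ (y, t) + r • v)) (h' (Φ (y, t))) ((t - t) / s) := by
      rw [sub_self, zero_div]
      exact hderiv (Φ (y, t))
    refine (hline.comp t (((hasDerivAt_id t).sub_const t).div_const s)).congr_deriv (by ring)
      |>.congr_of_eventuallyEq (Eventually.of_forall fun r => ?_)
    simp only [hΦ, Function.comp_apply, id_eq, add_assoc, ← add_smul]
    congr 3
    ring
  rw [integral_eq_integral_integral_of_measurePreserving hpres hLh,
    integral_eq_integral_integral_of_measurePreserving hpres hh']
  refine integral_congr_ae ?_
  have hsq := (hpres.integrable_comp_of_integrable hh.integrable_sq).prod_right_ae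
  have hm := (hh.comp_measurePreserving hpres).1.prodMk_left
  have hd := (hpres.integrable_comp_of_integrable hh').prod_right_ae
  filter_upwards [hsq, hm, hd] with y hy hym hyd
  have hstein := integral_sub_mul_gaussianReal γ[L] s.toNNReal (hslice y)
    ((memLp_two_iff_integrable_sq hym).2 hy) (hyd.div_const s)
  simp only [hLΦ]
  rw [hstein, integral_div, Real.coe_toNNReal _ (variance_nonneg _ _), mul_div_cancel₀ _ hL]

end Stein

section Interpolation

variable {E : Type*} [NormedAddCommGroup E] [NormedSpace ℝ E]

/-- The interpolation between the two coordinates of `E × E` used for Gaussian vectors with means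
`a` and `b`: the means move along a segment, the fluctuations along a quarter of a circle. -/
noncomputable def interpolate (a b : E) (θ : ℝ) (z : E × E) : E :=
  (Real.cos θ ^ 2 • a + Real.sin θ ^ 2 • b) + (Real.cos θ • (z.1 - a) + Real.sin θ • (z.2 - b))

/-- The derivative of `interpolate` with respect to the angle. -/
noncomputable def interpolateVelocity (a b : E) (θ : ℝ) (z : E × E) : E :=
  (2 * Real.sin θ * Real.cos θ) • (b - a) + (Real.cos θ • (z.2 - b) - Real.sin θ • (z.1 - a))

variable (a b : E)

@[simp]
theorem interpolate_zero (z : E × E) : interpolate a b 0 z = z.1 := by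
  simp [interpolate]

@[simp]
theorem interpolate_pi_div_two (z : E × E) : interpolate a b (Real.pi / 2) z = z.2 := by
  simp [interpolate]

theorem continuous_interpolate (θ : ℝ) : Continuous (interpolate a b θ) := by
  unfold interpolate
  fun_prop

theorem continuous_interpolateVelocity (θ : ℝ) : Continuous (interpolateVelocity a b θ) := by
  unfold interpolateVelocity
  fun_prop

theorem hasFDerivAt_interpolate (θ : ℝ) (z : E × E) :
    HasFDerivAt (interpolate a b θ)
      (Real.cos θ • ContinuousLinearMap.fst ℝ E E + Real.sin θ • ContinuousLinearMap.snd ℝ E E) z :=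
  (((hasFDerivAt_fst.sub_const a).const_smul (Real.cos θ)).add
    ((hasFDerivAt_snd.sub_const b).const_smul (Real.sin θ))).const_add _

theorem hasDerivAt_interpolate (θ : ℝ) (z : E × E) :
    HasDerivAt (fun θ => interpolate a b θ z) (interpolateVelocity a b θ z) θ := by
  have hc := Real.hasDerivAt_cos θ
  have hs := Real.hasDerivAt_sin θ
  refine ((((hc.pow 2).smul_const a).add ((hs.pow 2).smul_const b)).add
    ((hc.smul_const (z.1 - a)).add (hs.smul_const (z.2 - b)))).congr_deriv ?_
  simp only [interpolateVelocity]
  module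

theorem norm_interpolateVelocity_le (θ : ℝ) (z : E × E) :
    ‖interpolateVelocity a b θ z‖ ≤ 2 * ‖b - a‖ + (‖z.2 - b‖ + ‖z.1 - a‖) := by
  have hc := Real.abs_cos_le_one θ
  have hs := Real.abs_sin_le_one θ
  refine (norm_add_le _ _).trans (add_le_add ?_ ((norm_sub_le _ _).trans (add_le_add ?_ ?_)))
  · rw [norm_smul, Real.norm_eq_abs, abs_mul, abs_mul, abs_two]
    gcongr
    nlinarith [abs_nonneg (Real.sin θ), abs_nonneg (Real.cos θ)]
  · rw [norm_smul, Real.norm_eq_abs]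
    exact mul_le_of_le_one_left (norm_nonneg _) hc
  · rw [norm_smul, Real.norm_eq_abs]
    exact mul_le_of_le_one_left (norm_nonneg _) hs

theorem memLp_comp_lipschitz {Ω E : Type*} [NormedAddCommGroup E] [MeasurableSpace Ω]
    {P : Measure Ω} [IsFiniteMeasure P] {p : ENNReal} {X : Ω → E} (hX : MemLp X p P)
    {F : E → ℝ} {K : ℝ≥0} (hF : LipschitzWith K F) :
    MemLp (fun ω => F (X ω)) p P := by
  have h0 : LipschitzWith K fun x => F x - F 0 := by
    simpa using hF.sub (LipschitzWith.const (F 0))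
  convert (h0.comp_memLp (by simp) hX).add (memLp_const (F 0)) using 2
  simp

variable [MeasurableSpace E] [SecondCountableTopology E] {γ δ : Measure E}
  [IsProbabilityMeasure γ] [IsProbabilityMeasure δ]

theorem memLp_interpolate (hγ : MemLp id 2 γ) (hδ : MemLp id 2 δ) (θ : ℝ) :
    MemLp (interpolate a b θ) 2 (γ.prod δ) := by
  have hfluct := (((hγ.comp_fst δ).sub (memLp_const a)).const_smul (Real.cos θ)).add
    (((hδ.comp_snd γ).sub (memLp_const b)).const_smul (Real.sin θ))
  exact (memLp_const (Real.cos θ ^ 2 • a + Real.sin θ ^ 2 • b)).add hfluct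

variable [BorelSpace E]

theorem hasDerivAt_integral_mul_interpolate (hγ : MemLp id 2 γ) (hδ : MemLp id 2 δ)
    {R : E × E → ℝ} (hR : MemLp R 2 (γ.prod δ)) {F : E → ℝ} {F' : E → StrongDual ℝ E}
    (hF : ∀ x, HasFDerivAt F (F' x) x) (hF' : Continuous F') {K : ℝ≥0} (hK : ∀ x, ‖F' x‖₊ ≤ K)
    (θ : ℝ) :
    HasDerivAt (fun θ => ∫ z, R z * F (interpolate a b θ z) ∂(γ.prod δ))
      (∫ z, R z * F' (interpolate a b θ z) (interpolateVelocity a b θ z) ∂(γ.prod δ)) θ := by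
  have hlip : LipschitzWith K F := lipschitzWith_of_nnnorm_fderiv_le
    (fun x => (hF x).differentiableAt) fun x => (hF x).fderiv ▸ hK x
  have hint : ∀ θ, Integrable (fun z => R z * F (interpolate a b θ z)) (γ.prod δ) := fun θ =>
    hR.integrable_mul (memLp_comp_lipschitz (memLp_interpolate a b hγ hδ θ) hlip)
  have hfst : MemLp (fun z : E × E => ‖z.1 - a‖) 2 (γ.prod δ) :=
    ((hγ.comp_fst δ).sub (memLp_const a)).norm
  have hsnd : MemLp (fun z : E × E => ‖z.2 - b‖) 2 (γ.prod δ) :=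
    ((hδ.comp_snd γ).sub (memLp_const b)).norm
  have hdom : MemLp (fun z : E × E => 2 * ‖b - a‖ + (‖z.2 - b‖ + ‖z.1 - a‖)) 2 (γ.prod δ) :=
    (memLp_const (2 * ‖b - a‖)).add (hsnd.add hfst)
  have hmeas : AEStronglyMeasurable
      (fun z => R z * F' (interpolate a b θ z) (interpolateVelocity a b θ z)) (γ.prod δ) :=
    hR.1.mul ((hF'.comp (continuous_interpolate a b θ)).clm_apply
      (continuous_interpolateVelocity a b θ)).aestronglyMeasurable
  have hbound : ∀ θ z, ‖R z * F' (interpolate a b θ z) (interpolateVelocity a b θ z)‖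
      ≤ ‖R z‖ * (2 * ‖b - a‖ + (‖z.2 - b‖ + ‖z.1 - a‖)) * K := fun θ z => by
    rw [norm_mul, mul_assoc, mul_comm _ (K : ℝ)]
    refine mul_le_mul_of_nonneg_left ((ContinuousLinearMap.le_opNorm _ _).trans ?_) (norm_nonneg _)
    exact mul_le_mul (hK _) (norm_interpolateVelocity_le a b θ z) (norm_nonneg _) K.2
  have hderiv : ∀ θ z, HasDerivAt (fun θ => R z * F (interpolate a b θ z))
      (R z * F' (interpolate a b θ z) (interpolateVelocity a b θ z)) θ := fun θ z =>
    ((hF _).comp_hasDerivAt θ (hasDerivAt_interpolate a b θ z)).const_mul (R z)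
  exact (hasDerivAt_integral_of_dominated_loc_of_deriv_le Filter.univ_mem
    (Eventually.of_forall fun θ => (hint θ).1) (hint θ) hmeas
    (ae_of_all _ fun z θ _ => hbound θ z) ((hR.norm.integrable_mul hdom).mul_const (K : ℝ))
    (ae_of_all _ fun z θ _ => hderiv θ z)).2

end Interpolation

section GaussianVector

variable {ι : Type*}

/-- The row of index `i` of the covariance matrix of a measure on `ι → ℝ`. -/
noncomputable def covRow (γ : Measure (ι → ℝ)) (i j : ι) : ℝ :=
  cov[fun x => x i, fun x => x j; γ]

/-- The fluctuating part of the `i`-th coordinate of `interpolateVelocity`. -/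
noncomputable def coordFluctuation (i : ι) (θ : ℝ) : StrongDual ℝ ((ι → ℝ) × (ι → ℝ)) :=
  (ContinuousLinearMap.proj i : StrongDual ℝ (ι → ℝ)) ∘L
    (Real.cos θ • ContinuousLinearMap.snd ℝ _ _ - Real.sin θ • ContinuousLinearMap.fst ℝ _ _)

theorem coordFluctuation_apply (i : ι) (θ : ℝ) (z : (ι → ℝ) × (ι → ℝ)) :
    coordFluctuation i θ z = Real.cos θ * z.2 i - Real.sin θ * z.1 i := by
  simp [coordFluctuation]

theorem covariance_comp_measurePreserving {Ω Ω' : Type*} [MeasurableSpace Ω] [MeasurableSpace Ω']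
    {μ : Measure Ω} {ν : Measure Ω'} {φ : Ω → Ω'} (hφ : MeasurePreserving φ μ ν) {X Y : Ω' → ℝ}
    (hX : AEStronglyMeasurable X ν) (hY : AEStronglyMeasurable Y ν) :
    cov[fun ω => X (φ ω), fun ω => Y (φ ω); μ] = cov[X, Y; ν] := by
  rw [← hφ.map_eq] at hX hY
  rw [← covariance_map_fun hX hY hφ.aemeasurable, hφ.map_eq]

section

variable [Finite ι]

theorem memLp_eval_two (γ : Measure (ι → ℝ)) [IsGaussian γ] (i : ι) :
    MemLp (fun x : ι → ℝ => x i) 2 γ := by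
  have := Fintype.ofFinite ι
  exact IsGaussian.memLp_dual γ (ContinuousLinearMap.proj i) 2 (by simp)

variable {γ δ : Measure (ι → ℝ)} [IsGaussian γ]

theorem apply_covRow (A : StrongDual ℝ (ι → ℝ)) (i : ι) :
    A (covRow γ i) = cov[fun x => x i, A; γ] := by
  classical
  have := Fintype.ofFinite ι
  have hA : ⇑A = fun x => ∑ j, x j * A (Pi.single j 1) := by
    ext x
    conv_lhs => rw [← Finset.univ_sum_single x, map_sum]
    refine Finset.sum_congr rfl fun j _ => ?_
    rw [← smul_eq_mul, ← map_smul, ← Pi.single_smul, smul_eq_mul, mul_one]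
  calc A (covRow γ i) = ∑ j, covRow γ i j * A (Pi.single j 1) := congrFun hA _
    _ = cov[fun x => x i, fun x => ∑ j, x j * A (Pi.single j 1); γ] := by
      rw [covariance_fun_sum_right (fun j => (memLp_eval_two γ j).mul_const _)
        (memLp_eval_two γ i)]
      simp only [covariance_mul_const_right, covRow]
    _ = cov[fun x => x i, A; γ] := by rw [← hA]

variable [IsGaussian δ]

theorem apply_covRow_prod (i : ι) (θ : ℝ) (L : StrongDual ℝ ((ι → ℝ) × (ι → ℝ))) :
    L (-Real.sin θ • covRow γ i, Real.cos θ • covRow δ i)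
      = cov[coordFluctuation i θ, L; γ.prod δ] := by
  set A : StrongDual ℝ (ι → ℝ) := L ∘L ContinuousLinearMap.inl ℝ _ _ with hA
  set B : StrongDual ℝ (ι → ℝ) := L ∘L ContinuousLinearMap.inr ℝ _ _ with hB
  have hL : ∀ z, L z = A z.1 + B z.2 := fun z => by
    simp [hA, hB, ← map_add]
  have := Fintype.ofFinite ι
  have hA2 := IsGaussian.memLp_dual γ A 2 (by simp)
  have hB2 := IsGaussian.memLp_dual δ B 2 (by simp)
  have hi := memLp_eval_two γ i
  have hi' := memLp_eval_two δ i
  have hγ : cov[fun z => z.1 i, fun z => A z.1; γ.prod δ] = A (covRow γ i) := by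
    rw [apply_covRow]
    exact covariance_comp_measurePreserving (measurePreserving_fst (μ := γ) (ν := δ))
      hi.1 hA2.1
  have hδ : cov[fun z => z.2 i, fun z => B z.2; γ.prod δ] = B (covRow δ i) := by
    rw [apply_covRow]
    exact covariance_comp_measurePreserving (measurePreserving_snd (μ := γ) (ν := δ))
      hi'.1 hB2.1
  have hcross : cov[fun z => z.1 i, fun z => B z.2; γ.prod δ] = 0 := covariance_fst_snd_prod hi hB2
  have hcross' : cov[fun z => z.2 i, fun z => A z.1; γ.prod δ] = 0 := by
    rw [covariance_comm]
    exact covariance_fst_snd_prod hA2 hi'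
  have hsum : MemLp (fun z => A z.1 + B z.2) 2 (γ.prod δ) :=
    (hA2.comp_fst δ).add (hB2.comp_snd γ)
  simp only [funext hL, hL, funext (coordFluctuation_apply i θ), map_smul]
  have hadd : (fun z : (ι → ℝ) × (ι → ℝ) => A z.1 + B z.2)
      = (fun z => A z.1) + fun z => B z.2 := rfl
  rw [covariance_fun_sub_left ((hi'.comp_snd γ).const_mul _) ((hi.comp_fst δ).const_mul _) hsum,
    covariance_const_mul_left, covariance_const_mul_left, hadd,
    covariance_add_right (hi'.comp_snd γ) (hA2.comp_fst δ) (hB2.comp_snd γ),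
    covariance_add_right (hi.comp_fst δ) (hA2.comp_fst δ) (hB2.comp_snd γ), hγ, hδ, hcross,
    hcross']
  simp only [smul_eq_mul]
  ring

end

variable [Fintype ι] {γ δ : Measure (ι → ℝ)}

section

variable [IsProbabilityMeasure δ]

theorem memLp_mul_comp_interpolate {p : ENNReal} (θ : ℝ) {r u : (ι → ℝ) → ℝ} (hr : MemLp r p γ)
    (hu : Continuous u) {K : ℝ} (huK : ∀ x, |u x| ≤ K) (a b : ι → ℝ) :
    MemLp (fun z => r z.1 * u (interpolate a b θ z)) p (γ.prod δ) := by
  refine .of_le_mul (hr.comp_fst δ) ((hr.comp_fst δ).1.mul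
    (hu.comp (continuous_interpolate a b θ)).aestronglyMeasurable) (c := K)
    (ae_of_all _ fun z => ?_)
  rw [norm_mul, mul_comm]
  gcongr
  exact huK _

theorem integrable_mul_comp_interpolate (θ : ℝ) {r u : (ι → ℝ) → ℝ} (hr : Integrable r γ)
    (hu : Continuous u) {K : ℝ} (huK : ∀ x, |u x| ≤ K) (a b : ι → ℝ) :
    Integrable (fun z => r z.1 * u (interpolate a b θ z)) (γ.prod δ) :=
  memLp_one_iff_integrable.1
    (memLp_mul_comp_interpolate θ (memLp_one_iff_integrable.2 hr) hu huK a b)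

theorem integrable_stein_rhs (i : ι) (θ : ℝ) {r u : (ι → ℝ) → ℝ}
    {r' u' : (ι → ℝ) → StrongDual ℝ (ι → ℝ)} (hr : Integrable r γ) (hr' : Integrable r' γ)
    (huc : Continuous u) (hu'c : Continuous u') {K : ℝ} (huK : ∀ x, |u x| ≤ K)
    (hu'K : ∀ x, ‖u' x‖ ≤ K) (a b : ι → ℝ) :
    Integrable (fun z => -Real.sin θ * r' z.1 (covRow γ i) * u (interpolate a b θ z)
      + Real.sin θ * Real.cos θ * r z.1
        * u' (interpolate a b θ z) (covRow δ i - covRow γ i)) (γ.prod δ) :=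
  (integrable_mul_comp_interpolate θ ((hr'.apply_continuousLinearMap _).const_mul _) huc huK
    a b).add (integrable_mul_comp_interpolate θ (hr.const_mul _)
      (hu'c.clm_apply continuous_const) (K := K * ‖covRow δ i - covRow γ i‖)
      (fun _ => (ContinuousLinearMap.le_opNorm _ _).trans
        (mul_le_mul_of_nonneg_right (hu'K _) (norm_nonneg _))) a b)

/-- The vector of the means of the coordinates. -/
noncomputable def coordMean (γ : Measure (ι → ℝ)) (i : ι) : ℝ := ∫ x, x i ∂γ

/-- The interpolation between `γ` and `δ`, centred at their means. -/
noncomputable abbrev gaussianInterpolate (γ δ : Measure (ι → ℝ)) (θ : ℝ) :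
    (ι → ℝ) × (ι → ℝ) → (ι → ℝ) :=
  interpolate (coordMean γ) (coordMean δ) θ

/-- The `i`-th contribution to the derivative of `∫ r(x) F(Z_θ)` in `θ`, after integration by parts;
`u` and `u'` are the `i`-th partial derivative of `F` and its differential. -/
noncomputable def interpolationRate (γ δ : Measure (ι → ℝ)) (r : (ι → ℝ) → ℝ)
    (r' : (ι → ℝ) → StrongDual ℝ (ι → ℝ)) (u : (ι → ℝ) → ℝ) (u' : (ι → ℝ) → StrongDual ℝ (ι → ℝ))
    (i : ι) (θ : ℝ) (z : (ι → ℝ) × (ι → ℝ)) : ℝ :=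
  2 * Real.sin θ * Real.cos θ * (coordMean δ i - coordMean γ i) * r z.1
      * u (gaussianInterpolate γ δ θ z)
    + (-Real.sin θ * r' z.1 (covRow γ i) * u (gaussianInterpolate γ δ θ z)
      + Real.sin θ * Real.cos θ * r z.1
        * u' (gaussianInterpolate γ δ θ z) (covRow δ i - covRow γ i))

/-- `F` has gradient `G` and Hessian with rows `G'`, both bounded by `K`, as needed to integrate the
coordinates of the gradient by parts. -/
structure HasBoundedHessian (F : (ι → ℝ) → ℝ) (G : ι → (ι → ℝ) → ℝ)
    (G' : ι → (ι → ℝ) → StrongDual ℝ (ι → ℝ)) (K : ℝ≥0) : Prop where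
  hasFDerivAt (x : ι → ℝ) : HasFDerivAt F
    (∑ i, G i x • (ContinuousLinearMap.proj i : StrongDual ℝ (ι → ℝ))) x
  hasFDerivAt_gradient (i : ι) (x : ι → ℝ) : HasFDerivAt (G i) (G' i x) x
  continuous_hessian (i : ι) : Continuous (G' i)
  sum_abs_gradient_le (x : ι → ℝ) : ∑ i, |G i x| ≤ K
  norm_hessian_le (i : ι) (x : ι → ℝ) : ‖G' i x‖ ≤ K

namespace HasBoundedHessian

variable {F : (ι → ℝ) → ℝ} {G : ι → (ι → ℝ) → ℝ} {G' : ι → (ι → ℝ) → StrongDual ℝ (ι → ℝ)} {K : ℝ≥0}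

theorem abs_gradient_le (hF : HasBoundedHessian F G G' K) (i : ι) (x : ι → ℝ) : |G i x| ≤ K :=
  (Finset.single_le_sum (f := fun i => |G i x|) (fun _ _ => abs_nonneg _)
    (Finset.mem_univ i)).trans (hF.sum_abs_gradient_le x)

theorem continuous_gradient (hF : HasBoundedHessian F G G' K) (i : ι) : Continuous (G i) :=
  continuous_iff_continuousAt.2 fun x => (hF.hasFDerivAt_gradient i x).continuousAt

theorem nnnorm_fderiv_le (hF : HasBoundedHessian F G G' K) (x : ι → ℝ) :
    ‖∑ i, G i x • (ContinuousLinearMap.proj i : StrongDual ℝ (ι → ℝ))‖₊ ≤ K := by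
  refine ContinuousLinearMap.opNorm_le_bound _ K.2 fun v => ?_
  calc ‖(∑ i, G i x • (ContinuousLinearMap.proj i : StrongDual ℝ (ι → ℝ))) v‖
      = |∑ i, G i x * v i| := by simp
    _ ≤ ∑ i, |G i x| * ‖v‖ := (Finset.abs_sum_le_sum_abs _ _).trans <|
      Finset.sum_le_sum fun i _ => (abs_mul _ _).trans_le <|
        mul_le_mul_of_nonneg_left (norm_le_pi_norm v i) (abs_nonneg _)
    _ ≤ K * ‖v‖ := by
      rw [← Finset.sum_mul]
      exact mul_le_mul_of_nonneg_right (hF.sum_abs_gradient_le x) (norm_nonneg v)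

theorem lipschitzWith (hF : HasBoundedHessian F G G' K) : LipschitzWith K F :=
  lipschitzWith_of_nnnorm_fderiv_le (fun x => (hF.hasFDerivAt x).differentiableAt) fun x =>
    (hF.hasFDerivAt x).fderiv ▸ hF.nnnorm_fderiv_le x

theorem integrable_interpolationRate (hF : HasBoundedHessian F G G' K) {r : (ι → ℝ) → ℝ}
    {r' : (ι → ℝ) → StrongDual ℝ (ι → ℝ)} (hr : Integrable r γ) (hr' : Integrable r' γ) (i : ι)
    (θ : ℝ) : Integrable (interpolationRate γ δ r r' (G i) (G' i) i θ) (γ.prod δ) :=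
  (integrable_mul_comp_interpolate θ (hr.const_mul _) (hF.continuous_gradient i)
    (hF.abs_gradient_le i) _ _).add (integrable_stein_rhs i θ hr hr' (hF.continuous_gradient i)
      (hF.continuous_hessian i) (hF.abs_gradient_le i) (hF.norm_hessian_le i) _ _)

end HasBoundedHessian

end

variable [IsGaussian γ] [IsGaussian δ]

theorem integral_coordFluctuation_mul (i : ι) (θ : ℝ) {r u : (ι → ℝ) → ℝ}
    {r' u' : (ι → ℝ) → StrongDual ℝ (ι → ℝ)} (hr : ∀ x, HasFDerivAt r (r' x) x)
    (hr2 : MemLp r 2 γ) (hr' : Integrable r' γ) (hu : ∀ x, HasFDerivAt u (u' x) x)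
    (hu'c : Continuous u') {K : ℝ} (huK : ∀ x, |u x| ≤ K) (hu'K : ∀ x, ‖u' x‖ ≤ K)
    (a b : ι → ℝ) :
    ∫ z, (coordFluctuation i θ z - (γ.prod δ)[coordFluctuation i θ])
        * (r z.1 * u (interpolate a b θ z)) ∂(γ.prod δ)
      = ∫ z, (-Real.sin θ * r' z.1 (covRow γ i) * u (interpolate a b θ z)
        + Real.sin θ * Real.cos θ * r z.1
          * u' (interpolate a b θ z) (covRow δ i - covRow γ i)) ∂(γ.prod δ) := by
  have huc : Continuous u := continuous_iff_continuousAt.2 fun x => (hu x).continuousAt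
  refine integral_sub_mul_eq_integral_lineDeriv _ (apply_covRow_prod i θ) (fun z => ?_)
    (memLp_mul_comp_interpolate θ hr2 huc huK a b)
    (integrable_stein_rhs i θ (hr2.integrable one_le_two) hr' huc hu'c huK hu'K a b)
  have hprod : HasFDerivAt (fun z => r z.1 * u (interpolate a b θ z)) _ z :=
    ((hr z.1).comp z hasFDerivAt_fst).mul ((hu _).comp z (hasFDerivAt_interpolate a b θ z))
  convert hprod.hasLineDerivAt _ using 1
  simp only [Function.comp_apply, add_apply, smul_apply, ContinuousLinearMap.comp_apply,
    ContinuousLinearMap.coe_fst', ContinuousLinearMap.coe_snd',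
    map_add, map_sub, map_smul, smul_eq_mul]
  ring

theorem interpolateVelocity_apply_eq (i : ι) (θ : ℝ) (z : (ι → ℝ) × (ι → ℝ)) :
    interpolateVelocity (coordMean γ) (coordMean δ) θ z i
      = 2 * Real.sin θ * Real.cos θ * (coordMean δ i - coordMean γ i)
        + (coordFluctuation i θ z - (γ.prod δ)[coordFluctuation i θ]) := by
  have hmean : (γ.prod δ)[coordFluctuation i θ]
      = Real.cos θ * coordMean δ i - Real.sin θ * coordMean γ i := by
    simp only [coordFluctuation_apply]
    rw [integral_sub
      ((((memLp_eval_two δ i).comp_snd γ).integrable one_le_two).const_mul _)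
      ((((memLp_eval_two γ i).comp_fst δ).integrable one_le_two).const_mul _), integral_const_mul,
      integral_const_mul, integral_fun_fst (fun x : ι → ℝ => x i),
      integral_fun_snd (fun x : ι → ℝ => x i)]
    simp [coordMean]
  rw [hmean, coordFluctuation_apply]
  simp only [interpolateVelocity, Pi.add_apply, Pi.sub_apply, Pi.smul_apply, smul_eq_mul]
  ring

theorem integrable_interpolateVelocity_mul (i : ι) (θ : ℝ) {r u : (ι → ℝ) → ℝ} (hr : MemLp r 2 γ)
    (hu : Continuous u) {K : ℝ} (huK : ∀ x, |u x| ≤ K) :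
    Integrable (fun z => interpolateVelocity (coordMean γ) (coordMean δ) θ z i
      * (r z.1 * u (gaussianInterpolate γ δ θ z))) (γ.prod δ) := by
  have hfluct : MemLp (coordFluctuation i θ) 2 (γ.prod δ) := IsGaussian.memLp_dual _ _ 2 (by simp)
  have hvel : ∀ c d : ℝ, MemLp (fun z => c + (coordFluctuation i θ z - d)) 2 (γ.prod δ) :=
    fun c d => (memLp_const c).add (hfluct.sub (memLp_const d))
  simp only [interpolateVelocity_apply_eq]
  exact (hvel _ _).integrable_mul (memLp_mul_comp_interpolate θ hr hu huK _ _)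

theorem integral_interpolateVelocity_mul (i : ι) (θ : ℝ) {r u : (ι → ℝ) → ℝ}
    {r' u' : (ι → ℝ) → StrongDual ℝ (ι → ℝ)} (hr : ∀ x, HasFDerivAt r (r' x) x)
    (hr2 : MemLp r 2 γ) (hr' : Integrable r' γ) (hu : ∀ x, HasFDerivAt u (u' x) x)
    (hu'c : Continuous u') {K : ℝ} (huK : ∀ x, |u x| ≤ K) (hu'K : ∀ x, ‖u' x‖ ≤ K) :
    ∫ z, interpolateVelocity (coordMean γ) (coordMean δ) θ z i
        * (r z.1 * u (gaussianInterpolate γ δ θ z)) ∂(γ.prod δ)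
      = ∫ z, interpolationRate γ δ r r' u u' i θ z ∂(γ.prod δ) := by
  have huc : Continuous u := continuous_iff_continuousAt.2 fun x => (hu x).continuousAt
  have hr1 := hr2.integrable one_le_two
  have hdrift := integrable_mul_comp_interpolate (δ := δ) θ
    (hr1.const_mul (2 * Real.sin θ * Real.cos θ * (coordMean δ i - coordMean γ i))) huc huK
    (coordMean γ) (coordMean δ)
  have hsplit : ∀ z, interpolateVelocity (coordMean γ) (coordMean δ) θ z i
      * (r z.1 * u (gaussianInterpolate γ δ θ z))
      - 2 * Real.sin θ * Real.cos θ * (coordMean δ i - coordMean γ i) * r z.1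
        * u (gaussianInterpolate γ δ θ z)
      = (coordFluctuation i θ z - (γ.prod δ)[coordFluctuation i θ])
        * (r z.1 * u (gaussianInterpolate γ δ θ z)) := fun z => by
    rw [interpolateVelocity_apply_eq]
    ring
  unfold interpolationRate
  rw [integral_add hdrift (integrable_stein_rhs i θ hr1 hr' huc hu'c huK hu'K _ _),
    ← integral_coordFluctuation_mul i θ hr hr2 hr' hu hu'c huK hu'K, ← sub_eq_iff_eq_add',
    ← integral_sub (integrable_interpolateVelocity_mul i θ hr2 huc huK) hdrift]
  exact integral_congr_ae (ae_of_all _ hsplit)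

theorem HasBoundedHessian.hasDerivAt_integral_interpolate {F : (ι → ℝ) → ℝ} {G : ι → (ι → ℝ) → ℝ}
    {G' : ι → (ι → ℝ) → StrongDual ℝ (ι → ℝ)} {K : ℝ≥0} (hF : HasBoundedHessian F G G' K)
    {r : (ι → ℝ) → ℝ} {r' : (ι → ℝ) → StrongDual ℝ (ι → ℝ)} (hr : ∀ x, HasFDerivAt r (r' x) x)
    (hr2 : MemLp r 2 γ) (hr' : Integrable r' γ) (θ : ℝ) :
    HasDerivAt (fun θ => ∫ z, r z.1 * F (gaussianInterpolate γ δ θ z) ∂(γ.prod δ))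
      (∫ z, ∑ i, interpolationRate γ δ r r' (G i) (G' i) i θ z ∂(γ.prod δ)) θ := by
  have hderiv := hasDerivAt_integral_mul_interpolate (coordMean γ) (coordMean δ)
    (IsGaussian.memLp_id γ 2 (by simp)) (IsGaussian.memLp_id δ 2 (by simp)) (hr2.comp_fst δ)
    hF.hasFDerivAt (continuous_finsetSum _ fun i _ => (hF.continuous_gradient i).smul
      continuous_const) hF.nnnorm_fderiv_le θ
  refine hderiv.congr_deriv ?_
  calc _ = ∫ z, ∑ i, interpolateVelocity (coordMean γ) (coordMean δ) θ z i
        * (r z.1 * G i (gaussianInterpolate γ δ θ z)) ∂(γ.prod δ) := by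
        congr with z
        simp only [sum_apply, smul_apply, ContinuousLinearMap.proj_apply,
          smul_eq_mul, Finset.mul_sum]
        exact Finset.sum_congr rfl fun i _ => by ring
    _ = ∑ i, ∫ z, interpolationRate γ δ r r' (G i) (G' i) i θ z ∂(γ.prod δ) := by
        rw [integral_finsetSum _ fun i _ => integrable_interpolateVelocity_mul i θ hr2
          (hF.continuous_gradient i) (hF.abs_gradient_le i)]
        exact Finset.sum_congr rfl fun i _ => integral_interpolateVelocity_mul i θ hr hr2 hr'
          (hF.hasFDerivAt_gradient i) (hF.continuous_hessian i) (hF.abs_gradient_le i)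
          (hF.norm_hessian_le i)
    _ = _ := (integral_finsetSum _ fun i _ =>
        hF.integrable_interpolationRate (hr2.integrable one_le_two) hr' i θ).symm

end GaussianVector

section LogMeanExp

variable {ι : Type*} [Fintype ι]

/-- The logarithm of the mean of the exponentials of the coordinates. -/
noncomputable def logMeanExp (x : ι → ℝ) : ℝ :=
  Real.log ((∑ i, Real.exp (x i)) / Fintype.card ι)

/-- The Gibbs weights of a vector, which form the gradient of `logMeanExp`. -/
noncomputable def softmax (i : ι) (x : ι → ℝ) : ℝ := Real.exp (x i) / ∑ j, Real.exp (x j)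

/-- The `i`-th row of the Hessian of `logMeanExp`. -/
noncomputable def softmaxDeriv (i : ι) (x : ι → ℝ) : StrongDual ℝ (ι → ℝ) :=
  softmax i x • ((ContinuousLinearMap.proj i : StrongDual ℝ (ι → ℝ))
    - ∑ j, softmax j x • (ContinuousLinearMap.proj j : StrongDual ℝ (ι → ℝ)))

theorem softmaxDeriv_apply (i : ι) (x v : ι → ℝ) :
    softmaxDeriv i x v = softmax i x * (v i - ∑ j, softmax j x * v j) := by
  simp [softmaxDeriv]

theorem softmax_nonneg (i : ι) (x : ι → ℝ) : 0 ≤ softmax i x := by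
  unfold softmax
  positivity

theorem hasFDerivAt_sum_exp (x : ι → ℝ) :
    HasFDerivAt (fun x : ι → ℝ => ∑ i, Real.exp (x i))
      (∑ i, Real.exp (x i) • (ContinuousLinearMap.proj i : StrongDual ℝ (ι → ℝ))) x :=
  HasFDerivAt.fun_sum fun i _ => (hasFDerivAt_apply i x).exp

variable [Nonempty ι]

theorem sum_exp_pos (x : ι → ℝ) : 0 < ∑ i, Real.exp (x i) :=
  Finset.sum_pos (fun _ _ => Real.exp_pos _) Finset.univ_nonempty

theorem sum_softmax (x : ι → ℝ) : ∑ i, softmax i x = 1 := by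
  unfold softmax
  rw [← Finset.sum_div, div_self (sum_exp_pos x).ne']

theorem abs_sum_softmax_mul_le {x v : ι → ℝ} {b : ℝ} (hv : ∀ i, |v i| ≤ b) :
    |∑ i, softmax i x * v i| ≤ b := by
  refine (Finset.abs_sum_le_sum_abs _ _).trans ?_
  calc ∑ i, |softmax i x * v i| ≤ ∑ i, softmax i x * b := by
        gcongr with i
        rw [abs_mul, abs_of_nonneg (softmax_nonneg i x)]
        exact mul_le_mul_of_nonneg_left (hv i) (softmax_nonneg i x)
    _ = b := by rw [← Finset.sum_mul, sum_softmax, one_mul]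

theorem logMeanExp_eq (x : ι → ℝ) :
    logMeanExp x = Real.log (∑ i, Real.exp (x i)) - Real.log (Fintype.card ι) :=
  Real.log_div (sum_exp_pos x).ne' (by simp)

theorem softmax_eq_exp_sub (i : ι) (x : ι → ℝ) :
    softmax i x = Real.exp (x i - logMeanExp x) / Fintype.card ι := by
  rw [Real.exp_sub, logMeanExp, Real.exp_log (by have := sum_exp_pos x; positivity), div_div,
    div_mul_cancel₀ _ (by simp), softmax]

theorem hasFDerivAt_logMeanExp (x : ι → ℝ) :
    HasFDerivAt logMeanExp
      (∑ i, softmax i x • (ContinuousLinearMap.proj i : StrongDual ℝ (ι → ℝ))) x := by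
  simp only [funext logMeanExp_eq]
  refine (((hasFDerivAt_sum_exp x).log (sum_exp_pos x).ne').sub_const _).congr_fderiv ?_
  simp only [softmax, Finset.smul_sum, smul_smul, div_eq_inv_mul]

theorem hasFDerivAt_softmax (i : ι) (x : ι → ℝ) :
    HasFDerivAt (softmax i) (softmaxDeriv i x) x := by
  have hdiff := (hasFDerivAt_apply (𝕜 := ℝ) i x).sub (hasFDerivAt_logMeanExp x)
  simp only [funext (softmax_eq_exp_sub i), div_eq_mul_inv]
  refine (hdiff.exp.mul_const _).congr_fderiv ?_
  rw [softmaxDeriv, softmax_eq_exp_sub, smul_smul, mul_comm, ← div_eq_mul_inv]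
  rfl

theorem hasBoundedHessian_logMeanExp :
    HasBoundedHessian (logMeanExp : (ι → ℝ) → ℝ) softmax softmaxDeriv 2 where
  hasFDerivAt := hasFDerivAt_logMeanExp
  hasFDerivAt_gradient := hasFDerivAt_softmax
  continuous_hessian i := by
    have hcont : ∀ i : ι, Continuous (softmax i) := fun i =>
      continuous_iff_continuousAt.2 fun x => (hasFDerivAt_softmax i x).continuousAt
    unfold softmaxDeriv
    fun_prop
  sum_abs_gradient_le x := by
    simp only [abs_of_nonneg (softmax_nonneg _ x), sum_softmax]
    norm_num
  norm_hessian_le i x := by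
    refine ContinuousLinearMap.opNorm_le_bound _ (by norm_num) fun v => ?_
    have hle : softmax i x ≤ 1 := sum_softmax x ▸
      Finset.single_le_sum (fun j _ => softmax_nonneg j x) (Finset.mem_univ i)
    rw [softmaxDeriv_apply, Real.norm_eq_abs, abs_mul, abs_of_nonneg (softmax_nonneg i x)]
    calc softmax i x * |v i - ∑ j, softmax j x * v j|
        ≤ 1 * (‖v‖ + ‖v‖) := by
          gcongr
          exact (abs_sub _ _).trans (add_le_add (norm_le_pi_norm v i)
            (abs_sum_softmax_mul_le fun j => norm_le_pi_norm v j))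
      _ = ((2 : ℝ≥0) : ℝ) * ‖v‖ := by
          push_cast
          ring

end LogMeanExp

section Comparison

theorem sub_le_sub_of_hasDerivAt_le {f g f' g' : ℝ → ℝ} {a b : ℝ} (hab : a ≤ b)
    (hf : ∀ x, HasDerivAt f (f' x) x) (hg : ∀ x, HasDerivAt g (g' x) x)
    (h : ∀ x ∈ Set.Ioo a b, f' x ≤ g' x) : f b - f a ≤ g b - g a := by
  have hmono : MonotoneOn (fun x => g x - f x) (Set.Icc a b) :=
    monotoneOn_of_hasDerivWithinAt_nonneg (convex_Icc a b)
      (fun x _ => ((hg x).sub (hf x)).continuousAt.continuousWithinAt)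
      (fun x _ => ((hg x).sub (hf x)).hasDerivWithinAt) fun x hx => by
        rw [interior_Icc] at hx
        exact sub_nonneg.2 (h x hx)
  linarith [hmono (Set.left_mem_Icc.2 hab) (Set.right_mem_Icc.2 hab) hab]

variable {ι : Type*} [Fintype ι] {γ δ : Measure (ι → ℝ)}

variable [Nonempty ι]

theorem sum_interpolationRate_softmax_le {D : ℝ}
    (hmean : ∀ i, coordMean δ i + covRow δ i i / 2 ≤ coordMean γ i + covRow γ i i / 2)
    (hcov : ∀ i j, covRow γ i j ≤ covRow δ i j + D) {θ : ℝ} (hsin : 0 ≤ Real.sin θ)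
    (hcos : 0 ≤ Real.cos θ) (z : (ι → ℝ) × (ι → ℝ)) :
    ∑ i, interpolationRate γ δ (fun _ => 1) (fun _ => 0) (softmax i) (softmaxDeriv i) i θ z
      ≤ Real.sin θ * Real.cos θ * D := by
  set x := gaussianInterpolate γ δ θ z with hx
  have hoff : ∀ i, -D ≤ ∑ j, softmax j x * (covRow δ i j - covRow γ i j) := fun i => by
    calc -D = ∑ j, softmax j x * -D := by rw [← Finset.sum_mul, sum_softmax, one_mul]
      _ ≤ _ := by
        gcongr with j
        · exact softmax_nonneg j x
        · linarith [hcov i j]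
  calc ∑ i, interpolationRate γ δ (fun _ => 1) (fun _ => 0) (softmax i) (softmaxDeriv i) i θ z
      = ∑ i, softmax i x * (Real.sin θ * Real.cos θ * (2 * (coordMean δ i - coordMean γ i)
        + (covRow δ i i - covRow γ i i)
        - ∑ j, softmax j x * (covRow δ i j - covRow γ i j))) := by
        refine Finset.sum_congr rfl fun i _ => ?_
        rw [interpolationRate, ← hx, softmaxDeriv_apply]
        simp only [zero_apply, Pi.sub_apply]
        ring
    _ ≤ ∑ i, softmax i x * (Real.sin θ * Real.cos θ * D) := by
        refine Finset.sum_le_sum fun i _ => mul_le_mul_of_nonneg_left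
          (mul_le_mul_of_nonneg_left ?_ (mul_nonneg hsin hcos)) (softmax_nonneg i x)
        linarith [hmean i, hoff i]
    _ = Real.sin θ * Real.cos θ * D := by rw [← Finset.sum_mul, sum_softmax, one_mul]

theorem integral_logMeanExp_le_of_covRow_le [IsGaussian γ] [IsGaussian δ] {D : ℝ}
    (hmean : ∀ i, coordMean δ i + covRow δ i i / 2 ≤ coordMean γ i + covRow γ i i / 2)
    (hcov : ∀ i j, covRow γ i j ≤ covRow δ i j + D) :
    ∫ x, logMeanExp x ∂δ ≤ ∫ x, logMeanExp x ∂γ + D / 2 := by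
  have h0 : Integrable (fun _ : ι → ℝ => (0 : StrongDual ℝ (ι → ℝ))) γ :=
    integrable_const 0
  have h1 : MemLp (fun _ : ι → ℝ => (1 : ℝ)) 2 γ := memLp_const 1
  have hconst : ∀ x, HasFDerivAt (fun _ : ι → ℝ => (1 : ℝ))
      (0 : StrongDual ℝ (ι → ℝ)) x := hasFDerivAt_const 1
  have hderiv := hasBoundedHessian_logMeanExp.hasDerivAt_integral_interpolate (δ := δ) hconst h1 h0
  have hsq : ∀ θ, HasDerivAt (fun θ => D / 2 * Real.sin θ ^ 2)
      (Real.sin θ * Real.cos θ * D) θ := fun θ =>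
    (((Real.hasDerivAt_sin θ).pow 2).const_mul (D / 2)).congr_deriv (by ring)
  have h := sub_le_sub_of_hasDerivAt_le Real.pi_div_two_pos.le hderiv hsq fun θ hθ => by
    have hsin := (Real.sin_pos_of_pos_of_lt_pi hθ.1 (by linarith [hθ.2, Real.pi_pos])).le
    have hcos := (Real.cos_pos_of_mem_Ioo ⟨by linarith [hθ.1, Real.pi_pos], hθ.2⟩).le
    refine (integral_mono (integrable_finsetSum _ fun i _ =>
      hasBoundedHessian_logMeanExp.integrable_interpolationRate (integrable_const 1) h0
        i θ) (integrable_const _)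
      fun z => sum_interpolationRate_softmax_le hmean hcov hsin hcos z).trans_eq ?_
    simp
  simp only [one_mul, interpolate_zero, interpolate_pi_div_two, integral_fun_fst (logMeanExp),
    integral_fun_snd logMeanExp] at h
  simp only [probReal_univ, one_smul, Real.sin_pi_div_two, Real.sin_zero] at h
  linarith

end Comparison

section Concentration

theorem integrable_exp_mul_norm {E : Type*} [NormedAddCommGroup E] [NormedSpace ℝ E]
    [MeasurableSpace E] [BorelSpace E] [SecondCountableTopology E] [CompleteSpace E]
    (γ : Measure E) [IsGaussian γ] (c : ℝ) : Integrable (fun x => Real.exp (c * ‖x‖)) γ := by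
  obtain ⟨C, hC, hint⟩ := IsGaussian.exists_integrable_exp_sq γ
  refine (hint.const_mul (Real.exp (c ^ 2 / (4 * C)))).mono' (by fun_prop) (ae_of_all _ fun x => ?_)
  rw [Real.norm_eq_abs, Real.abs_exp, ← Real.exp_add, Real.exp_le_exp]
  have hsq : c ^ 2 / (4 * C) + C * ‖x‖ ^ 2 - c * ‖x‖ = (c - 2 * C * ‖x‖) ^ 2 / (4 * C) := by
    field_simp
    ring
  have : 0 ≤ (c - 2 * C * ‖x‖) ^ 2 / (4 * C) := by positivity
  linarith

theorem integrable_exp_mul_of_lipschitzWith {E : Type*} [NormedAddCommGroup E] [NormedSpace ℝ E]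
    [MeasurableSpace E] [BorelSpace E] [SecondCountableTopology E] [CompleteSpace E]
    (γ : Measure E) [IsGaussian γ] {F : E → ℝ} {K : ℝ≥0} (hF : LipschitzWith K F) (s : ℝ) :
    Integrable (fun x => Real.exp (s * F x)) γ := by
  refine ((integrable_exp_mul_norm γ (|s| * K)).const_mul (Real.exp (|s| * |F 0|))).mono'
    (hF.continuous.const_mul s).rexp.aestronglyMeasurable (ae_of_all _ fun x => ?_)
  have hle : |F x| ≤ |F 0| + K * ‖x‖ := by
    have h := hF.dist_le_mul x 0
    rw [Real.dist_eq, dist_zero_right] at h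
    linarith [abs_sub_abs_le_abs_sub (F x) (F 0)]
  rw [Real.norm_eq_abs, Real.abs_exp, ← Real.exp_add, Real.exp_le_exp]
  calc s * F x ≤ |s| * |F x| := (le_abs_self _).trans (abs_mul _ _).le
    _ ≤ |s| * (|F 0| + K * ‖x‖) := by gcongr
    _ = |s| * |F 0| + |s| * K * ‖x‖ := by ring

variable {Ω : Type*} [MeasurableSpace Ω] {P : Measure Ω} [IsProbabilityMeasure P]

theorem hasDerivAt_cgf {X : Ω → ℝ} (hX : ∀ s, Integrable (fun ω => Real.exp (s * X ω)) P) (s : ℝ) :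
    HasDerivAt (cgf X P) (P[fun ω => X ω * Real.exp (s * X ω)] / mgf X P s) s := by
  have hs : s ∈ interior (integrableExpSet X P) := by
    rw [show integrableExpSet X P = Set.univ from Set.eq_univ_of_forall hX, interior_univ]
    trivial
  exact (hasDerivAt_mgf hs).log (mgf_pos (hX s)).ne'

/-- Divided by `s * mgf X P s`, the hypothesis bounds the derivative of the cumulant generating
function. -/
theorem hasSubgaussianMGF_sub_integral_of_mul_integral_le {X : Ω → ℝ} {V : ℝ≥0}
    (hX : ∀ s, Integrable (fun ω => Real.exp (s * X ω)) P)
    (h : ∀ s, s * P[fun ω => X ω * Real.exp (s * X ω)] ≤ (s * P[X] + s ^ 2 * V) * mgf X P s) :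
    HasSubgaussianMGF (fun ω => X ω - P[X]) V P := by
  have hshift : ∀ s ω, Real.exp (s * (X ω - P[X]))
      = Real.exp (s * X ω) * Real.exp (-(s * P[X])) := fun s ω => by
    rw [← Real.exp_add]
    ring_nf
  refine ⟨fun s => ?_, fun s => ?_⟩
  · simp only [hshift]
    exact (hX s).mul_const _
  have hleft : ∀ t, HasDerivAt (fun t => cgf X P (t * s))
      (P[fun ω => X ω * Real.exp (t * s * X ω)] / mgf X P (t * s) * s) t := fun t =>
    HasDerivAt.comp (h₂ := cgf X P) t (hasDerivAt_cgf hX (t * s)) (hasDerivAt_mul_const s)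
  have hright : ∀ t, HasDerivAt (fun t => t * (s * P[X]) + s ^ 2 * V / 2 * t ^ 2)
      (s * P[X] + s ^ 2 * V * t) t := fun t =>
    ((hasDerivAt_mul_const _).add ((hasDerivAt_pow 2 t).const_mul _)).congr_deriv (by
      push_cast
      ring)
  have hcgf := sub_le_sub_of_hasDerivAt_le zero_le_one hleft hright fun t ht => by
    rw [div_mul_eq_mul_div, div_le_iff₀ (mgf_pos (hX _))]
    refine le_of_mul_le_mul_left ?_ ht.1
    linarith [h (t * s)]
  have hcgf : cgf X P s ≤ s * P[X] + s ^ 2 * V / 2 := by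
    simpa using hcgf
  calc mgf (fun ω => X ω - P[X]) P s
      = Real.exp (cgf X P s) * Real.exp (-(s * P[X])) := by
        rw [exp_cgf (hX s), mgf, mgf, ← integral_mul_const]
        simp only [hshift]
    _ ≤ Real.exp (s * P[X] + s ^ 2 * V / 2) * Real.exp (-(s * P[X])) := by gcongr
    _ = Real.exp (V * s ^ 2 / 2) := by
        rw [← Real.exp_add]
        ring_nf

variable {ι : Type*} [Fintype ι] {γ : Measure (ι → ℝ)}

/-- The weight inserted at the first endpoint of the interpolation to produce exponential moments
of `F`. -/
noncomputable def expWeight (F : (ι → ℝ) → ℝ) (s : ℝ) (x : ι → ℝ) : ℝ := -s * Real.exp (s * F x)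

/-- The derivative of `expWeight F s`, where `G` is the gradient of `F`. -/
noncomputable def expWeightDeriv (F : (ι → ℝ) → ℝ) (G : ι → (ι → ℝ) → ℝ) (s : ℝ) (x : ι → ℝ) :
    StrongDual ℝ (ι → ℝ) :=
  (-s * s * Real.exp (s * F x)) •
    ∑ i, G i x • (ContinuousLinearMap.proj i : StrongDual ℝ (ι → ℝ))

namespace HasBoundedHessian

variable {F : (ι → ℝ) → ℝ} {G : ι → (ι → ℝ) → ℝ}
  {G' : ι → (ι → ℝ) → StrongDual ℝ (ι → ℝ)} {K V : ℝ≥0}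

theorem hasFDerivAt_expWeight (hF : HasBoundedHessian F G G' K) (s : ℝ) (x : ι → ℝ) :
    HasFDerivAt (expWeight F s) (expWeightDeriv F G s x) x :=
  (((hF.hasFDerivAt x).const_mul s).exp.const_mul (-s)).congr_fderiv (by
    simp only [expWeightDeriv, smul_smul]
    ring_nf)

theorem sum_interpolationRate_expWeight (s θ : ℝ) (z : (ι → ℝ) × (ι → ℝ)) :
    ∑ i, interpolationRate γ γ (expWeight F s) (expWeightDeriv F G s) (G i) (G' i) i θ z
      = s ^ 2 * Real.sin θ * Real.exp (s * F z.1)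
        * ∑ i, G i (gaussianInterpolate γ γ θ z) * ∑ j, G j z.1 * covRow γ i j := by
  rw [Finset.mul_sum]
  refine Finset.sum_congr rfl fun i _ => ?_
  simp only [interpolationRate, expWeightDeriv, sub_self, map_zero, smul_apply, sum_apply,
    ContinuousLinearMap.proj_apply, smul_eq_mul]
  ring

variable [IsGaussian γ]

theorem integrable_exp_mul (hF : HasBoundedHessian F G G' K) (s : ℝ) :
    Integrable (fun x => Real.exp (s * F x)) γ :=
  integrable_exp_mul_of_lipschitzWith γ hF.lipschitzWith s

theorem memLp_expWeight (hF : HasBoundedHessian F G G' K) (s : ℝ) :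
    MemLp (expWeight F s) 2 γ := by
  have hsq : Integrable (fun x => expWeight F s x ^ 2) γ := by
    refine ((hF.integrable_exp_mul (2 * s)).const_mul (s ^ 2)).congr (ae_of_all _ fun x => ?_)
    simp only [expWeight, mul_pow, neg_sq, ← Real.exp_nat_mul]
    ring_nf
  exact (memLp_two_iff_integrable_sq
    ((hF.integrable_exp_mul s).const_mul (-s)).aestronglyMeasurable).2 hsq

theorem integrable_expWeightDeriv (hF : HasBoundedHessian F G G' K) (s : ℝ) :
    Integrable (expWeightDeriv F G s) γ :=
  ((hF.integrable_exp_mul s).const_mul (-s * s)).smul_bdd K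
    (continuous_finsetSum _ fun i _ => (hF.continuous_gradient i).smul
      continuous_const).aestronglyMeasurable (ae_of_all _ fun x => hF.nnnorm_fderiv_le x)

theorem integral_sum_interpolationRate_expWeight_le (hF : HasBoundedHessian F G G' K)
    (hV : ∀ x y, ∑ i, G i y * ∑ j, G j x * covRow γ i j ≤ V) (s : ℝ) {θ : ℝ}
    (hsin : 0 ≤ Real.sin θ) :
    ∫ z, ∑ i, interpolationRate γ γ (expWeight F s) (expWeightDeriv F G s) (G i) (G' i) i θ z
        ∂(γ.prod γ)
      ≤ s ^ 2 * V * mgf F γ s * Real.sin θ := by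
  calc _ ≤ ∫ z, s ^ 2 * Real.sin θ * Real.exp (s * F z.1) * V ∂(γ.prod γ) := by
        refine integral_mono (integrable_finsetSum _ fun i _ => hF.integrable_interpolationRate
          ((hF.memLp_expWeight s).integrable one_le_two) (hF.integrable_expWeightDeriv s) i θ)
          ((((hF.integrable_exp_mul s).comp_fst γ).const_mul _).mul_const _) fun z => ?_
        rw [sum_interpolationRate_expWeight]
        exact mul_le_mul_of_nonneg_left (hV _ _) (by positivity)
    _ = s ^ 2 * V * mgf F γ s * Real.sin θ := by
        rw [integral_mul_const, integral_const_mul,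
          integral_fun_fst (fun x => Real.exp (s * F x)), probReal_univ, one_smul, mgf]
        ring

/-- Interpolating between two independent copies of `γ` computes the covariance of `F` with
`exp (s F)`. -/
theorem mul_integral_mul_exp_le (hF : HasBoundedHessian F G G' K)
    (hV : ∀ x y, ∑ i, G i y * ∑ j, G j x * covRow γ i j ≤ V) (s : ℝ) :
    s * γ[fun x => F x * Real.exp (s * F x)] ≤ (s * γ[F] + s ^ 2 * V) * mgf F γ s := by
  have hderiv := hF.hasDerivAt_integral_interpolate (δ := γ) (hF.hasFDerivAt_expWeight s)
    (hF.memLp_expWeight (γ := γ) s) (hF.integrable_expWeightDeriv s)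
  have hcos : ∀ θ, HasDerivAt (fun θ => -(s ^ 2 * V * mgf F γ s) * Real.cos θ)
      (s ^ 2 * V * mgf F γ s * Real.sin θ) θ := fun θ =>
    ((Real.hasDerivAt_cos θ).const_mul _).congr_deriv (by ring)
  have h := sub_le_sub_of_hasDerivAt_le Real.pi_div_two_pos.le hderiv hcos fun θ hθ =>
    hF.integral_sum_interpolationRate_expWeight_le hV s
      (Real.sin_pos_of_pos_of_lt_pi hθ.1 (by linarith [hθ.2, Real.pi_pos])).le
  have hzero : ∫ z, expWeight F s z.1 * F z.1 ∂(γ.prod γ)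
      = -s * γ[fun x => F x * Real.exp (s * F x)] := by
    rw [integral_fun_fst (fun x => expWeight F s x * F x), probReal_univ, one_smul,
      ← integral_const_mul]
    congr with x
    rw [expWeight]
    ring
  have hone : ∫ z, expWeight F s z.1 * F z.2 ∂(γ.prod γ) = -s * mgf F γ s * γ[F] := by
    rw [integral_prod_mul]
    simp only [expWeight, integral_const_mul, mgf]
  simp only [interpolate_zero, interpolate_pi_div_two, Real.cos_pi_div_two, Real.cos_zero, hzero,
    hone] at h
  linarith

theorem hasSubgaussianMGF (hF : HasBoundedHessian F G G' K)
    (hV : ∀ x y, ∑ i, G i y * ∑ j, G j x * covRow γ i j ≤ V) :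
    HasSubgaussianMGF (fun x => F x - γ[F]) V γ :=
  hasSubgaussianMGF_sub_integral_of_mul_integral_le
    (fun s => hF.integrable_exp_mul s) (hF.mul_integral_mul_exp_le hV)

end HasBoundedHessian

theorem covariance_le_of_variance_le {X Y : Ω → ℝ} (hX : MemLp X 2 P) (hY : MemLp Y 2 P) {V : ℝ}
    (hVX : Var[X; P] ≤ V) (hVY : Var[Y; P] ≤ V) : cov[X, Y; P] ≤ V := by
  have h := variance_nonneg (X - Y) P
  rw [variance_sub hX hY] at h
  linarith

end Concentration

section GaussianLaw

variable {ι : Type*} {Ω Ω' : Type*} [MeasurableSpace Ω] [MeasurableSpace Ω']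
  {P : Measure Ω} {P' : Measure Ω'} {X : ι → Ω → ℝ} {Y : ι → Ω' → ℝ}

theorem covRow_map (hX : HasGaussianLaw (fun ω i => X i ω) P) (i j : ι) :
    covRow (P.map fun ω i => X i ω) i j = cov[X i, X j; P] :=
  covariance_map_fun (measurable_pi_apply i).aestronglyMeasurable
    (measurable_pi_apply j).aestronglyMeasurable hX.aemeasurable

theorem coordMean_map (hX : HasGaussianLaw (fun ω i => X i ω) P) (i : ι) :
    coordMean (P.map fun ω i => X i ω) i = P[X i] :=
  integral_map hX.aemeasurable (measurable_pi_apply i).aestronglyMeasurable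

variable [Fintype ι] [Nonempty ι]

theorem continuous_logMeanExp : Continuous (logMeanExp : (ι → ℝ) → ℝ) :=
  continuous_iff_continuousAt.2 fun x => (hasFDerivAt_logMeanExp x).continuousAt

theorem integral_logMeanExp_map (hX : HasGaussianLaw (fun ω i => X i ω) P) :
    ∫ x, logMeanExp x ∂(P.map fun ω i => X i ω) = ∫ ω, logMeanExp (fun i => X i ω) ∂P :=
  integral_map hX.aemeasurable continuous_logMeanExp.aestronglyMeasurable

theorem integral_logMeanExp_le_of_covariance_le (hX : HasGaussianLaw (fun ω i => X i ω) P)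
    (hY : HasGaussianLaw (fun ω i => Y i ω) P') {D : ℝ}
    (hmean : ∀ i, P'[Y i] + cov[Y i, Y i; P'] / 2 ≤ P[X i] + cov[X i, X i; P] / 2)
    (hcov : ∀ i j, cov[X i, X j; P] ≤ cov[Y i, Y j; P'] + D) :
    ∫ ω, logMeanExp (fun i => Y i ω) ∂P' ≤ ∫ ω, logMeanExp (fun i => X i ω) ∂P + D / 2 := by
  have := hX.isGaussian_map
  have := hY.isGaussian_map
  rw [← integral_logMeanExp_map hX, ← integral_logMeanExp_map hY]
  exact integral_logMeanExp_le_of_covRow_le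
    (by simpa only [covRow_map hX, covRow_map hY, coordMean_map hX, coordMean_map hY] using hmean)
    (by simpa only [covRow_map hX, covRow_map hY] using hcov)

theorem hasSubgaussianMGF_logMeanExp (hX : HasGaussianLaw (fun ω i => X i ω) P) {V : ℝ≥0}
    (hV : ∀ i, cov[X i, X i; P] ≤ V) :
    HasSubgaussianMGF (fun ω => logMeanExp (fun i => X i ω)
      - ∫ ω, logMeanExp (fun i => X i ω) ∂P) V P := by
  have := hX.isGaussian_map
  have hcov : ∀ i j, covRow (P.map fun ω i => X i ω) i j ≤ V := fun i j => by
    have hvar : ∀ i, Var[fun x => x i; P.map fun ω i => X i ω] ≤ V := fun i => by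
      rw [← covariance_self (measurable_pi_apply i).aemeasurable]
      exact (covRow_map hX i i).trans_le (hV i)
    exact covariance_le_of_variance_le (memLp_eval_two _ i) (memLp_eval_two _ j) (hvar i) (hvar j)
  have hsub := hasBoundedHessian_logMeanExp.hasSubgaussianMGF (V := V)
    (γ := P.map fun ω i => X i ω) fun x y => by
      calc ∑ i, softmax i y * ∑ j, softmax j x * covRow (P.map fun ω i => X i ω) i j
          ≤ ∑ i, softmax i y * ∑ j, softmax j x * V := by
            gcongr with i _ j
            · exact softmax_nonneg i y
            · exact softmax_nonneg j x
            · exact hcov i j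
        _ = V := by simp only [← Finset.sum_mul, sum_softmax, one_mul]
  rw [integral_logMeanExp_map hX] at hsub
  exact hsub.of_map hX.aemeasurable

end GaussianLaw

section IntegralLimits

variable {Ω : Type*} [MeasurableSpace Ω] {P : Measure Ω}

/-- The truncation of a real number to `[-K, K]`. -/
def clamp (K x : ℝ) : ℝ := max (-K) (min x K)

theorem continuous_clamp (K : ℝ) : Continuous (clamp K) :=
  continuous_const.max (continuous_id.min continuous_const)

theorem abs_clamp_le {K : ℝ} (hK : 0 ≤ K) (x : ℝ) : |clamp K x| ≤ K :=
  abs_le.2 ⟨le_max_left _ _, max_le (by linarith) (min_le_right _ _)⟩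

theorem abs_sub_clamp_le {K : ℝ} (hK : 0 < K) (x : ℝ) : |x - clamp K x| ≤ x ^ 2 / K := by
  rw [le_div_iff₀ hK, clamp]
  rcases le_total x K with h₁ | h₁
  · rcases le_total (-K) x with h₂ | h₂
    · rw [min_eq_left h₁, max_eq_right h₂, sub_self, abs_zero, zero_mul]
      positivity
    · rw [min_eq_left h₁, max_eq_left h₂, abs_of_nonpos (by linarith)]
      nlinarith
  · rw [min_eq_right h₁, max_eq_right (by linarith), abs_of_nonneg (by linarith)]
    nlinarith

variable [IsFiniteMeasure P]

theorem abs_integral_sub_integral_clamp_le {φ : Ω → ℝ} (hφ : MemLp φ 2 P) {K : ℝ} (hK : 0 < K) :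
    |∫ ω, φ ω ∂P - ∫ ω, clamp K (φ ω) ∂P| ≤ (∫ ω, φ ω ^ 2 ∂P) / K := by
  have hint : Integrable φ P := hφ.integrable one_le_two
  have hclamp : Integrable (fun ω => clamp K (φ ω)) P :=
    (integrable_const K).mono' ((continuous_clamp K).comp_aestronglyMeasurable hφ.1)
      (ae_of_all _ fun ω => abs_clamp_le hK.le (φ ω))
  rw [← integral_sub hint hclamp, ← integral_div]
  exact abs_integral_le_integral_abs.trans <| integral_mono (hint.sub hclamp).abs
    (hφ.integrable_sq.div_const K) fun ω => abs_sub_clamp_le hK (φ ω)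

theorem tendsto_integral_of_integral_sq_le {φ : ℕ → Ω → ℝ} {ψ : Ω → ℝ} {C : ℝ}
    (hφ : ∀ n, MemLp (φ n) 2 P) (hC : ∀ n, ∫ ω, φ n ω ^ 2 ∂P ≤ C)
    (hψ : MemLp ψ 2 P) (hCψ : ∫ ω, ψ ω ^ 2 ∂P ≤ C)
    (hlim : ∀ᵐ ω ∂P, Tendsto (fun n => φ n ω) atTop (𝓝 (ψ ω))) :
    Tendsto (fun n => ∫ ω, φ n ω ∂P) atTop (𝓝 (∫ ω, ψ ω ∂P)) := by
  have hC0 : 0 ≤ C := (integral_nonneg fun ω => sq_nonneg _).trans hCψ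
  rw [Metric.tendsto_atTop]
  intro ε hε
  have hK : 0 < 4 * (C + 1) / ε := by positivity
  set K := 4 * (C + 1) / ε with hKdef
  have htrunc : ∀ {χ : Ω → ℝ}, MemLp χ 2 P → ∫ ω, χ ω ^ 2 ∂P ≤ C →
      |∫ ω, χ ω ∂P - ∫ ω, clamp K (χ ω) ∂P| ≤ ε / 4 := fun hχ hCχ => by
    refine (abs_integral_sub_integral_clamp_le hχ hK).trans ?_
    have hKε : ε / 4 * K = C + 1 := by
      rw [hKdef]
      field_simp
    rw [div_le_iff₀ hK]
    linarith
  have hclamp : Tendsto (fun n => ∫ ω, clamp K (φ n ω) ∂P) atTop (𝓝 (∫ ω, clamp K (ψ ω) ∂P)) :=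
    tendsto_integral_of_dominated_convergence (fun _ => K)
      (fun n => (continuous_clamp K).comp_aestronglyMeasurable (hφ n).1) (integrable_const K)
      (fun n => ae_of_all _ fun ω => abs_clamp_le hK.le (φ n ω))
      (hlim.mono fun ω hω => ((continuous_clamp K).tendsto _).comp hω)
  obtain ⟨N, hN⟩ := Metric.tendsto_atTop.1 hclamp (ε / 4) (by positivity)
  refine ⟨N, fun n hn => ?_⟩
  have hφn := abs_le.1 (htrunc (hφ n) (hC n))
  have hψ' := abs_le.1 (htrunc hψ hCψ)
  have hNn := abs_lt.1 ((Real.dist_eq _ _) ▸ hN n hn)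
  rw [Real.dist_eq, abs_lt]
  constructor <;> linarith [hφn.1, hφn.2, hψ'.1, hψ'.2, hNn.1, hNn.2]

end IntegralLimits

section Fatou

variable {Ω : Type*} [MeasurableSpace Ω] {P : Measure Ω}

theorem integrable_and_integral_le_of_tendsto {f : ℕ → Ω → ℝ} {g : Ω → ℝ} {C : ℕ → ℝ} {c : ℝ}
    (hf₀ : ∀ n ω, 0 ≤ f n ω) (hf : ∀ n, Integrable (f n) P) (hC : ∀ n, ∫ ω, f n ω ∂P ≤ C n)
    (hCc : Tendsto C atTop (𝓝 c)) (hlim : ∀ᵐ ω ∂P, Tendsto (fun n => f n ω) atTop (𝓝 (g ω))) :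
    Integrable g P ∧ ∫ ω, g ω ∂P ≤ c := by
  have hg₀ : 0 ≤ᵐ[P] g := hlim.mono fun ω hω => ge_of_tendsto' hω fun n => hf₀ n ω
  have hc₀ : 0 ≤ c := ge_of_tendsto' hCc fun n => (integral_nonneg (hf₀ n)).trans (hC n)
  have hfatou : ∫⁻ ω, ENNReal.ofReal (g ω) ∂P ≤ ENNReal.ofReal c := by
    calc ∫⁻ ω, ENNReal.ofReal (g ω) ∂P
        = ∫⁻ ω, liminf (fun n => ENNReal.ofReal (f n ω)) atTop ∂P :=
          lintegral_congr_ae <| hlim.mono fun ω hω => (ENNReal.tendsto_ofReal hω).liminf_eq.symm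
      _ ≤ liminf (fun n => ∫⁻ ω, ENNReal.ofReal (f n ω) ∂P) atTop :=
          lintegral_liminf_le' fun n => (hf n).1.aemeasurable.ennreal_ofReal
      _ ≤ liminf (fun n => ENNReal.ofReal (C n)) atTop := by
          refine liminf_le_liminf (Eventually.of_forall fun n => ?_)
          rw [← ofReal_integral_eq_lintegral_ofReal (hf n) (ae_of_all _ (hf₀ n))]
          exact ENNReal.ofReal_le_ofReal (hC n)
      _ = ENNReal.ofReal c := (ENNReal.tendsto_ofReal hCc).liminf_eq
  have hg : Integrable g P :=
    ⟨aestronglyMeasurable_of_tendsto_ae _ (fun n => (hf n).1) hlim,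
      (hasFiniteIntegral_iff_ofReal hg₀).2 (hfatou.trans_lt ENNReal.ofReal_lt_top)⟩
  refine ⟨hg, ?_⟩
  rwa [← ofReal_integral_eq_lintegral_ofReal hg hg₀, ENNReal.ofReal_le_ofReal_iff hc₀] at hfatou

theorem memLp_two_and_integral_sq_le_of_tendsto {φ : ℕ → Ω → ℝ} {ψ : Ω → ℝ} {C : ℝ}
    (hφ : ∀ n, MemLp (φ n) 2 P) (hC : ∀ n, ∫ ω, φ n ω ^ 2 ∂P ≤ C)
    (hlim : ∀ᵐ ω ∂P, Tendsto (fun n => φ n ω) atTop (𝓝 (ψ ω))) :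
    MemLp ψ 2 P ∧ ∫ ω, ψ ω ^ 2 ∂P ≤ C := by
  have hsq := integrable_and_integral_le_of_tendsto (fun n ω => sq_nonneg (φ n ω))
    (fun n => (hφ n).integrable_sq) hC tendsto_const_nhds (hlim.mono fun ω hω => hω.pow 2)
  exact ⟨(memLp_two_iff_integrable_sq
    (aestronglyMeasurable_of_tendsto_ae _ (fun n => (hφ n).1) hlim)).2 hsq.1, hsq.2⟩

theorem hasSubgaussianMGF_of_tendsto {X : ℕ → Ω → ℝ} {Y : Ω → ℝ} {V : ℝ≥0}
    (hX : ∀ n, HasSubgaussianMGF (X n) V P)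
    (hlim : ∀ᵐ ω ∂P, Tendsto (fun n => X n ω) atTop (𝓝 (Y ω))) : HasSubgaussianMGF Y V P := by
  have hfatou := fun s : ℝ => integrable_and_integral_le_of_tendsto
    (fun n ω => (Real.exp_pos (s * X n ω)).le) (fun n => (hX n).integrable_exp_mul s)
    (fun n => (hX n).mgf_le s) tendsto_const_nhds
    (hlim.mono fun ω hω => (Real.continuous_exp.tendsto _).comp (hω.const_mul s))
  exact ⟨fun s => (hfatou s).1, fun s => (hfatou s).2⟩

end Fatou

section StrongLaw

variable {T : Type*} [MeasurableSpace T] (μ : Measure T) [IsProbabilityMeasure μ]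

theorem ae_tendsto_average_infinitePi {f : T → ℝ} (hf : Measurable f) (hint : Integrable f μ) :
    ∀ᵐ t ∂(Measure.infinitePi fun _ : ℕ => μ),
      Tendsto (fun n : ℕ => (∑ i ∈ Finset.range n, f (t i)) / n) atTop (𝓝 (∫ t, f t ∂μ)) := by
  have hpres : ∀ i : ℕ, MeasurePreserving (Function.eval i) (Measure.infinitePi fun _ : ℕ => μ) μ :=
    fun i => measurePreserving_eval_infinitePi (fun _ => μ) i
  have hident : ∀ i : ℕ, IdentDistrib (fun t : ℕ → T => f (t i)) f
      (Measure.infinitePi fun _ => μ) μ := fun i =>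
    (IdentDistrib.mk (hpres i).aemeasurable aemeasurable_id
      ((hpres i).map_eq.trans Measure.map_id.symm)).comp hf
  rw [← (hident 0).integral_eq]
  exact strong_law_ae_real (fun i (t : ℕ → T) => f (t i))
    ((hident 0).integrable_iff.2 hint)
    (fun i j hij => (iIndepFun_infinitePi (P := fun _ => μ) fun _ => hf).indepFun hij)
    fun i => (hident i).trans (hident 0).symm

end StrongLaw

section LogMeanExpBounds

variable {ι : Type*} [Fintype ι] [Nonempty ι]

theorem exp_logMeanExp (x : ι → ℝ) :
    Real.exp (logMeanExp x) = (∑ i, Real.exp (x i)) / Fintype.card ι :=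
  Real.exp_log (div_pos (sum_exp_pos x) (Nat.cast_pos.2 Fintype.card_pos))

theorem exp_neg_logMeanExp_le (x : ι → ℝ) :
    Real.exp (-logMeanExp x) ≤ (∑ i, Real.exp (-x i)) / Fintype.card ι := by
  have h := Finset.sum_mul_sq_le_sq_mul_sq Finset.univ (fun i => Real.exp (x i / 2))
    (fun i => Real.exp (-x i / 2))
  have hmul : ∀ i, Real.exp (x i / 2) * Real.exp (-x i / 2) = 1 := fun i => by
    rw [← Real.exp_add, neg_div, add_neg_cancel, Real.exp_zero]
  have hsq : ∀ y : ℝ, Real.exp (y / 2) ^ 2 = Real.exp y := fun y => by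
    rw [← Real.exp_nat_mul, Nat.cast_ofNat, mul_div_cancel₀ y two_ne_zero]
  simp only [hmul, hsq, Finset.sum_const, Finset.card_univ, nsmul_eq_mul, mul_one] at h
  rw [Real.exp_neg, exp_logMeanExp, inv_div,
    div_le_div_iff₀ (sum_exp_pos x) (Nat.cast_pos.2 Fintype.card_pos), ← sq, mul_comm]
  exact h

theorem sq_le_exp_add_exp_neg (x : ℝ) : x ^ 2 ≤ 2 * (Real.exp x + Real.exp (-x)) := by
  have h := Real.quadratic_le_exp_of_nonneg (abs_nonneg x)
  rw [sq_abs] at h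
  linarith [Real.exp_abs_le x, abs_nonneg x]

theorem sq_logMeanExp_le (x : ι → ℝ) :
    logMeanExp x ^ 2 ≤ 2 * ((∑ i, Real.exp (1 * x i)) / Fintype.card ι
      + (∑ i, Real.exp (-1 * x i)) / Fintype.card ι) := by
  simp only [one_mul, neg_one_mul]
  exact (sq_le_exp_add_exp_neg _).trans (mul_le_mul_of_nonneg_left
    (add_le_add (exp_logMeanExp x).le (exp_neg_logMeanExp_le x)) two_pos.le)

end LogMeanExpBounds

/-- The exponential integral `∫ exp (X t ω) ∂μ(t)`: for `X = -β H` and a product measure `μ` this is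
the partition function. -/
noncomputable def expIntegral {T Ω : Type*} [MeasurableSpace T] (X : T → Ω → ℝ) (μ : Measure T)
    (ω : Ω) : ℝ := ∫ t, Real.exp (X t ω) ∂μ

/-- A jointly measurable Gaussian process with means in `[-B, B]` and variances at most `V`. -/
structure IsBoundedGaussian {T Ω : Type*} [MeasurableSpace T] [MeasurableSpace Ω]
    (X : T → Ω → ℝ) (P : Measure Ω) (B : ℝ) (V : ℝ≥0) : Prop where
  measurable : Measurable (fun p : T × Ω => X p.1 p.2)
  gaussian : IsGaussianProcess X P
  mean_le : ∀ t, |∫ ω, X t ω ∂P| ≤ B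
  cov_le : ∀ t, cov[X t, X t; P] ≤ V

theorem hasGaussianLaw_pi {T Ω ι : Type*} [MeasurableSpace Ω] {X : T → Ω → ℝ} {P : Measure Ω}
    [Finite ι] (hX : IsGaussianProcess X P) (t : ι → T) :
    HasGaussianLaw (fun ω i => X (t i) ω) P := by
  have := Fintype.ofFinite ι
  let L : ({i // i ∈ (Finset.univ : Finset ι)} → ℝ) →L[ℝ] (ι → ℝ) :=
    ContinuousLinearMap.pi fun i => ContinuousLinearMap.proj ⟨i, Finset.mem_univ i⟩
  exact ((hX.comp_right t).hasGaussianLaw Finset.univ).map L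

namespace IsBoundedGaussian

section Moments

variable {T Ω : Type*} [MeasurableSpace T] [MeasurableSpace Ω] {X : T → Ω → ℝ} {P : Measure Ω}
  {B : ℝ} {V : ℝ≥0}

theorem measurable_left (hX : IsBoundedGaussian X P B V) (ω : Ω) : Measurable fun t => X t ω :=
  hX.measurable.comp measurable_prodMk_right

theorem measurable_right (hX : IsBoundedGaussian X P B V) (t : T) : Measurable (X t) :=
  hX.measurable.comp measurable_prodMk_left

theorem measurable_expIntegral (hX : IsBoundedGaussian X P B V) (μ : Measure T) [SFinite μ] :
    Measurable (expIntegral X μ) :=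
  (hX.measurable.exp.stronglyMeasurable.integral_prod_left' (μ := μ)).measurable

theorem integrable (hX : IsBoundedGaussian X P B V) (t : T) : Integrable (X t) P :=
  (hX.gaussian.hasGaussianLaw_eval t).integrable

theorem integrable_exp_mul (hX : IsBoundedGaussian X P B V) (t : T) (s : ℝ) :
    Integrable (fun ω => Real.exp (s * X t ω)) P := by
  have h := integrable_exp_mul_gaussianReal (μ := P[X t]) (v := Var[X t; P].toNNReal) s
  rwa [← (hX.gaussian.hasGaussianLaw_eval t).map_eq_gaussianReal,
    integrable_map_measure (by fun_prop) (hX.measurable_right t).aemeasurable] at h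

theorem integral_exp_mul_le (hX : IsBoundedGaussian X P B V) (t : T) {s : ℝ} (hs : |s| = 1) :
    ∫ ω, Real.exp (s * X t ω) ∂P ≤ Real.exp (B + V / 2) := by
  have hmgf := mgf_gaussianReal (hX.gaussian.hasGaussianLaw_eval t).map_eq_gaussianReal s
  rw [mgf, Real.coe_toNNReal _ (variance_nonneg _ _), ← sq_abs s, hs, one_pow, mul_one,
    ← covariance_self (hX.measurable_right t).aemeasurable] at hmgf
  rw [hmgf, Real.exp_le_exp]
  have hmean : P[X t] * s ≤ B := by
    calc P[X t] * s ≤ |P[X t]| * |s| := (le_abs_self _).trans (abs_mul _ _).le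
      _ ≤ B := by
        rw [hs, mul_one]
        exact hX.mean_le t
  linarith [hX.cov_le t]

variable {ι : Type*} [Fintype ι]

theorem integrable_average_exp (hX : IsBoundedGaussian X P B V) (t : ι → T) (s : ℝ) :
    Integrable (fun ω => (∑ i, Real.exp (s * X (t i) ω)) / Fintype.card ι) P :=
  (integrable_finsetSum _ fun i _ => hX.integrable_exp_mul (t i) s).div_const _

variable [Nonempty ι]

theorem integral_average_exp_le (hX : IsBoundedGaussian X P B V) (t : ι → T) {s : ℝ}
    (hs : |s| = 1) :
    ∫ ω, (∑ i, Real.exp (s * X (t i) ω)) / Fintype.card ι ∂P ≤ Real.exp (B + V / 2) := by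
  rw [integral_div, integral_finsetSum _ fun i _ => hX.integrable_exp_mul (t i) s,
    div_le_iff₀ (Nat.cast_pos.2 Fintype.card_pos), mul_comm, ← nsmul_eq_mul]
  exact Finset.sum_le_card_nsmul _ _ _ fun i _ => hX.integral_exp_mul_le (t i) hs

theorem memLp_logMeanExp (hX : IsBoundedGaussian X P B V) (t : ι → T) :
    MemLp (fun ω => logMeanExp fun i => X (t i) ω) 2 P := by
  have hmeas : Measurable fun ω => logMeanExp fun i => X (t i) ω :=
    continuous_logMeanExp.measurable.comp (measurable_pi_lambda _ fun i =>
      hX.measurable_right (t i))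
  refine (memLp_two_iff_integrable_sq hmeas.aestronglyMeasurable).2 ?_
  refine (((hX.integrable_average_exp t 1).add (hX.integrable_average_exp t (-1))).const_mul
    2).mono' (hmeas.pow_const 2).aestronglyMeasurable (ae_of_all _ fun ω => ?_)
  rw [Real.norm_eq_abs, abs_of_nonneg (sq_nonneg _)]
  exact sq_logMeanExp_le _

theorem integral_sq_logMeanExp_le (hX : IsBoundedGaussian X P B V) (t : ι → T) :
    ∫ ω, (logMeanExp fun i => X (t i) ω) ^ 2 ∂P ≤ 4 * Real.exp (B + V / 2) := by
  have hint := hX.integrable_average_exp t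
  refine (integral_mono (hX.memLp_logMeanExp t).integrable_sq
    (((hint 1).add (hint (-1))).const_mul 2) fun ω => sq_logMeanExp_le _).trans ?_
  rw [integral_const_mul, integral_add' (hint 1) (hint (-1))]
  linarith [hX.integral_average_exp_le t abs_one,
    hX.integral_average_exp_le t (s := -1) (by rw [abs_neg, abs_one])]

end Moments

variable {T Ω : Type*} [MeasurableSpace T] [MeasurableSpace Ω] {X : T → Ω → ℝ} {P : Measure Ω}
  [IsProbabilityMeasure P] {B : ℝ} {V : ℝ≥0}

theorem integrable_exp_prod (hX : IsBoundedGaussian X P B V) (μ : Measure T) [IsFiniteMeasure μ] :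
    Integrable (fun p : T × Ω => Real.exp (X p.1 p.2)) (μ.prod P) := by
  have hmeas : Measurable (fun p : T × Ω => Real.exp (X p.1 p.2)) := hX.measurable.exp
  rw [integrable_prod_iff hmeas.aestronglyMeasurable]
  refine ⟨ae_of_all _ fun t => by simpa using hX.integrable_exp_mul t 1, ?_⟩
  refine (integrable_const (Real.exp (B + V / 2))).mono'
    hmeas.norm.stronglyMeasurable.integral_prod_right.aestronglyMeasurable (ae_of_all _ fun t => ?_)
  rw [Real.norm_eq_abs, abs_of_nonneg (integral_nonneg fun ω => norm_nonneg _)]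
  simpa using hX.integral_exp_mul_le t abs_one

theorem ae_integrable_exp (hX : IsBoundedGaussian X P B V) (μ : Measure T) [IsFiniteMeasure μ] :
    ∀ᵐ ω ∂P, Integrable (fun t => Real.exp (X t ω)) μ :=
  (hX.integrable_exp_prod μ).prod_left_ae

theorem ae_expIntegral_pos (hX : IsBoundedGaussian X P B V) (μ : Measure T) [IsFiniteMeasure μ]
    [NeZero μ] : ∀ᵐ ω ∂P, 0 < expIntegral X μ ω :=
  (hX.ae_integrable_exp μ).mono fun _ hω => integral_exp_pos hω

section ProbabilityMeasure

variable (μ : Measure T) [IsProbabilityMeasure μ]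

theorem ae_tendsto_average (hX : IsBoundedGaussian X P B V) :
    ∀ᵐ t ∂(Measure.infinitePi fun _ : ℕ => μ), ∀ᵐ ω ∂P,
      Tendsto (fun n : ℕ => (∑ i ∈ Finset.range n, Real.exp (X (t i) ω)) / n) atTop
        (𝓝 (expIntegral X μ ω)) := by
  have hmeas : ∀ i : ℕ, Measurable fun p : (ℕ → T) × Ω => X (p.1 i) p.2 := fun i => by
    have hproj : Measurable fun p : (ℕ → T) × Ω => (p.1 i, p.2) := by fun_prop
    exact hX.measurable.comp hproj
  rw [Measure.ae_ae_comm (measurableSet_tendsto_fun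
    (fun n => (Finset.measurable_sum _ fun i _ => (hmeas i).exp).div_const _)
    ((hX.measurable_expIntegral μ).comp measurable_snd))]
  exact (hX.ae_integrable_exp μ).mono fun ω hω =>
    ae_tendsto_average_infinitePi μ (hX.measurable_left ω).exp hω

theorem ae_tendsto_logMeanExp (hX : IsBoundedGaussian X P B V) :
    ∀ᵐ t ∂(Measure.infinitePi fun _ : ℕ => μ), ∀ᵐ ω ∂P,
      Tendsto (fun n : ℕ => logMeanExp fun i : Fin (n + 1) => X (t i) ω) atTop
        (𝓝 (Real.log (expIntegral X μ ω))) := by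
  filter_upwards [hX.ae_tendsto_average μ] with t ht
  filter_upwards [ht, hX.ae_expIntegral_pos μ] with ω hω hpos
  refine ((Real.continuousAt_log hpos.ne').tendsto.comp
    (hω.comp (tendsto_add_atTop_nat 1))).congr fun n => ?_
  simp only [Function.comp, logMeanExp, Fintype.card_fin, Finset.sum_range]

theorem ae_tendsto_integral_logMeanExp (hX : IsBoundedGaussian X P B V) :
    ∀ᵐ t ∂(Measure.infinitePi fun _ : ℕ => μ),
      Tendsto (fun n : ℕ => ∫ ω, logMeanExp (fun i : Fin (n + 1) => X (t i) ω) ∂P) atTop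
        (𝓝 (∫ ω, Real.log (expIntegral X μ ω) ∂P)) := by
  filter_upwards [hX.ae_tendsto_logMeanExp μ] with t ht
  have hmem := fun n : ℕ => hX.memLp_logMeanExp fun i : Fin (n + 1) => t i
  have hle := fun n : ℕ => hX.integral_sq_logMeanExp_le fun i : Fin (n + 1) => t i
  have hlim := memLp_two_and_integral_sq_le_of_tendsto hmem hle ht
  exact tendsto_integral_of_integral_sq_le hmem hle hlim.1 hlim.2 ht

theorem integrable_log_of_isProbabilityMeasure (hX : IsBoundedGaussian X P B V) :
    Integrable (fun ω => Real.log (expIntegral X μ ω)) P := by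
  obtain ⟨t, ht⟩ := (hX.ae_tendsto_logMeanExp μ).exists
  exact (memLp_two_and_integral_sq_le_of_tendsto
    (fun n : ℕ => hX.memLp_logMeanExp fun i : Fin (n + 1) => t i)
    (fun n => hX.integral_sq_logMeanExp_le _) ht).1.integrable one_le_two

theorem hasSubgaussianMGF_log_of_isProbabilityMeasure (hX : IsBoundedGaussian X P B V) :
    HasSubgaussianMGF (fun ω => Real.log (expIntegral X μ ω)
      - ∫ ω, Real.log (expIntegral X μ ω) ∂P) V P := by
  obtain ⟨t, hlim, hmean⟩ :=
    ((hX.ae_tendsto_logMeanExp μ).and (hX.ae_tendsto_integral_logMeanExp μ)).exists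
  exact hasSubgaussianMGF_of_tendsto
    (fun n => hasSubgaussianMGF_logMeanExp
      (hasGaussianLaw_pi hX.gaussian fun i : Fin (n + 1) => t i) fun i => hX.cov_le _)
    (hlim.mono fun ω hω => hω.sub hmean)

theorem integral_log_le_of_isProbabilityMeasure {Ω' : Type*} [MeasurableSpace Ω']
    {P' : Measure Ω'} [IsProbabilityMeasure P'] {Y : T → Ω' → ℝ} {B' : ℝ} {V' : ℝ≥0}
    (hX : IsBoundedGaussian X P B V) (hY : IsBoundedGaussian Y P' B' V') {D : ℝ}
    (hmean : ∀ t, P'[Y t] + cov[Y t, Y t; P'] / 2 ≤ P[X t] + cov[X t, X t; P] / 2)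
    (hcov : ∀ s t, cov[X s, X t; P] ≤ cov[Y s, Y t; P'] + D) :
    ∫ ω, Real.log (expIntegral Y μ ω) ∂P' ≤ ∫ ω, Real.log (expIntegral X μ ω) ∂P + D / 2 := by
  obtain ⟨t, hXt, hYt⟩ :=
    ((hX.ae_tendsto_integral_logMeanExp μ).and (hY.ae_tendsto_integral_logMeanExp μ)).exists
  exact le_of_tendsto_of_tendsto' hYt (hXt.add_const (D / 2)) fun n =>
    integral_logMeanExp_le_of_covariance_le
      (hasGaussianLaw_pi hX.gaussian fun i : Fin (n + 1) => t i)
      (hasGaussianLaw_pi hY.gaussian _) (fun i => hmean _) fun i j => hcov _ _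

end ProbabilityMeasure

end IsBoundedGaussian

instance neZero_prod {α γ : Type*} [MeasurableSpace α] [MeasurableSpace γ] (μ : Measure α)
    (ν : Measure γ) [SFinite ν] [NeZero μ] [NeZero ν] : NeZero (μ.prod ν) := by
  refine ⟨fun h => ?_⟩
  have huniv := Measure.prod_prod (μ := μ) (ν := ν) Set.univ Set.univ
  rw [h, Measure.coe_zero, Pi.zero_apply] at huniv
  exact mul_ne_zero (NeZero.ne _) (NeZero.ne _) huniv.symm

instance neZero_pi {ι : Type*} [Fintype ι] {α : ι → Type*} [∀ i, MeasurableSpace (α i)]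
    (μ : ∀ i, Measure (α i)) [∀ i, SigmaFinite (μ i)] [∀ i, NeZero (μ i)] :
    NeZero (Measure.pi μ) := by
  refine ⟨fun h => ?_⟩
  have huniv := Measure.pi_univ μ
  rw [h, Measure.coe_zero, Pi.zero_apply] at huniv
  exact Finset.prod_ne_zero_iff.2 (fun i _ => NeZero.ne _) huniv.symm

theorem neZero_of_le {α : Type*} [MeasurableSpace α] {μ μ' : Measure α} [NeZero μ] (h : μ ≤ μ') :
    NeZero μ' :=
  ⟨fun h0 => NeZero.ne μ (le_antisymm (h.trans h0.le) (Measure.zero_le μ))⟩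

theorem le_sum_restrict {α ι : Type*} [MeasurableSpace α] [Fintype ι] (μ : Measure α)
    {A : ι → Set α} (hA : ∀ t, ∃ i, t ∈ A i) : μ ≤ ∑ i, μ.restrict (A i) := by
  calc μ = μ.restrict (⋃ i, A i) := by rw [Set.iUnion_eq_univ_iff.2 hA, Measure.restrict_univ]
    _ ≤ Measure.sum fun i => μ.restrict (A i) := Measure.restrict_iUnion_le
    _ = ∑ i, μ.restrict (A i) := Measure.sum_fintype _

theorem integral_abs_le_of_hasSubgaussianMGF {Ω : Type*} [MeasurableSpace Ω] {P : Measure Ω}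
    {Y : Ω → ℝ} {V : ℝ≥0} (hY : HasSubgaussianMGF Y V P) {l : ℝ} (hl : 0 < l) :
    ∫ ω, |Y ω| ∂P ≤ 2 * Real.exp (V * l ^ 2 / 2) / l := by
  have hle : ∀ ω, |Y ω| ≤ (Real.exp (l * Y ω) + Real.exp (-l * Y ω)) / l := fun ω => by
    have habs : |Y ω| * l = |l * Y ω| := by rw [abs_mul, abs_of_pos hl, mul_comm]
    rw [le_div_iff₀ hl, habs, abs_le]
    have hpos := Real.add_one_le_exp (l * Y ω)
    have hneg := Real.add_one_le_exp (-l * Y ω)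
    constructor <;> linarith [Real.exp_pos (l * Y ω), Real.exp_pos (-l * Y ω)]
  have hint := hY.integrable_exp_mul
  have hpos := hY.mgf_le l
  have hneg := hY.mgf_le (-l)
  rw [neg_sq] at hneg
  refine (integral_mono hY.integrable.abs (((hint l).add (hint (-l))).div_const l) hle).trans ?_
  rw [integral_div, integral_add' (hint l) (hint (-l))]
  gcongr
  unfold mgf at hpos hneg
  linarith

/-- The mean of the logarithm of the exponential integral, `E log Z`. -/
noncomputable def meanLog {T Ω : Type*} [MeasurableSpace T] [MeasurableSpace Ω] (X : T → Ω → ℝ)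
    (μ : Measure T) (P : Measure Ω) : ℝ := ∫ ω, Real.log (expIntegral X μ ω) ∂P

namespace IsBoundedGaussian

section Moments

variable {T Ω : Type*} [MeasurableSpace T] [MeasurableSpace Ω] {X : T → Ω → ℝ} {P : Measure Ω}
  {B : ℝ} {V : ℝ≥0}

theorem meanLog_map {T' : Type*} [MeasurableSpace T'] (hX : IsBoundedGaussian X P B V)
    {φ : T' → T} (hφ : Measurable φ) (μ : Measure T') :
    meanLog X (μ.map φ) P = meanLog (fun t => X (φ t)) μ P :=
  integral_congr_ae (ae_of_all _ fun ω => congrArg Real.log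
    (integral_map hφ.aemeasurable (hX.measurable_left ω).exp.aestronglyMeasurable))

theorem integral_expIntegral_le (hX : IsBoundedGaussian X P B V) (μ : Measure T)
    [IsFiniteMeasure μ] [IsProbabilityMeasure P] :
    ∫ ω, expIntegral X μ ω ∂P ≤ μ.real Set.univ * Real.exp (B + V / 2) := by
  have hint := hX.integrable_exp_prod μ
  calc ∫ ω, ∫ t, Real.exp (X t ω) ∂μ ∂P
      = ∫ t, ∫ ω, Real.exp (X t ω) ∂P ∂μ :=
        integral_integral_swap (f := fun ω t => Real.exp (X t ω)) hint.swap
    _ ≤ ∫ _, Real.exp (B + V / 2) ∂μ :=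
        integral_mono hint.integral_prod_left (integrable_const _) fun t => by
          simpa using hX.integral_exp_mul_le t abs_one
    _ = μ.real Set.univ * Real.exp (B + V / 2) := by rw [integral_const, smul_eq_mul]

end Moments

section FiniteMeasure

variable {T Ω : Type*} [MeasurableSpace T] [MeasurableSpace Ω] {X : T → Ω → ℝ} {P : Measure Ω}
  [IsProbabilityMeasure P] {B : ℝ} {V : ℝ≥0} (μ : Measure T) [IsFiniteMeasure μ] [NeZero μ]

theorem log_expIntegral_ae_eq (hX : IsBoundedGaussian X P B V) :
    (fun ω => Real.log (expIntegral X μ ω)) =ᵐ[P]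
      fun ω => Real.log (μ.real Set.univ) + Real.log (expIntegral X ((μ Set.univ)⁻¹ • μ) ω) := by
  have hmass : μ.real Set.univ ≠ 0 := measureReal_univ_ne_zero
  filter_upwards [hX.ae_expIntegral_pos ((μ Set.univ)⁻¹ • μ)] with ω hω
  rw [← Real.log_mul hmass hω.ne', expIntegral, expIntegral, integral_smul_measure,
    ENNReal.toReal_inv, smul_eq_mul, ← measureReal_def, mul_inv_cancel_left₀ hmass]

theorem integrable_log (hX : IsBoundedGaussian X P B V) :
    Integrable (fun ω => Real.log (expIntegral X μ ω)) P :=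
  ((integrable_const _).add (hX.integrable_log_of_isProbabilityMeasure
    ((μ Set.univ)⁻¹ • μ))).congr (hX.log_expIntegral_ae_eq μ).symm

theorem meanLog_eq (hX : IsBoundedGaussian X P B V) :
    meanLog X μ P = Real.log (μ.real Set.univ) + meanLog X ((μ Set.univ)⁻¹ • μ) P := by
  rw [meanLog, integral_congr_ae (hX.log_expIntegral_ae_eq μ), integral_add (integrable_const _)
    (hX.integrable_log_of_isProbabilityMeasure _), integral_const, probReal_univ, one_smul, meanLog]

theorem hasSubgaussianMGF_log (hX : IsBoundedGaussian X P B V) :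
    HasSubgaussianMGF (fun ω => Real.log (expIntegral X μ ω) - meanLog X μ P) V P := by
  refine (hX.hasSubgaussianMGF_log_of_isProbabilityMeasure ((μ Set.univ)⁻¹ • μ)).congr ?_
  filter_upwards [hX.log_expIntegral_ae_eq μ] with ω hω
  rw [hω, hX.meanLog_eq μ, add_sub_add_left_eq_sub, meanLog]

theorem meanLog_le_of_covariance_le {Ω' : Type*} [MeasurableSpace Ω'] {P' : Measure Ω'}
    [IsProbabilityMeasure P'] {Y : T → Ω' → ℝ} {B' : ℝ} {V' : ℝ≥0}
    (hX : IsBoundedGaussian X P B V) (hY : IsBoundedGaussian Y P' B' V') {D : ℝ}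
    (hmean : ∀ t, P'[Y t] + cov[Y t, Y t; P'] / 2 ≤ P[X t] + cov[X t, X t; P] / 2)
    (hcov : ∀ s t, cov[X s, X t; P] ≤ cov[Y s, Y t; P'] + D) :
    meanLog Y μ P' ≤ meanLog X μ P + D / 2 := by
  rw [hX.meanLog_eq μ, hY.meanLog_eq μ, add_assoc]
  exact add_le_add_right
    (hX.integral_log_le_of_isProbabilityMeasure ((μ Set.univ)⁻¹ • μ) hY hmean hcov) _

theorem meanLog_le (hX : IsBoundedGaussian X P B V) :
    meanLog X μ P ≤ Real.log (μ.real Set.univ) + (B + V / 2) := by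
  have hmass : 0 < μ.real Set.univ := measureReal_univ_pos
  obtain ⟨c, hc⟩ : ∃ c, c = μ.real Set.univ * Real.exp (B + V / 2) := ⟨_, rfl⟩
  have hc_pos : 0 < c := hc ▸ mul_pos hmass (Real.exp_pos _)
  have hZ : Integrable (expIntegral X μ) P := (hX.integrable_exp_prod μ).integral_prod_right
  have htangent : ∀ᵐ ω ∂P, Real.log (expIntegral X μ ω)
      ≤ expIntegral X μ ω / c + (Real.log c - 1) := by
    filter_upwards [hX.ae_expIntegral_pos μ] with ω hω
    have hlog := Real.log_le_sub_one_of_pos (div_pos hω hc_pos)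
    rw [Real.log_div hω.ne' hc_pos.ne'] at hlog
    linarith
  calc meanLog X μ P ≤ ∫ ω, (expIntegral X μ ω / c + (Real.log c - 1)) ∂P :=
        integral_mono_ae (hX.integrable_log μ) ((hZ.div_const c).add (integrable_const _)) htangent
    _ = (∫ ω, expIntegral X μ ω ∂P) / c + (Real.log c - 1) := by
        rw [integral_add (hZ.div_const c) (integrable_const _), integral_div, integral_const,
          probReal_univ, one_smul]
    _ ≤ 1 + (Real.log c - 1) := by
        gcongr
        exact (div_le_one hc_pos).2 ((hX.integral_expIntegral_le μ).trans hc.ge)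
    _ = Real.log (μ.real Set.univ) + (B + V / 2) := by
        rw [hc, Real.log_mul hmass.ne' (Real.exp_pos _).ne', Real.log_exp]
        ring

theorem meanLog_mono {X' : T → Ω → ℝ} {B' : ℝ} {V' : ℝ≥0} {μ' : Measure T} [IsFiniteMeasure μ']
    (hX : IsBoundedGaussian X P B V) (hX' : IsBoundedGaussian X' P B' V') (hμ : μ ≤ μ') {c : ℝ}
    (hc : ∀ᵐ t ∂μ, ∀ ω, X t ω ≤ X' t ω + c) :
    meanLog X μ P ≤ meanLog X' μ' P + c := by
  have : NeZero μ' := neZero_of_le hμ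
  have hadd : meanLog X' μ' P + c = ∫ ω, (Real.log (expIntegral X' μ' ω) + c) ∂P := by
    rw [integral_add (hX'.integrable_log μ') (integrable_const c), integral_const, probReal_univ,
      one_smul, meanLog]
  rw [hadd]
  refine integral_mono_ae (hX.integrable_log μ)
    ((hX'.integrable_log μ').add (integrable_const c)) ?_
  filter_upwards [hX.ae_integrable_exp μ, hX'.ae_integrable_exp μ', hX.ae_expIntegral_pos μ,
    hX'.ae_expIntegral_pos μ'] with ω hint hint' hpos hpos'
  rw [← Real.log_exp c, ← Real.log_mul hpos'.ne' (Real.exp_pos c).ne']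
  refine Real.log_le_log hpos ?_
  calc ∫ t, Real.exp (X t ω) ∂μ ≤ ∫ t, Real.exp (X' t ω) * Real.exp c ∂μ := by
        refine integral_mono_ae hint ((hint'.mono_measure hμ).mul_const _) ?_
        filter_upwards [hc] with t ht
        rw [← Real.exp_add]
        exact Real.exp_le_exp.2 (ht ω)
    _ = (∫ t, Real.exp (X' t ω) ∂μ) * Real.exp c := integral_mul_const _ _
    _ ≤ (∫ t, Real.exp (X' t ω) ∂μ') * Real.exp c :=
        mul_le_mul_of_nonneg_right
          (integral_mono_measure hμ (ae_of_all _ fun t => (Real.exp_pos _).le) hint')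
          (Real.exp_pos c).le

variable {ι : Type*} [Fintype ι]

theorem ae_log_expIntegral_le_of_le_sum (hX : IsBoundedGaussian X P B V) {ν : ι → Measure T}
    [∀ i, IsFiniteMeasure (ν i)] [∀ i, NeZero (ν i)] (hμ : μ ≤ ∑ i, ν i) {a : ℝ}
    (ha : ∀ i, meanLog X (ν i) P ≤ a) :
    ∀ᵐ ω ∂P, Real.log (expIntegral X μ ω) ≤ a + Real.log (Fintype.card ι)
      + ∑ i, |Real.log (expIntegral X (ν i) ω) - meanLog X (ν i) P| := by
  filter_upwards [hX.ae_expIntegral_pos μ, ae_all_iff.2 fun i => hX.ae_integrable_exp (ν i),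
    ae_all_iff.2 fun i => hX.ae_expIntegral_pos (ν i)] with ω hpos hint hpos_ν
  set r := a + ∑ i, |Real.log (expIntegral X (ν i) ω) - meanLog X (ν i) P| with hr
  have hpiece : ∀ i, expIntegral X (ν i) ω ≤ Real.exp r := fun i => by
    rw [← Real.log_le_iff_le_exp (hpos_ν i)]
    have hsingle := Finset.single_le_sum (f := fun i =>
      |Real.log (expIntegral X (ν i) ω) - meanLog X (ν i) P|) (fun j _ => abs_nonneg _)
      (Finset.mem_univ i)
    linarith [ha i, le_abs_self (Real.log (expIntegral X (ν i) ω) - meanLog X (ν i) P)]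
  have hsum : expIntegral X μ ω ≤ Fintype.card ι * Real.exp r := by
    calc expIntegral X μ ω ≤ ∫ t, Real.exp (X t ω) ∂(∑ i, ν i) :=
          integral_mono_measure hμ (ae_of_all _ fun t => (Real.exp_pos _).le)
            (integrable_finsetSum_measure.2 fun i _ => hint i)
      _ = ∑ i, expIntegral X (ν i) ω := integral_finsetSum_measure fun i _ => hint i
      _ ≤ Fintype.card ι * Real.exp r := by
          rw [← nsmul_eq_mul]
          exact Finset.sum_le_card_nsmul _ _ _ fun i _ => hpiece i
  have hcard : (Fintype.card ι : ℝ) ≠ 0 := fun h0 => by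
    rw [h0, zero_mul] at hsum
    exact hpos.not_ge hsum
  calc Real.log (expIntegral X μ ω) ≤ Real.log (Fintype.card ι * Real.exp r) :=
        Real.log_le_log hpos hsum
    _ = _ := by
        rw [Real.log_mul hcard (Real.exp_pos _).ne', Real.log_exp, hr]
        ring

theorem exists_meanLog_le_of_le_sum (hX : IsBoundedGaussian X P B V) {ν : ι → Measure T}
    [∀ i, IsFiniteMeasure (ν i)] [∀ i, NeZero (ν i)] (hμ : μ ≤ ∑ i, ν i) {l : ℝ} (hl : 0 < l) :
    ∃ i, meanLog X μ P ≤ meanLog X (ν i) P + Real.log (Fintype.card ι)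
      + Fintype.card ι * (2 * Real.exp (V * l ^ 2 / 2) / l) := by
  have : Nonempty ι := by
    by_contra hempty
    rw [not_nonempty_iff] at hempty
    rw [Finset.univ_eq_empty, Finset.sum_empty] at hμ
    exact NeZero.ne μ (le_antisymm hμ (Measure.zero_le μ))
  obtain ⟨i, hi⟩ := Finite.exists_max fun i => meanLog X (ν i) P
  refine ⟨i, ?_⟩
  have hdev : ∀ j, Integrable
      (fun ω => |Real.log (expIntegral X (ν j) ω) - meanLog X (ν j) P|) P := fun j =>
    (hX.hasSubgaussianMGF_log (ν j)).integrable.abs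
  calc meanLog X μ P
      ≤ ∫ ω, (meanLog X (ν i) P + Real.log (Fintype.card ι)
          + ∑ j, |Real.log (expIntegral X (ν j) ω) - meanLog X (ν j) P|) ∂P :=
        integral_mono_ae (hX.integrable_log μ)
          ((integrable_const _).add (integrable_finsetSum _ fun j _ => hdev j))
          (hX.ae_log_expIntegral_le_of_le_sum μ hμ hi)
    _ = meanLog X (ν i) P + Real.log (Fintype.card ι)
          + ∑ j, ∫ ω, |Real.log (expIntegral X (ν j) ω) - meanLog X (ν j) P| ∂P := by
        rw [integral_add (integrable_const _) (integrable_finsetSum _ fun j _ => hdev j),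
          integral_finsetSum _ fun j _ => hdev j, integral_const, probReal_univ, one_smul]
    _ ≤ _ := by
        rw [← nsmul_eq_mul]
        gcongr
        exact Finset.sum_le_card_nsmul _ _ _ fun j _ =>
          integral_abs_le_of_hasSubgaussianMGF (hX.hasSubgaussianMGF_log (ν j)) hl

theorem exists_meanLog_le_restrict (hX : IsBoundedGaussian X P B V) {A : ι → Set T}
    (hA : ∀ t, ∃ i, t ∈ A i) {l : ℝ} (hl : 0 < l) :
    ∃ i, NeZero (μ.restrict (A i)) ∧
      meanLog X μ P ≤ meanLog X (μ.restrict (A i)) P + Real.log (Fintype.card ι)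
        + Fintype.card ι * (2 * Real.exp (V * l ^ 2 / 2) / l) := by
  classical
  let ι' := {i // μ.restrict (A i) ≠ 0}
  have : ∀ i : ι', NeZero (μ.restrict (A i)) := fun i => ⟨i.2⟩
  have hsum : ∑ i, μ.restrict (A i) = ∑ i : ι', μ.restrict (A i) := by
    rw [← Finset.sum_filter_ne_zero, ← Finset.sum_subtype_eq_sum_filter, Finset.subtype_univ]
  obtain ⟨i, hi⟩ := hX.exists_meanLog_le_of_le_sum μ
    ((le_sum_restrict μ hA).trans hsum.le) hl
  have hcard : Fintype.card ι' ≤ Fintype.card ι := Fintype.card_subtype_le _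
  have hcard_pos : 0 < Fintype.card ι' := Fintype.card_pos_iff.2 ⟨i⟩
  refine ⟨i, inferInstance, hi.trans ?_⟩
  gcongr

end FiniteMeasure

end IsBoundedGaussian

/-- The sum of two processes driven by independent randomness, as a process on the product of the
two probability spaces. -/
def independentSum {T₁ T₂ Ω₁ Ω₂ : Type*} (X₁ : T₁ → Ω₁ → ℝ) (X₂ : T₂ → Ω₂ → ℝ)
    (t : T₁ × T₂) (ω : Ω₁ × Ω₂) : ℝ :=
  X₁ t.1 ω.1 + X₂ t.2 ω.2

theorem expIntegral_independentSum {T₁ T₂ Ω₁ Ω₂ : Type*} [MeasurableSpace T₁] [MeasurableSpace T₂]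
    (X₁ : T₁ → Ω₁ → ℝ) (X₂ : T₂ → Ω₂ → ℝ) (μ₁ : Measure T₁) (μ₂ : Measure T₂)
    [SFinite μ₁] [SFinite μ₂] (ω : Ω₁ × Ω₂) :
    expIntegral (independentSum X₁ X₂) (μ₁.prod μ₂) ω
      = expIntegral X₁ μ₁ ω.1 * expIntegral X₂ μ₂ ω.2 := by
  unfold expIntegral independentSum
  simp_rw [Real.exp_add]
  exact integral_prod_mul (fun s => Real.exp (X₁ s ω.1)) (fun s => Real.exp (X₂ s ω.2))

section IndependentSum

variable {T₁ T₂ Ω₁ Ω₂ : Type*} [MeasurableSpace Ω₁] [MeasurableSpace Ω₂]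
  {X₁ : T₁ → Ω₁ → ℝ} {X₂ : T₂ → Ω₂ → ℝ} {P₁ : Measure Ω₁} {P₂ : Measure Ω₂}

theorem hasGaussianLaw_comp_measurePreserving {Ω Ω' E : Type*} [MeasurableSpace Ω]
    [MeasurableSpace Ω'] [TopologicalSpace E] [AddCommMonoid E] [Module ℝ E] [MeasurableSpace E]
    {P : Measure Ω} {P' : Measure Ω'} {Y : Ω → E} (hY : HasGaussianLaw Y P) {φ : Ω' → Ω}
    (hφ : MeasurePreserving φ P' P) : HasGaussianLaw (Y ∘ φ) P' where
  isGaussian_map := by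
    have hmeas : AEMeasurable Y (P'.map φ) := hφ.map_eq ▸ hY.aemeasurable
    rw [← AEMeasurable.map_map_of_aemeasurable hmeas hφ.measurable.aemeasurable, hφ.map_eq]
    exact hY.isGaussian_map

variable [IsProbabilityMeasure P₁] [IsProbabilityMeasure P₂]

theorem isGaussianProcess_independentSum (h₁ : IsGaussianProcess X₁ P₁)
    (h₂ : IsGaussianProcess X₂ P₂) :
    IsGaussianProcess (independentSum X₁ X₂) (P₁.prod P₂) where
  hasGaussianLaw I := by
    have law₁ := hasGaussianLaw_pi h₁ fun i : I => i.1.1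
    have law₂ := hasGaussianLaw_pi h₂ fun i : I => i.1.2
    exact (IndepFun.hasGaussianLaw
      (hasGaussianLaw_comp_measurePreserving law₁ measurePreserving_fst)
      (hasGaussianLaw_comp_measurePreserving law₂ measurePreserving_snd)
      (indepFun_prod₀ law₁.aemeasurable law₂.aemeasurable)).add

theorem covariance_independentSum (h₁ : IsGaussianProcess X₁ P₁) (h₂ : IsGaussianProcess X₂ P₂)
    (s t : T₁ × T₂) :
    cov[independentSum X₁ X₂ s, independentSum X₁ X₂ t; P₁.prod P₂]
      = cov[X₁ s.1, X₁ t.1; P₁] + cov[X₂ s.2, X₂ t.2; P₂] := by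
  have hL₁ := fun u => (h₁.hasGaussianLaw_eval u).memLp_two
  have hL₂ := fun u => (h₂.hasGaussianLaw_eval u).memLp_two
  have hsum : ∀ u, independentSum X₁ X₂ u = X₁ u.1 ∘ Prod.fst + X₂ u.2 ∘ Prod.snd := fun _ => rfl
  have hfst := fun u => (hL₁ u).comp_measurePreserving (measurePreserving_fst (μ := P₁) (ν := P₂))
  have hsnd := fun u => (hL₂ u).comp_measurePreserving (measurePreserving_snd (μ := P₁) (ν := P₂))
  have hcross : ∀ u v, cov[X₁ u ∘ Prod.fst, X₂ v ∘ Prod.snd; P₁.prod P₂] = 0 := fun u v =>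
    covariance_fst_snd_prod (hL₁ u) (hL₂ v)
  rw [hsum, hsum, covariance_add_left (hfst _) (hsnd _) ((hfst _).add (hsnd _)),
    covariance_add_right (hfst _) (hfst _) (hsnd _),
    covariance_add_right (hsnd _) (hfst _) (hsnd _), hcross,
    covariance_comm (X₂ s.2 ∘ Prod.snd), hcross, add_zero, zero_add]
  exact congrArg₂ (· + ·)
    (covariance_comp_measurePreserving measurePreserving_fst (hL₁ _).1 (hL₁ _).1)
    (covariance_comp_measurePreserving measurePreserving_snd (hL₂ _).1 (hL₂ _).1)

theorem integral_independentSum (h₁ : IsGaussianProcess X₁ P₁) (h₂ : IsGaussianProcess X₂ P₂)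
    (t : T₁ × T₂) :
    ∫ ω, independentSum X₁ X₂ t ω ∂(P₁.prod P₂) = P₁[X₁ t.1] + P₂[X₂ t.2] := by
  unfold independentSum
  rw [integral_add ((h₁.hasGaussianLaw_eval _).integrable.comp_fst P₂)
    ((h₂.hasGaussianLaw_eval _).integrable.comp_snd P₁), integral_fun_fst, integral_fun_snd,
    probReal_univ, probReal_univ, one_smul, one_smul]

variable [MeasurableSpace T₁] [MeasurableSpace T₂] {B₁ B₂ : ℝ} {V₁ V₂ : ℝ≥0}

theorem IsBoundedGaussian.independentSum (h₁ : IsBoundedGaussian X₁ P₁ B₁ V₁)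
    (h₂ : IsBoundedGaussian X₂ P₂ B₂ V₂) :
    IsBoundedGaussian (independentSum X₁ X₂) (P₁.prod P₂) (B₁ + B₂) (V₁ + V₂) where
  measurable := by
    have hproj₁ : Measurable fun p : (T₁ × T₂) × Ω₁ × Ω₂ => (p.1.1, p.2.1) := by fun_prop
    have hproj₂ : Measurable fun p : (T₁ × T₂) × Ω₁ × Ω₂ => (p.1.2, p.2.2) := by fun_prop
    exact (h₁.measurable.comp hproj₁).add (h₂.measurable.comp hproj₂)
  gaussian := isGaussianProcess_independentSum h₁.gaussian h₂.gaussian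
  mean_le t := by
    rw [integral_independentSum h₁.gaussian h₂.gaussian]
    exact (abs_add_le _ _).trans (add_le_add (h₁.mean_le _) (h₂.mean_le _))
  cov_le t := by
    rw [covariance_independentSum h₁.gaussian h₂.gaussian, NNReal.coe_add]
    exact add_le_add (h₁.cov_le _) (h₂.cov_le _)

theorem meanLog_independentSum (h₁ : IsBoundedGaussian X₁ P₁ B₁ V₁)
    (h₂ : IsBoundedGaussian X₂ P₂ B₂ V₂) (μ₁ : Measure T₁) (μ₂ : Measure T₂)
    [IsFiniteMeasure μ₁] [IsFiniteMeasure μ₂] [NeZero μ₁] [NeZero μ₂] :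
    meanLog (independentSum X₁ X₂) (μ₁.prod μ₂) (P₁.prod P₂)
      = meanLog X₁ μ₁ P₁ + meanLog X₂ μ₂ P₂ := by
  have hlog : ∀ᵐ ω ∂(P₁.prod P₂),
      Real.log (expIntegral (independentSum X₁ X₂) (μ₁.prod μ₂) ω)
        = Real.log (expIntegral X₁ μ₁ ω.1) + Real.log (expIntegral X₂ μ₂ ω.2) := by
    filter_upwards [Measure.quasiMeasurePreserving_fst.ae (h₁.ae_expIntegral_pos μ₁),
      Measure.quasiMeasurePreserving_snd.ae (h₂.ae_expIntegral_pos μ₂)] with ω hpos₁ hpos₂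
    rw [expIntegral_independentSum, Real.log_mul hpos₁.ne' hpos₂.ne']
  rw [meanLog, integral_congr_ae hlog, integral_add ((h₁.integrable_log μ₁).comp_fst P₂)
    ((h₂.integrable_log μ₂).comp_snd P₁),
    integral_fun_fst (fun ω => Real.log (expIntegral X₁ μ₁ ω)),
    integral_fun_snd (fun ω => Real.log (expIntegral X₂ μ₂ ω)), probReal_univ, probReal_univ,
    one_smul, one_smul, meanLog, meanLog]

end IndependentSum

section Compensated

variable {T Ω : Type*} [MeasurableSpace Ω]

/-- The mean plus half the variance of `X t`, the cumulant `log E exp (X t)` of a Gaussian `X t`. -/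
noncomputable def compensator (X : T → Ω → ℝ) (P : Measure Ω) (t : T) : ℝ :=
  P[X t] + cov[X t, X t; P] / 2

/-- The compensated process, normalized so that `E exp (X t) = 1` in the Gaussian case. The
comparison inequality requires equal cumulants, so superadditivity holds for it and not for `X`. -/
noncomputable def compensated (X : T → Ω → ℝ) (P : Measure Ω) (t : T) (ω : Ω) : ℝ :=
  X t ω - compensator X P t

theorem isGaussianProcess_sub_const {X : T → Ω → ℝ} {P : Measure Ω} (hX : IsGaussianProcess X P)
    (c : T → ℝ) : IsGaussianProcess (fun t ω => X t ω - c t) P where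
  hasGaussianLaw I := by
    have hlaw := hX.hasGaussianLaw I
    have := hlaw.isGaussian_map
    have hmap : P.map (fun ω => I.restrict fun t => X t ω - c t)
        = (P.map fun ω => I.restrict fun t => X t ω).map (fun x => x - I.restrict c) := by
      rw [AEMeasurable.map_map_of_aemeasurable (by fun_prop) hlaw.aemeasurable]
      rfl
    exact ⟨hmap ▸ inferInstance⟩

variable [MeasurableSpace T] {X : T → Ω → ℝ} {P : Measure Ω} {B : ℝ} {V : ℝ≥0}

namespace IsBoundedGaussian

theorem comp {T' : Type*} [MeasurableSpace T'] (hX : IsBoundedGaussian X P B V) {φ : T' → T}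
    (hφ : Measurable φ) : IsBoundedGaussian (fun t => X (φ t)) P B V where
  measurable := by
    have hpair : Measurable fun p : T' × Ω => (φ p.1, p.2) := by fun_prop
    exact hX.measurable.comp hpair
  gaussian := hX.gaussian.comp_right φ
  mean_le t := hX.mean_le _
  cov_le t := hX.cov_le _

theorem abs_compensator_le (hX : IsBoundedGaussian X P B V) (t : T) :
    |compensator X P t| ≤ B + V / 2 := by
  have hcov : 0 ≤ cov[X t, X t; P] := by
    rw [covariance_self (hX.measurable_right t).aemeasurable]
    exact variance_nonneg _ _
  refine (abs_add_le _ _).trans (add_le_add (hX.mean_le t) ?_)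
  rw [abs_of_nonneg (by positivity)]
  linarith [hX.cov_le t]

variable [IsProbabilityMeasure P]

theorem measurable_compensator (hX : IsBoundedGaussian X P B V) :
    Measurable (compensator X P) := by
  have hmean : Measurable fun t => P[X t] :=
    hX.measurable.stronglyMeasurable.integral_prod_right'.measurable
  have hcentered : Measurable fun p : T × Ω => X p.1 p.2 - P[X p.1] :=
    hX.measurable.sub (hmean.comp measurable_fst)
  have hcov : Measurable fun t => cov[X t, X t; P] :=
    (hcentered.mul hcentered).stronglyMeasurable.integral_prod_right'.measurable
  exact hmean.add (hcov.div_const 2)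

theorem covariance_compensated (hX : IsBoundedGaussian X P B V) (s t : T) :
    cov[compensated X P s, compensated X P t; P] = cov[X s, X t; P] := by
  unfold compensated
  rw [covariance_sub_const_left (hX.integrable s), covariance_sub_const_right (hX.integrable t)]

theorem integral_compensated (hX : IsBoundedGaussian X P B V) (t : T) :
    ∫ ω, compensated X P t ω ∂P = P[X t] - compensator X P t := by
  unfold compensated
  rw [integral_sub (hX.integrable t) (integrable_const _), integral_const, probReal_univ, one_smul]

theorem isBoundedGaussian_compensated (hX : IsBoundedGaussian X P B V) :
    IsBoundedGaussian (compensated X P) P (B + (B + V / 2)) V where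
  measurable := hX.measurable.sub (hX.measurable_compensator.comp measurable_fst)
  gaussian := isGaussianProcess_sub_const hX.gaussian _
  mean_le t := by
    rw [hX.integral_compensated]
    exact (abs_sub _ _).trans (add_le_add (hX.mean_le t) (hX.abs_compensator_le t))
  cov_le t := by
    rw [hX.covariance_compensated]
    exact hX.cov_le t

theorem mean_add_half_covariance_compensated (hX : IsBoundedGaussian X P B V) (t : T) :
    P[compensated X P t] + cov[compensated X P t, compensated X P t; P] / 2 = 0 := by
  rw [hX.integral_compensated, hX.covariance_compensated, compensator]
  ring

end IsBoundedGaussian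

end Compensated

theorem meanLog_compensated_add_le {T T₁ T₂ Ω Ω₁ Ω₂ : Type*}
    [MeasurableSpace T] [MeasurableSpace T₁] [MeasurableSpace T₂] [MeasurableSpace Ω]
    [MeasurableSpace Ω₁] [MeasurableSpace Ω₂] {X : T → Ω → ℝ} {X₁ : T₁ → Ω₁ → ℝ}
    {X₂ : T₂ → Ω₂ → ℝ} {P : Measure Ω} {P₁ : Measure Ω₁} {P₂ : Measure Ω₂}
    [IsProbabilityMeasure P] [IsProbabilityMeasure P₁] [IsProbabilityMeasure P₂]
    {B B₁ B₂ : ℝ} {V V₁ V₂ : ℝ≥0} (h : IsBoundedGaussian X P B V)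
    (h₁ : IsBoundedGaussian X₁ P₁ B₁ V₁) (h₂ : IsBoundedGaussian X₂ P₂ B₂ V₂)
    {μ : Measure T} {μ₁ : Measure T₁} {μ₂ : Measure T₂} [IsFiniteMeasure μ] [IsFiniteMeasure μ₁]
    [IsFiniteMeasure μ₂] [NeZero μ₁] [NeZero μ₂] {φ : T₁ × T₂ → T} (hφ : Measurable φ)
    (hμ : (μ₁.prod μ₂).map φ ≤ μ) {D : ℝ}
    (hcov : ∀ s t : T₁ × T₂, cov[X (φ s), X (φ t); P]
      ≤ cov[X₁ s.1, X₁ t.1; P₁] + cov[X₂ s.2, X₂ t.2; P₂] + D) :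
    meanLog (compensated X₁ P₁) μ₁ P₁ + meanLog (compensated X₂ P₂) μ₂ P₂
      ≤ meanLog (compensated X P) μ P + D / 2 := by
  have hc := h.isBoundedGaussian_compensated
  have hc₁ := h₁.isBoundedGaussian_compensated
  have hc₂ := h₂.isBoundedGaussian_compensated
  have : NeZero ((μ₁.prod μ₂).map φ) := ⟨(Measure.map_ne_zero_iff hφ.aemeasurable).2 (NeZero.ne _)⟩
  calc meanLog (compensated X₁ P₁) μ₁ P₁ + meanLog (compensated X₂ P₂) μ₂ P₂
      = meanLog (independentSum (compensated X₁ P₁) (compensated X₂ P₂)) (μ₁.prod μ₂)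
          (P₁.prod P₂) := (meanLog_independentSum hc₁ hc₂ μ₁ μ₂).symm
    _ ≤ meanLog (fun t => compensated X P (φ t)) (μ₁.prod μ₂) P + D / 2 := by
        refine (hc.comp hφ).meanLog_le_of_covariance_le _ (hc₁.independentSum hc₂)
          (fun t => ?_) fun s t => ?_
        · rw [integral_independentSum hc₁.gaussian hc₂.gaussian,
            covariance_independentSum hc₁.gaussian hc₂.gaussian,
            h.mean_add_half_covariance_compensated]
          linarith [h₁.mean_add_half_covariance_compensated t.1,
            h₂.mean_add_half_covariance_compensated t.2]
        · rw [covariance_independentSum hc₁.gaussian hc₂.gaussian, h.covariance_compensated,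
            h₁.covariance_compensated, h₂.covariance_compensated]
          exact hcov s t
    _ = meanLog (compensated X P) ((μ₁.prod μ₂).map φ) P + D / 2 := by rw [hc.meanLog_map hφ]
    _ ≤ meanLog (compensated X P) μ P + D / 2 := by
        have hmono := hc.meanLog_mono _ hc hμ (c := 0) (ae_of_all _ fun t ω => (add_zero _).ge)
        linarith

section Append

variable {α : Type*} [MeasurableSpace α]

theorem measurable_fin_append (m n : ℕ) :
    Measurable fun p : (Fin m → α) × (Fin n → α) => Fin.append p.1 p.2 := by
  refine measurable_pi_lambda _ fun i => ?_
  induction i using Fin.addCases with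
  | left i =>
    simp only [Fin.append_left]
    fun_prop
  | right i =>
    simp only [Fin.append_right]
    fun_prop

theorem map_append_pi_prod_pi (ν : Measure α) [SigmaFinite ν] (m n : ℕ) :
    ((Measure.pi fun _ : Fin m => ν).prod (Measure.pi fun _ : Fin n => ν)).map
      (fun p => Fin.append p.1 p.2) = Measure.pi fun _ : Fin (m + n) => ν := by
  refine (Measure.pi_eq fun s hs => ?_).symm
  rw [Measure.map_apply (measurable_fin_append m n) (MeasurableSet.univ_pi hs)]
  have hpreimage : (fun p : (Fin m → α) × (Fin n → α) => Fin.append p.1 p.2) ⁻¹' Set.univ.pi s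
      = (Set.univ.pi fun i => s (Fin.castAdd n i)) ×ˢ Set.univ.pi fun i => s (Fin.natAdd m i) := by
    ext p
    simp only [Set.mem_preimage, Set.mem_pi, Set.mem_univ, forall_const, Set.mem_prod,
      Fin.forall_fin_add, Fin.append_left, Fin.append_right]
  rw [hpreimage, Measure.prod_prod, Measure.pi_pi, Measure.pi_pi, Fin.prod_univ_add]

theorem map_append_restrict_le (ν : Measure α) [SigmaFinite ν] {m n : ℕ}
    {A₁ : Set (Fin m → α)} {A₂ : Set (Fin n → α)} {A : Set (Fin (m + n) → α)}
    (hA : ∀ σ ∈ A₁, ∀ τ ∈ A₂, Fin.append σ τ ∈ A) :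
    (((Measure.pi fun _ : Fin m => ν).restrict A₁).prod
      ((Measure.pi fun _ : Fin n => ν).restrict A₂)).map (fun p => Fin.append p.1 p.2)
      ≤ (Measure.pi fun _ : Fin (m + n) => ν).restrict A := by
  refine Measure.le_iff.2 fun s hs => ?_
  have hmeas := measurable_fin_append (α := α) m n
  rw [Measure.prod_restrict, Measure.map_apply hmeas hs, Measure.restrict_apply (hmeas hs),
    Measure.restrict_apply hs, ← map_append_pi_prod_pi ν m n]
  refine le_trans (measure_mono ?_) (Measure.le_map_apply hmeas.aemeasurable _)
  rintro ⟨σ, τ⟩ ⟨hs, hσ, hτ⟩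
  exact ⟨hs, hA σ hσ τ hτ⟩

theorem neZero_restrict_append (ν : Measure α) [SigmaFinite ν] {m n : ℕ}
    {A₁ : Set (Fin m → α)} {A₂ : Set (Fin n → α)} {A : Set (Fin (m + n) → α)}
    [NeZero ((Measure.pi fun _ : Fin m => ν).restrict A₁)]
    [NeZero ((Measure.pi fun _ : Fin n => ν).restrict A₂)]
    (hA : ∀ σ ∈ A₁, ∀ τ ∈ A₂, Fin.append σ τ ∈ A) :
    NeZero ((Measure.pi fun _ : Fin (m + n) => ν).restrict A) := by
  have : NeZero ((((Measure.pi fun _ : Fin m => ν).restrict A₁).prod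
      ((Measure.pi fun _ : Fin n => ν).restrict A₂)).map fun p => Fin.append p.1 p.2) :=
    ⟨(Measure.map_ne_zero_iff (measurable_fin_append m n).aemeasurable).2 (NeZero.ne _)⟩
  exact neZero_of_le (map_append_restrict_le ν hA)

end Append

section Sequences

theorem exists_tendsto_of_eventually_sub_le {u : ℕ → ℝ} {K : ℝ} (hK : ∀ᶠ N in atTop, u N ≤ K)
    (h : ∀ ε > 0, ∀ᶠ n in atTop, ∀ᶠ N in atTop, u n - ε ≤ u N) :
    ∃ l, Tendsto u atTop (𝓝 l) := by
  obtain ⟨n₀, hn₀⟩ := (h 1 one_pos).exists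
  have hbdd : IsBoundedUnder (· ≤ ·) atTop u := isBoundedUnder_of_eventually_le hK
  have hbdd' : IsBoundedUnder (· ≥ ·) atTop u := isBoundedUnder_of_eventually_ge hn₀
  refine ⟨liminf u atTop, tendsto_of_le_liminf_of_limsup_le le_rfl ?_ hbdd hbdd'⟩
  refine le_of_forall_pos_le_add fun ε hε => limsup_le_of_le hbdd'.isCoboundedUnder_le ?_
  filter_upwards [h ε hε] with n hn
  exact sub_le_iff_le_add.1 (le_liminf_of_le hbdd.isCoboundedUnder_ge hn)

theorem exists_eq_succ_mul_add {n N : ℕ} (hn : 1 ≤ n) (hN : n + 1 ≤ N) :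
    ∃ q r, 1 ≤ r ∧ r ≤ n ∧ N = (q + 1) * n + r := by
  have hq : 1 ≤ (N - 1) / n := (Nat.one_le_div_iff hn).2 (by omega)
  refine ⟨(N - 1) / n - 1, (N - 1) % n + 1, by omega, Nat.mod_lt _ hn, ?_⟩
  rw [Nat.sub_add_cancel hq]
  have := Nat.div_add_mod' (N - 1) n
  omega

-- Fekete's argument, with errors that are negligible only for large blocks.
theorem exists_tendsto_div_of_block_le {u : ℕ → ℝ} {K : ℝ} (hK : ∀ᶠ N : ℕ in atTop, u N / N ≤ K)
    (h : ∀ ε > 0, ∀ᶠ n : ℕ in atTop, ∃ W : ℝ, ∀ᶠ N : ℕ in atTop, ∀ q r : ℕ, 1 ≤ r → r ≤ n →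
      N = (q + 1) * n + r → (q + 1) * u n ≤ u N + ε * N + W) :
    ∃ l, Tendsto (fun N : ℕ => u N / N) atTop (𝓝 l) := by
  refine exists_tendsto_of_eventually_sub_le hK fun ε hε => ?_
  filter_upwards [h (ε / 2) (half_pos hε), eventually_ge_atTop 1] with n ⟨W, hW⟩ hn
  have herror : ∀ᶠ N : ℕ in atTop, |u n| + W ≤ N * (ε / 2) :=
    (tendsto_natCast_atTop_atTop.atTop_mul_const (half_pos hε)).eventually_ge_atTop _
  filter_upwards [hW, herror, eventually_ge_atTop (n + 1)] with N hblock hlarge hN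
  obtain ⟨q, r, hr, hrn, hNq⟩ := exists_eq_succ_mul_add hn hN
  have hn_pos : (0 : ℝ) < n := by exact_mod_cast hn
  have hN_pos : (0 : ℝ) < N := by exact_mod_cast (by omega : 0 < N)
  have hremainder : r * (u n / n) ≤ |u n| := by
    refine (le_abs_self _).trans ?_
    rw [abs_mul, abs_div, Nat.abs_cast, Nat.abs_cast, mul_div_left_comm]
    refine mul_le_of_le_one_right (abs_nonneg _) ((div_le_one hn_pos).2 ?_)
    exact_mod_cast hrn
  have hsplit : u n / n * N = (q + 1) * u n + r * (u n / n) := by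
    rw [hNq]
    push_cast
    field_simp
  rw [le_div_iff₀ hN_pos, sub_mul, hsplit]
  linarith [hblock q r hr hrn hNq]

theorem tendsto_add_mul_sqrt_div_atTop (a b : ℝ) :
    Tendsto (fun N : ℕ => (a + b * √(N : ℝ)) / N) atTop (𝓝 0) := by
  have hsqrt : Tendsto (fun N : ℕ => b * (√(N : ℝ))⁻¹) atTop (𝓝 (b * 0)) :=
    ((Real.tendsto_sqrt_atTop.comp tendsto_natCast_atTop_atTop).inv_tendsto_atTop).const_mul b
  have hsum := (tendsto_const_div_atTop_nhds_zero_nat a).add hsqrt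
  rw [mul_zero, add_zero] at hsum
  refine hsum.congr fun N => ?_
  rw [add_div, mul_div_assoc, Real.sqrt_div_self', one_div]

end Sequences

theorem exists_finset_cover_of_continuous {E : Type*} [SeminormedAddCommGroup E] [ProperSpace E]
    {φ : E → ℝ} (hφ : Continuous φ) (M : ℝ) {ε : ℝ} (hε : 0 < ε) :
    ∃ ρ > 0, ∃ t : Finset E, (∀ x ∈ t, ‖x‖ ≤ M) ∧ (∀ z, ‖z‖ ≤ M → ∃ x ∈ t, dist z x ≤ ρ) ∧
      ∀ x ∈ t, ∀ z, ‖z‖ ≤ M → dist z x ≤ 2 * ρ → |φ z - φ x| ≤ ε := by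
  have hcompact : IsCompact (Metric.closedBall (0 : E) M) := isCompact_closedBall _ _
  obtain ⟨δ, hδ, hosc⟩ := Metric.uniformContinuousOn_iff.1
    (hcompact.uniformContinuousOn_of_continuous hφ.continuousOn) ε hε
  obtain ⟨t, ht, htfin, hcover⟩ := hcompact.finite_cover_balls (e := δ / 3) (by positivity)
  refine ⟨δ / 3, by positivity, htfin.toFinset,
    fun x hx => mem_closedBall_zero_iff.1 (ht (htfin.mem_toFinset.1 hx)), fun z hz => ?_,
    fun x hx z hz hzx => (hosc z (mem_closedBall_zero_iff.2 hz) x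
      (ht (htfin.mem_toFinset.1 hx)) (by linarith)).le⟩
  obtain ⟨x, hx, hzx⟩ := Set.mem_iUnion₂.1 (hcover (mem_closedBall_zero_iff.2 hz))
  exact ⟨x, htfin.mem_toFinset.2 hx, (Metric.mem_ball.1 hzx).le⟩

section BlockModel

/-- Gaussian processes on the configurations of all sizes which decouple along an order parameter:
the order parameter `y` of a concatenation is the average of those of its blocks, the cumulant
`log E exp (X N σ)` is `N φ (y N σ)` up to `C`, and the covariances are subadditive under
concatenation up to `D`. -/
structure IsGaussianBlockModel {α Ω E : Type*} [MeasurableSpace α] [MeasurableSpace Ω]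
    [NormedAddCommGroup E] [NormedSpace ℝ E] [MeasurableSpace E] (X : (N : ℕ) → (Fin N → α) → Ω → ℝ)
    (P : Measure Ω) (y : (N : ℕ) → (Fin N → α) → E) (φ : E → ℝ) (M B : ℝ) (V : ℝ≥0) (C D : ℝ) :
    Prop where
  isBoundedGaussian : ∀ N, 1 ≤ N → IsBoundedGaussian (X N) P (N * B) (N * V)
  measurable_orderParameter : ∀ N, 1 ≤ N → Measurable (y N)
  norm_orderParameter_le : ∀ N, 1 ≤ N → ∀ σ, ‖y N σ‖ ≤ M
  orderParameter_append : ∀ m n, 1 ≤ m → 1 ≤ n → ∀ (σ : Fin m → α) (τ : Fin n → α),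
    ((m + n : ℕ) : ℝ) • y (m + n) (Fin.append σ τ) = (m : ℝ) • y m σ + (n : ℝ) • y n τ
  continuous_cumulant : Continuous φ
  abs_compensator_sub_le : ∀ N, 1 ≤ N → ∀ σ, |compensator (X N) P σ - N * φ (y N σ)| ≤ C
  covariance_append_le : ∀ m n, 1 ≤ m → 1 ≤ n → ∀ (σ σ' : Fin m → α) (τ τ' : Fin n → α),
    cov[X (m + n) (Fin.append σ τ), X (m + n) (Fin.append σ' τ'); P]
      ≤ cov[X m σ, X m σ'; P] + cov[X n τ, X n τ'; P] + D

variable {α Ω E : Type*} [MeasurableSpace α] [MeasurableSpace Ω] [NormedAddCommGroup E]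

/-- The configurations whose order parameter lies within distance `r` of `x`. -/
def cell (y : (N : ℕ) → (Fin N → α) → E) (x : E) (r : ℝ) (N : ℕ) : Set (Fin N → α) :=
  y N ⁻¹' Metric.closedBall x r

/-- The product measure restricted to a cell. -/
noncomputable def cellMeasure (ν : Measure α) (y : (N : ℕ) → (Fin N → α) → E) (x : E) (r : ℝ)
    (N : ℕ) : Measure (Fin N → α) :=
  (Measure.pi fun _ : Fin N => ν).restrict (cell y x r N)

instance (ν : Measure α) [IsFiniteMeasure ν] (y : (N : ℕ) → (Fin N → α) → E) (x : E) (r : ℝ)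
    (N : ℕ) : IsFiniteMeasure (cellMeasure ν y x r N) :=
  inferInstanceAs (IsFiniteMeasure ((Measure.pi fun _ : Fin N => ν).restrict (cell y x r N)))

variable [NormedSpace ℝ E] [MeasurableSpace E] {X : (N : ℕ) → (Fin N → α) → Ω → ℝ}
  {P : Measure Ω} {y : (N : ℕ) → (Fin N → α) → E} {φ : E → ℝ} {M B : ℝ} {V : ℝ≥0} {C D : ℝ}
  {x : E} {r : ℝ}

namespace IsGaussianBlockModel

theorem measurableSet_cell [OpensMeasurableSpace E] (h : IsGaussianBlockModel X P y φ M B V C D)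
    {N : ℕ} (hN : 1 ≤ N) : MeasurableSet (cell y x r N) :=
  h.measurable_orderParameter N hN Metric.isClosed_closedBall.measurableSet

theorem append_mem_cell (h : IsGaussianBlockModel X P y φ M B V C D) {m n : ℕ} (hm : 1 ≤ m)
    (hn : 1 ≤ n) {s ρ : ℝ} (hρ : m * r + n * s ≤ (m + n) * ρ) {σ : Fin m → α}
    (hσ : σ ∈ cell y x r m) {τ : Fin n → α} (hτ : τ ∈ cell y x s n) :
    Fin.append σ τ ∈ cell y x ρ (m + n) := by
  have hσ' : ‖y m σ - x‖ ≤ r := mem_closedBall_iff_norm.1 hσ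
  have hτ' : ‖y n τ - x‖ ≤ s := mem_closedBall_iff_norm.1 hτ
  have hpos : (0 : ℝ) < m + n := by exact_mod_cast (by omega : 0 < m + n)
  have haverage : ((m : ℝ) + n) • (y (m + n) (Fin.append σ τ) - x)
      = (m : ℝ) • (y m σ - x) + (n : ℝ) • (y n τ - x) := by
    have happend := h.orderParameter_append m n hm hn σ τ
    rw [Nat.cast_add] at happend
    rw [smul_sub, happend, add_smul, smul_sub, smul_sub]
    abel
  refine mem_closedBall_iff_norm.2 (le_of_mul_le_mul_left ?_ hpos)
  calc ((m : ℝ) + n) * ‖y (m + n) (Fin.append σ τ) - x‖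
      = ‖(m : ℝ) • (y m σ - x) + (n : ℝ) • (y n τ - x)‖ := by
        rw [← haverage, norm_smul, Real.norm_of_nonneg hpos.le]
    _ ≤ m * ‖y m σ - x‖ + n * ‖y n τ - x‖ := by
        refine (norm_add_le _ _).trans_eq ?_
        rw [norm_smul, norm_smul, Real.norm_natCast, Real.norm_natCast]
    _ ≤ m * r + n * s := by gcongr
    _ ≤ (m + n) * ρ := hρ

variable [IsProbabilityMeasure P] {ν : Measure α} [IsFiniteMeasure ν]

theorem meanLog_compensated_append (h : IsGaussianBlockModel X P y φ M B V C D) {m n : ℕ}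
    (hm : 1 ≤ m) (hn : 1 ≤ n) {A₁ : Set (Fin m → α)} {A₂ : Set (Fin n → α)}
    {A : Set (Fin (m + n) → α)} [NeZero ((Measure.pi fun _ : Fin m => ν).restrict A₁)]
    [NeZero ((Measure.pi fun _ : Fin n => ν).restrict A₂)]
    (hA : ∀ σ ∈ A₁, ∀ τ ∈ A₂, Fin.append σ τ ∈ A) :
    meanLog (compensated (X m) P) ((Measure.pi fun _ : Fin m => ν).restrict A₁) P
        + meanLog (compensated (X n) P) ((Measure.pi fun _ : Fin n => ν).restrict A₂) P
      ≤ meanLog (compensated (X (m + n)) P) ((Measure.pi fun _ : Fin (m + n) => ν).restrict A) P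
        + D / 2 :=
  meanLog_compensated_add_le (h.isBoundedGaussian (m + n) (by omega)) (h.isBoundedGaussian m hm)
    (h.isBoundedGaussian n hn) (measurable_fin_append m n) (map_append_restrict_le ν hA)
    fun s t => h.covariance_append_le m n hm hn s.1 t.1 s.2 t.2

theorem meanLog_cell_mul (h : IsGaussianBlockModel X P y φ M B V C D) {N : ℕ} (hN : 1 ≤ N)
    [NeZero (cellMeasure ν y x r N)] (q : ℕ) :
    NeZero (cellMeasure ν y x r ((q + 1) * N)) ∧
      (q + 1) * meanLog (compensated (X N) P) (cellMeasure ν y x r N) P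
        ≤ meanLog (compensated (X ((q + 1) * N)) P) (cellMeasure ν y x r ((q + 1) * N)) P
          + q * (D / 2) := by
  induction q with
  | zero =>
    rw [zero_add, one_mul]
    exact ⟨inferInstance, by rw [Nat.cast_zero]; linarith⟩
  | succ q ih =>
    obtain ⟨hne, hle⟩ := ih
    rw [Nat.succ_mul]
    have hq : 1 ≤ (q + 1) * N := Nat.mul_pos (Nat.succ_pos q) hN
    have happend : ∀ σ ∈ cell y x r ((q + 1) * N), ∀ τ ∈ cell y x r N,
        Fin.append σ τ ∈ cell y x r ((q + 1) * N + N) := fun σ hσ τ hτ =>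
      h.append_mem_cell hq hN (add_mul _ _ _).ge hσ hτ
    unfold cellMeasure at *
    have hadd := h.meanLog_compensated_append (ν := ν) hq hN happend
    refine ⟨neZero_restrict_append ν happend, ?_⟩
    push_cast
    linarith

theorem meanLog_compensated_cell_le [OpensMeasurableSpace E]
    (h : IsGaussianBlockModel X P y φ M B V C D) {N : ℕ} (hN : 1 ≤ N)
    [NeZero (cellMeasure ν y x r N)] {ε : ℝ}
    (hosc : ∀ z, ‖z‖ ≤ M → dist z x ≤ r → |φ z - φ x| ≤ ε) :
    meanLog (compensated (X N) P) (cellMeasure ν y x r N) P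
      ≤ meanLog (X N) (Measure.pi fun _ : Fin N => ν) P + (C - N * (φ x - ε)) := by
  have hX := h.isBoundedGaussian N hN
  refine hX.isBoundedGaussian_compensated.meanLog_mono (cellMeasure ν y x r N) hX
    Measure.restrict_le_self
    (ae_restrict_of_forall_mem (h.measurableSet_cell hN) fun σ hσ ω => ?_)
  have hcell := (abs_le.1 (hosc _ (h.norm_orderParameter_le N hN σ) hσ)).1
  have hscaled := mul_le_mul_of_nonneg_left hcell (Nat.cast_nonneg (α := ℝ) N)
  rw [compensated]
  linarith [(abs_le.1 (h.abs_compensator_sub_le N hN σ)).1]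

theorem meanLog_cell_le [OpensMeasurableSpace E] (h : IsGaussianBlockModel X P y φ M B V C D)
    {N : ℕ} (hN : 1 ≤ N) [NeZero (cellMeasure ν y x r N)] {ε : ℝ}
    (hosc : ∀ z, ‖z‖ ≤ M → dist z x ≤ r → |φ z - φ x| ≤ ε) :
    meanLog (X N) (cellMeasure ν y x r N) P
      ≤ meanLog (compensated (X N) P) (cellMeasure ν y x r N) P + (N * (φ x + ε) + C) := by
  have hX := h.isBoundedGaussian N hN
  refine hX.meanLog_mono _ hX.isBoundedGaussian_compensated le_rfl
    (ae_restrict_of_forall_mem (h.measurableSet_cell hN) fun σ hσ ω => ?_)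
  have hcell := (abs_le.1 (hosc _ (h.norm_orderParameter_le N hN σ) hσ)).2
  have hscaled := mul_le_mul_of_nonneg_left hcell (Nat.cast_nonneg (α := ℝ) N)
  rw [compensated]
  linarith [(abs_le.1 (h.abs_compensator_sub_le N hN σ)).2]

variable [NeZero ν]

theorem meanLog_cell_mul_add (h : IsGaussianBlockModel X P y φ M B V C D) {N R : ℕ} (hN : 1 ≤ N)
    (hR : 1 ≤ R) [NeZero (cellMeasure ν y x r N)] (q : ℕ) (hx : ‖x‖ ≤ M) (hr : 0 ≤ r)
    (hlarge : R * (2 * M) ≤ (((q + 1) * N + R : ℕ) : ℝ) * r) :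
    NeZero (cellMeasure ν y x (2 * r) ((q + 1) * N + R)) ∧
      (q + 1) * meanLog (compensated (X N) P) (cellMeasure ν y x r N) P
          + meanLog (compensated (X R) P) (Measure.pi fun _ : Fin R => ν) P
        ≤ meanLog (compensated (X ((q + 1) * N + R)) P)
            (cellMeasure ν y x (2 * r) ((q + 1) * N + R)) P + (q + 1) * (D / 2) := by
  obtain ⟨hne, hle⟩ := h.meanLog_cell_mul (ν := ν) (x := x) (r := r) hN q
  have hq : 1 ≤ (q + 1) * N := Nat.mul_pos (Nat.succ_pos q) hN
  have hball : ∀ τ : Fin R → α, τ ∈ cell y x (2 * M) R := fun τ =>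
    mem_closedBall_iff_norm.2 ((norm_sub_le _ _).trans
      (by linarith [h.norm_orderParameter_le R hR τ]))
  have hradius : (((q + 1) * N : ℕ) : ℝ) * r + R * (2 * M)
      ≤ (((q + 1) * N : ℕ) + R) * (2 * r) := by
    rw [Nat.cast_add ((q + 1) * N)] at hlarge
    nlinarith [mul_nonneg (Nat.cast_nonneg (α := ℝ) R) hr]
  have happend : ∀ σ ∈ cell y x r ((q + 1) * N), ∀ τ ∈ (Set.univ : Set (Fin R → α)),
      Fin.append σ τ ∈ cell y x (2 * r) ((q + 1) * N + R) := fun σ hσ τ _ =>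
    h.append_mem_cell hq hR hradius hσ (hball τ)
  have : NeZero ((Measure.pi fun _ : Fin R => ν).restrict Set.univ) := by
    rw [Measure.restrict_univ]
    infer_instance
  unfold cellMeasure at *
  have hadd := h.meanLog_compensated_append (ν := ν) hq hR happend
  rw [Measure.restrict_univ] at hadd
  exact ⟨neZero_restrict_append ν happend, by linarith⟩

theorem exists_meanLog_le_cell (h : IsGaussianBlockModel X P y φ M B V C D) {t : Finset E}
    (hcover : ∀ z, ‖z‖ ≤ M → ∃ x ∈ t, dist z x ≤ r) {N : ℕ} (hN : 1 ≤ N) :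
    ∃ x ∈ t, NeZero (cellMeasure ν y x r N) ∧
      meanLog (X N) (Measure.pi fun _ : Fin N => ν) P
        ≤ meanLog (X N) (cellMeasure ν y x r N) P
          + (Real.log t.card + t.card * (2 * Real.exp (V / 2)) * √(N : ℝ)) := by
  have hN_pos : (0 : ℝ) < N := by exact_mod_cast hN
  have hsqrt : 0 < √(N : ℝ) := Real.sqrt_pos.2 hN_pos
  have hcells : ∀ σ, ∃ x : t, σ ∈ cell y x r N := fun σ =>
    let ⟨x, hx, hσx⟩ := hcover _ (h.norm_orderParameter_le N hN σ)
    ⟨⟨x, hx⟩, hσx⟩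
  obtain ⟨⟨x, hx⟩, hne, hle⟩ := (h.isBoundedGaussian N hN).exists_meanLog_le_restrict
    (Measure.pi fun _ : Fin N => ν) hcells (inv_pos.2 hsqrt)
  -- the scale `1 / √N` balances the fluctuations of order `√N` of `log Z`
  have hvariance : ((N * V : ℝ≥0) : ℝ) * (√(N : ℝ))⁻¹ ^ 2 = V := by
    rw [inv_pow, Real.sq_sqrt hN_pos.le, NNReal.coe_mul, NNReal.coe_natCast]
    field_simp
  rw [hvariance, div_inv_eq_mul, Fintype.card_coe, ← mul_assoc, add_assoc] at hle
  exact ⟨x, hx, hne, hle⟩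

theorem exists_block_le [OpensMeasurableSpace E] (h : IsGaussianBlockModel X P y φ M B V C D)
    {ε ρ : ℝ} (hε : 0 ≤ ε) (hρ : 0 ≤ ρ) {t : Finset E} (ht : ∀ x ∈ t, ‖x‖ ≤ M)
    (hcover : ∀ z, ‖z‖ ≤ M → ∃ x ∈ t, dist z x ≤ ρ)
    (hosc : ∀ x ∈ t, ∀ z, ‖z‖ ≤ M → dist z x ≤ 2 * ρ → |φ z - φ x| ≤ ε) {N q R : ℕ} (hN : 1 ≤ N)
    (hR : 1 ≤ R) (hlarge : R * (2 * M) ≤ (((q + 1) * N + R : ℕ) : ℝ) * ρ) :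
    ∃ x ∈ t, (q + 1) * meanLog (X N) (Measure.pi fun _ : Fin N => ν) P
        + meanLog (compensated (X R) P) (Measure.pi fun _ : Fin R => ν) P + R * φ x
      ≤ meanLog (X ((q + 1) * N + R)) (Measure.pi fun _ : Fin ((q + 1) * N + R) => ν) P
        + 2 * ε * ((q + 1) * N + R : ℕ) + C + (q + 1) * (C + D / 2 + Real.log t.card
          + t.card * (2 * Real.exp (V / 2)) * √(N : ℝ)) := by
  obtain ⟨x, hx, hne, hcell⟩ := h.exists_meanLog_le_cell (ν := ν) hcover hN
  obtain ⟨hne', hadd⟩ := h.meanLog_cell_mul_add (ν := ν) hN hR q (ht x hx) hρ hlarge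
  have hupper := h.meanLog_cell_le (ν := ν) (r := ρ) hN fun z hz hzx =>
    hosc x hx z hz (by linarith)
  have hlower := h.meanLog_compensated_cell_le (ν := ν) (r := 2 * ρ)
    (by omega : 1 ≤ (q + 1) * N + R) (hosc x hx)
  have hblocks := mul_le_mul_of_nonneg_left (hcell.trans (add_le_add_left hupper _))
    (by positivity : (0 : ℝ) ≤ q + 1)
  refine ⟨x, hx, ?_⟩
  have hRε : 0 ≤ R * ε := by positivity
  push_cast at hlower ⊢
  linarith

theorem eventually_block_le [ProperSpace E] [OpensMeasurableSpace E]
    (h : IsGaussianBlockModel X P y φ M B V C D) {ε : ℝ} (hε : 0 < ε) :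
    ∀ᶠ n : ℕ in atTop, ∃ W : ℝ, ∀ᶠ N : ℕ in atTop, ∀ q r : ℕ, 1 ≤ r → r ≤ n →
      N = (q + 1) * n + r →
      (q + 1) * meanLog (X n) (Measure.pi fun _ : Fin n => ν) P
        ≤ meanLog (X N) (Measure.pi fun _ : Fin N => ν) P + ε * N + W := by
  obtain ⟨ρ, hρ, t, ht, hcover, hosc⟩ :=
    exists_finset_cover_of_continuous h.continuous_cumulant M (by positivity : 0 < ε / 3)
  have hsmall := (tendsto_add_mul_sqrt_div_atTop (C + D / 2 + Real.log t.card)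
    (t.card * (2 * Real.exp (V / 2)))).eventually_lt_const (by positivity : 0 < ε / 3)
  filter_upwards [hsmall, eventually_ge_atTop 1] with n hn hn1
  have hn_pos : (0 : ℝ) < n := by exact_mod_cast hn1
  rw [div_lt_iff₀ hn_pos] at hn
  obtain ⟨W, hW⟩ := ((Finset.range (n + 1) ×ˢ t).image fun p : ℕ × E =>
    C - (meanLog (compensated (X p.1) P) (Measure.pi fun _ : Fin p.1 => ν) P
      + p.1 * φ p.2)).exists_le
  refine ⟨W, ?_⟩
  filter_upwards [(tendsto_natCast_atTop_atTop.atTop_mul_const hρ).eventually_ge_atTop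
    (n * (2 * M))] with N hN q r hr hrn hNq
  obtain ⟨a⟩ : Nonempty α := ν.nonempty_of_neZero
  have hM : 0 ≤ M :=
    (norm_nonneg _).trans (h.norm_orderParameter_le n hn1 fun _ => a)
  subst hNq
  have hlarge : (r : ℝ) * (2 * M) ≤ (((q + 1) * n + r : ℕ) : ℝ) * ρ :=
    le_trans (by gcongr) hN
  obtain ⟨x, hx, hblock⟩ :=
    h.exists_block_le (ν := ν) (by positivity) hρ.le ht hcover hosc hn1 hr hlarge
  have hWx := hW _ (Finset.mem_image_of_mem _ (Finset.mk_mem_product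
    (Finset.mem_range.2 (Nat.lt_succ_of_le hrn)) hx))
  have hblocks := mul_le_mul_of_nonneg_left hn.le (by positivity : (0 : ℝ) ≤ q + 1)
  have hr_nonneg : 0 ≤ r * ε := by positivity
  push_cast at hblock ⊢
  linarith

theorem exists_tendsto_meanLog [ProperSpace E] [OpensMeasurableSpace E]
    (h : IsGaussianBlockModel X P y φ M B V C D) :
    ∃ l, Tendsto (fun N : ℕ => meanLog (X N) (Measure.pi fun _ : Fin N => ν) P / N) atTop
      (𝓝 l) := by
  refine exists_tendsto_div_of_block_le (K := Real.log (ν.real Set.univ) + (B + V / 2)) ?_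
    fun ε hε => h.eventually_block_le hε
  filter_upwards [eventually_ge_atTop 1] with N hN
  have hN_pos : (0 : ℝ) < N := by exact_mod_cast hN
  have hmass : (Measure.pi fun _ : Fin N => ν).real Set.univ = ν.real Set.univ ^ N := by
    simp only [measureReal_def, Measure.pi_univ, Finset.prod_const, Finset.card_univ,
      Fintype.card_fin, ENNReal.toReal_pow]
  have hle := (h.isBoundedGaussian N hN).meanLog_le (Measure.pi fun _ : Fin N => ν)
  rw [hmass, Real.log_pow, NNReal.coe_mul, NNReal.coe_natCast] at hle
  rw [div_le_iff₀ hN_pos]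
  linarith

end IsGaussianBlockModel

end BlockModel

section MeanField

theorem abs_le_maxAbsOnCube {k : ℕ} {f : (Fin k → ℝ) → ℝ} (hf : Continuous f) {M : ℝ}
    {x : Fin k → ℝ} (hx : ∀ i, |x i| ≤ M) : |f x| ≤ maxAbsOnCube f M := by
  have hcube : {x : Fin k → ℝ | ∀ i, |x i| ≤ M} = Set.univ.pi fun _ => Set.Icc (-M) M := by
    ext x
    simp only [Set.mem_ofPred_eq, Set.mem_pi, Set.mem_univ, forall_const, Set.mem_Icc, abs_le]
  have hcompact : IsCompact {x : Fin k → ℝ | ∀ i, |x i| ≤ M} :=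
    hcube ▸ isCompact_univ_pi fun _ => isCompact_Icc
  exact le_csSup (hcompact.image hf.abs).bddAbove ⟨x, hx, rfl⟩

theorem maxAbsOnCube_nonneg {k : ℕ} (f : (Fin k → ℝ) → ℝ) (M : ℝ) : 0 ≤ maxAbsOnCube f M :=
  Real.sSup_nonneg (Set.forall_mem_image.2 fun _ _ => abs_nonneg _)

theorem abs_sub_mul_le_of_abs_div_sub_le {a b C : ℝ} {N : ℕ} (hN : 1 ≤ N)
    (h : |a / N - b| ≤ C / N) : |a - N * b| ≤ C := by
  have hN_pos : (0 : ℝ) < N := by exact_mod_cast hN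
  rwa [div_sub' hN_pos.ne', abs_div, Nat.abs_cast, div_le_div_iff_of_pos_right hN_pos] at h

theorem abs_div_natCast_le (C : ℝ) (N : ℕ) : |C / N| ≤ |C| := by
  rcases N.eq_zero_or_pos with rfl | hN
  · simp only [Nat.cast_zero, div_zero, abs_zero, abs_nonneg]
  · rw [abs_div, Nat.abs_cast]
    exact div_le_self (abs_nonneg C) (by exact_mod_cast hN)

/-- Gaussian Hamiltonians whose mean and covariance per site are `g (m N σ)` and `f (Q N σ τ)` with
`f` convex, up to corrections of total size `Cb` and `Cc`, for magnetizations `m` and overlaps `Q`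
that average over blocks of spins. -/
structure IsMeanFieldModel {α Ω : Type*} [MeasurableSpace α] [MeasurableSpace Ω] (P : Measure Ω)
    (H : (N : ℕ) → (Fin N → α) → Ω → ℝ) {k : ℕ} (M : ℝ) (g : (Fin k → ℝ) → ℝ)
    (m : Fin k → (N : ℕ) → (Fin N → α) → ℝ) (Cb : ℝ) (f : (Fin k → ℝ) → ℝ)
    (Q : Fin k → (N : ℕ) → (Fin N → α) → (Fin N → α) → ℝ) (Cc : ℝ) : Prop where
  measurable : ∀ N, 1 ≤ N → Measurable (fun p : (Fin N → α) × Ω => H N p.1 p.2)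
  gaussian : ∀ N, 1 ≤ N → IsGaussianProcess (H N) P
  continuous_mean : Continuous g
  measurable_magnetization : ∀ i N, 1 ≤ N → Measurable (m i N)
  magnetization_le : ∀ i N, 1 ≤ N → ∀ σ, |m i N σ| ≤ M
  magnetization_append : ∀ i N₁ N₂, 1 ≤ N₁ → 1 ≤ N₂ → ∀ (σ₁ : Fin N₁ → α) (σ₂ : Fin N₂ → α),
    ((N₁ + N₂ : ℕ) : ℝ) * m i (N₁ + N₂) (Fin.append σ₁ σ₂) = N₁ * m i N₁ σ₁ + N₂ * m i N₂ σ₂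
  abs_mean_div_sub_le : ∀ N, 1 ≤ N → ∀ σ, |P[H N σ] / N - g (fun i => m i N σ)| ≤ Cb / N
  convexOn_covariance : ConvexOn ℝ Set.univ f
  measurable_selfOverlap : ∀ i N, 1 ≤ N → Measurable fun σ => Q i N σ σ
  selfOverlap_le : ∀ i N, 1 ≤ N → ∀ σ, |Q i N σ σ| ≤ M
  overlap_append : ∀ i N₁ N₂, 1 ≤ N₁ → 1 ≤ N₂ →
    ∀ (σ₁ τ₁ : Fin N₁ → α) (σ₂ τ₂ : Fin N₂ → α),
    ((N₁ + N₂ : ℕ) : ℝ) * Q i (N₁ + N₂) (Fin.append σ₁ σ₂) (Fin.append τ₁ τ₂)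
      = N₁ * Q i N₁ σ₁ τ₁ + N₂ * Q i N₂ σ₂ τ₂
  abs_covariance_div_sub_le : ∀ N, 1 ≤ N → ∀ σ τ,
    |cov[H N σ, H N τ; P] / N - f (fun i => Q i N σ τ)| ≤ Cc / N

/-- The exponent `-β H_N` of the Boltzmann factor, as a Gaussian process. -/
def gibbsExponent {α Ω : Type*} (H : (N : ℕ) → (Fin N → α) → Ω → ℝ) (β : ℝ) (N : ℕ)
    (σ : Fin N → α) (ω : Ω) : ℝ :=
  -β * H N σ ω

/-- The order parameter along which a mean field model decouples: the magnetizations determine the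
mean of the energy and the self-overlaps its variance. -/
def orderParameter {α : Type*} {k : ℕ} (m : Fin k → (N : ℕ) → (Fin N → α) → ℝ)
    (Q : Fin k → (N : ℕ) → (Fin N → α) → (Fin N → α) → ℝ) (N : ℕ) (σ : Fin N → α) :
    (Fin k → ℝ) × (Fin k → ℝ) :=
  (fun i => m i N σ, fun i => Q i N σ σ)

/-- The cumulant of `-β H_N` per site, as a function of the order parameter. -/
noncomputable def siteCumulant {k : ℕ} (g f : (Fin k → ℝ) → ℝ) (β : ℝ)
    (x : (Fin k → ℝ) × (Fin k → ℝ)) : ℝ :=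
  -β * g x.1 + β ^ 2 * f x.2 / 2

variable {α Ω : Type*} [MeasurableSpace Ω] {P : Measure Ω}
  {H : (N : ℕ) → (Fin N → α) → Ω → ℝ} {k : ℕ} {M : ℝ} {g : (Fin k → ℝ) → ℝ}
  {m : Fin k → (N : ℕ) → (Fin N → α) → ℝ} {Cb : ℝ} {f : (Fin k → ℝ) → ℝ}
  {Q : Fin k → (N : ℕ) → (Fin N → α) → (Fin N → α) → ℝ} {Cc : ℝ}

theorem integral_gibbsExponent (β : ℝ) (N : ℕ) (σ : Fin N → α) :
    P[gibbsExponent H β N σ] = -β * P[H N σ] :=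
  integral_const_mul _ _

theorem covariance_gibbsExponent (β : ℝ) (N : ℕ) (σ τ : Fin N → α) :
    cov[gibbsExponent H β N σ, gibbsExponent H β N τ; P] = β ^ 2 * cov[H N σ, H N τ; P] := by
  unfold gibbsExponent
  rw [covariance_const_mul_left, covariance_const_mul_right]
  ring

namespace IsMeanFieldModel

variable [MeasurableSpace α]

theorem continuous_covariance (h : IsMeanFieldModel P H M g m Cb f Q Cc) : Continuous f :=
  h.convexOn_covariance.locallyLipschitz.continuous

theorem continuous_siteCumulant (h : IsMeanFieldModel P H M g m Cb f Q Cc) (β : ℝ) :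
    Continuous (siteCumulant g f β) := by
  have hg := h.continuous_mean
  have hf := h.continuous_covariance
  unfold siteCumulant
  fun_prop

theorem abs_mean_sub_le (h : IsMeanFieldModel P H M g m Cb f Q Cc) {N : ℕ} (hN : 1 ≤ N)
    (σ : Fin N → α) : |P[H N σ] - N * g (fun i => m i N σ)| ≤ Cb :=
  abs_sub_mul_le_of_abs_div_sub_le hN (h.abs_mean_div_sub_le N hN σ)

theorem abs_covariance_sub_le (h : IsMeanFieldModel P H M g m Cb f Q Cc) {N : ℕ} (hN : 1 ≤ N)
    (σ τ : Fin N → α) : |cov[H N σ, H N τ; P] - N * f (fun i => Q i N σ τ)| ≤ Cc :=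
  abs_sub_mul_le_of_abs_div_sub_le hN (h.abs_covariance_div_sub_le N hN σ τ)

theorem abs_mean_le (h : IsMeanFieldModel P H M g m Cb f Q Cc) {N : ℕ} (hN : 1 ≤ N)
    (σ : Fin N → α) : |P[H N σ]| ≤ N * (maxAbsOnCube g M + |Cb|) := by
  have hN_one : (1 : ℝ) ≤ N := by exact_mod_cast hN
  have hg := mul_le_mul_of_nonneg_left
    (abs_le_maxAbsOnCube h.continuous_mean fun i => h.magnetization_le i N hN σ)
    (Nat.cast_nonneg (α := ℝ) N)
  have htriangle := abs_sub_abs_le_abs_sub P[H N σ] (N * g fun i => m i N σ)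
  rw [abs_mul, Nat.abs_cast] at htriangle
  linarith [h.abs_mean_sub_le hN σ, le_abs_self Cb, le_mul_of_one_le_left (abs_nonneg Cb) hN_one]

theorem variance_le (h : IsMeanFieldModel P H M g m Cb f Q Cc) {N : ℕ} (hN : 1 ≤ N)
    (σ : Fin N → α) : cov[H N σ, H N σ; P] ≤ N * (maxAbsOnCube f M + Cc / N) := by
  have hN_pos : (0 : ℝ) < N := by exact_mod_cast hN
  have hf := mul_le_mul_of_nonneg_left ((le_abs_self _).trans
    (abs_le_maxAbsOnCube h.continuous_covariance fun i => h.selfOverlap_le i N hN σ)) hN_pos.le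
  rw [mul_add, mul_div_cancel₀ _ hN_pos.ne']
  linarith [(abs_le.1 (h.abs_covariance_sub_le hN σ σ)).2]

theorem covariance_append_le (h : IsMeanFieldModel P H M g m Cb f Q Cc) {N₁ N₂ : ℕ}
    (hN₁ : 1 ≤ N₁) (hN₂ : 1 ≤ N₂) (σ₁ τ₁ : Fin N₁ → α) (σ₂ τ₂ : Fin N₂ → α) :
    cov[H (N₁ + N₂) (Fin.append σ₁ σ₂), H (N₁ + N₂) (Fin.append τ₁ τ₂); P]
      ≤ cov[H N₁ σ₁, H N₁ τ₁; P] + cov[H N₂ σ₂, H N₂ τ₂; P] + 3 * Cc := by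
  have hpos : (0 : ℝ) < N₁ + N₂ := by exact_mod_cast (by omega : 0 < N₁ + N₂)
  have hoverlap : (fun i => Q i (N₁ + N₂) (Fin.append σ₁ σ₂) (Fin.append τ₁ τ₂))
      = ((N₁ : ℝ) / (N₁ + N₂)) • (fun i => Q i N₁ σ₁ τ₁)
        + ((N₂ : ℝ) / (N₁ + N₂)) • fun i => Q i N₂ σ₂ τ₂ := by
    ext i
    have happend := h.overlap_append i N₁ N₂ hN₁ hN₂ σ₁ τ₁ σ₂ τ₂
    rw [Nat.cast_add] at happend
    simp only [Pi.add_apply, Pi.smul_apply, smul_eq_mul]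
    field_simp
    linarith
  have hconvex : ((N₁ + N₂ : ℕ) : ℝ)
        * f (fun i => Q i (N₁ + N₂) (Fin.append σ₁ σ₂) (Fin.append τ₁ τ₂))
      ≤ N₁ * f (fun i => Q i N₁ σ₁ τ₁) + N₂ * f fun i => Q i N₂ σ₂ τ₂ := by
    rw [hoverlap, Nat.cast_add, ← le_div_iff₀' hpos, add_div, mul_div_right_comm,
      mul_div_right_comm]
    exact h.convexOn_covariance.2 (Set.mem_univ _) (Set.mem_univ _) (by positivity)
      (by positivity) (by rw [← add_div, div_self hpos.ne'])
  linarith [(abs_le.1 (h.abs_covariance_sub_le (N := N₁ + N₂) (by omega) (Fin.append σ₁ σ₂)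
    (Fin.append τ₁ τ₂))).2, (abs_le.1 (h.abs_covariance_sub_le hN₁ σ₁ τ₁)).1,
    (abs_le.1 (h.abs_covariance_sub_le hN₂ σ₂ τ₂)).1]

theorem measurable_orderParameter (h : IsMeanFieldModel P H M g m Cb f Q Cc) {N : ℕ}
    (hN : 1 ≤ N) : Measurable (orderParameter m Q N) :=
  (measurable_pi_lambda _ fun i => h.measurable_magnetization i N hN).prodMk
    (measurable_pi_lambda _ fun i => h.measurable_selfOverlap i N hN)

theorem norm_orderParameter_le (h : IsMeanFieldModel P H M g m Cb f Q Cc) {N : ℕ} (hN : 1 ≤ N)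
    (σ : Fin N → α) : ‖orderParameter m Q N σ‖ ≤ |M| :=
  norm_prod_le_iff.2
    ⟨(pi_norm_le_iff_of_nonneg (abs_nonneg M)).2 fun i =>
      (h.magnetization_le i N hN σ).trans (le_abs_self M),
    (pi_norm_le_iff_of_nonneg (abs_nonneg M)).2 fun i =>
      (h.selfOverlap_le i N hN σ).trans (le_abs_self M)⟩

theorem orderParameter_append (h : IsMeanFieldModel P H M g m Cb f Q Cc) {N₁ N₂ : ℕ}
    (hN₁ : 1 ≤ N₁) (hN₂ : 1 ≤ N₂) (σ₁ : Fin N₁ → α) (σ₂ : Fin N₂ → α) :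
    ((N₁ + N₂ : ℕ) : ℝ) • orderParameter m Q (N₁ + N₂) (Fin.append σ₁ σ₂)
      = (N₁ : ℝ) • orderParameter m Q N₁ σ₁ + (N₂ : ℝ) • orderParameter m Q N₂ σ₂ :=
  Prod.ext (funext fun i => h.magnetization_append i N₁ N₂ hN₁ hN₂ σ₁ σ₂)
    (funext fun i => h.overlap_append i N₁ N₂ hN₁ hN₂ σ₁ σ₁ σ₂ σ₂)

theorem abs_compensator_sub_le (h : IsMeanFieldModel P H M g m Cb f Q Cc) {β : ℝ} (hβ : 0 ≤ β)
    {N : ℕ} (hN : 1 ≤ N) (σ : Fin N → α) :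
    |compensator (gibbsExponent H β N) P σ - N * siteCumulant g f β (orderParameter m Q N σ)|
      ≤ β * Cb + β ^ 2 * Cc / 2 := by
  have hsplit : compensator (gibbsExponent H β N) P σ
        - N * siteCumulant g f β (orderParameter m Q N σ)
      = -β * (P[H N σ] - N * g (fun i => m i N σ))
        + β ^ 2 / 2 * (cov[H N σ, H N σ; P] - N * f (fun i => Q i N σ σ)) := by
    rw [compensator, integral_gibbsExponent, covariance_gibbsExponent, siteCumulant,
      orderParameter]
    ring
  rw [hsplit]
  refine (abs_add_le _ _).trans ?_
  rw [abs_mul, abs_mul, abs_neg, abs_of_nonneg hβ, abs_of_nonneg (by positivity : 0 ≤ β ^ 2 / 2),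
    mul_div_right_comm]
  gcongr
  · exact h.abs_mean_sub_le hN σ
  · exact h.abs_covariance_sub_le hN σ σ

theorem isBoundedGaussian_gibbsExponent (h : IsMeanFieldModel P H M g m Cb f Q Cc) {β : ℝ}
    (hβ : 0 ≤ β) {N : ℕ} (hN : 1 ≤ N) {L : ℝ} (hL : ∀ σ, cov[H N σ, H N σ; P] ≤ N * L) :
    IsBoundedGaussian (gibbsExponent H β N) P (N * (β * (maxAbsOnCube g M + |Cb|)))
      (N * (β ^ 2 * L).toNNReal) where
  measurable := (h.measurable N hN).const_mul (-β)
  gaussian := (h.gaussian N hN).smul fun _ => -β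
  mean_le σ := by
    rw [integral_gibbsExponent, abs_mul, abs_neg, abs_of_nonneg hβ, mul_left_comm]
    exact mul_le_mul_of_nonneg_left (h.abs_mean_le hN σ) hβ
  cov_le σ := by
    rw [covariance_gibbsExponent, NNReal.coe_mul, NNReal.coe_natCast]
    calc β ^ 2 * cov[H N σ, H N σ; P] ≤ β ^ 2 * (N * L) :=
          mul_le_mul_of_nonneg_left (hL σ) (sq_nonneg β)
      _ = N * (β ^ 2 * L) := mul_left_comm _ _ _
      _ ≤ N * (β ^ 2 * L).toNNReal :=
          mul_le_mul_of_nonneg_left (Real.le_coe_toNNReal _) (Nat.cast_nonneg N)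

theorem isGaussianBlockModel (h : IsMeanFieldModel P H M g m Cb f Q Cc) {β : ℝ} (hβ : 0 ≤ β) :
    IsGaussianBlockModel (gibbsExponent H β) P (orderParameter m Q) (siteCumulant g f β) |M|
      (β * (maxAbsOnCube g M + |Cb|)) (β ^ 2 * (maxAbsOnCube f M + |Cc|)).toNNReal
      (β * Cb + β ^ 2 * Cc / 2) (β ^ 2 * (3 * Cc)) where
  isBoundedGaussian N hN := h.isBoundedGaussian_gibbsExponent hβ hN fun σ =>
    (h.variance_le hN σ).trans (by
      gcongr
      exact (le_abs_self _).trans (abs_div_natCast_le Cc N))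
  measurable_orderParameter _ hN := h.measurable_orderParameter hN
  norm_orderParameter_le _ hN σ := h.norm_orderParameter_le hN σ
  orderParameter_append _ _ hm hn σ τ := h.orderParameter_append hm hn σ τ
  continuous_cumulant := h.continuous_siteCumulant β
  abs_compensator_sub_le _ hN σ := h.abs_compensator_sub_le hβ hN σ
  covariance_append_le N₁ N₂ hN₁ hN₂ σ σ' τ τ' := by
    simp only [covariance_gibbsExponent, ← mul_add]
    exact mul_le_mul_of_nonneg_left (h.covariance_append_le hN₁ hN₂ σ σ' τ τ') (sq_nonneg β)

end IsMeanFieldModel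

end MeanField

section FreeEnergy

theorem measureReal_abs_ge_le_gaussianTail {Ω : Type*} [MeasurableSpace Ω] {P : Measure Ω}
    [IsFiniteMeasure P] {Y : Ω → ℝ} {c : ℝ≥0} (hY : HasSubgaussianMGF Y c P) {N : ℕ} {L : ℝ}
    (hN : 1 ≤ N) (hc : N * (c : ℝ) = L) {u : ℝ} (hu : 0 < u) :
    P.real {ω | u ≤ |Y ω|} ≤ gaussianTail N L u := by
  have hN_pos : (0 : ℝ) < N := by exact_mod_cast hN
  subst hc
  unfold gaussianTail
  split_ifs with h0
  · obtain rfl : c = 0 :=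
      NNReal.coe_eq_zero.1 ((mul_eq_zero.1 h0).resolve_left hN_pos.ne')
    have hY_zero : Y =ᵐ[P] 0 := hY.ae_eq_zero_of_hasSubgaussianMGF_zero
    refine ((measureReal_eq_zero_iff (measure_ne_top _ _)).2
      (measure_mono_null (fun ω hω hzero => ?_) hY_zero)).le
    have hu_le : u ≤ |Y ω| := hω
    rw [show Y ω = 0 from hzero, abs_zero] at hu_le
    exact hu.not_ge hu_le
  · have hexponent : -u ^ 2 / (2 * (c : ℝ)) = -(N * u ^ 2 / (2 * (N * c))) := by
      rw [mul_left_comm 2 (N : ℝ), mul_div_mul_left _ _ hN_pos.ne', neg_div]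
    have hupper := hY.measure_ge_le hu.le
    have hlower := hY.neg.measure_ge_le hu.le
    rw [hexponent] at hupper hlower
    calc P.real {ω | u ≤ |Y ω|} ≤ P.real ({ω | u ≤ Y ω} ∪ {ω | u ≤ (-Y) ω}) :=
          measureReal_mono (fun ω hω => (le_abs (b := Y ω)).1 hω) (measure_ne_top _ _)
      _ ≤ P.real {ω | u ≤ Y ω} + P.real {ω | u ≤ (-Y) ω} := measureReal_union_le _ _
      _ ≤ _ := by linarith

theorem gaussianTail_le_exp {N : ℕ} {L L' u : ℝ} (hL : 0 ≤ L) (h : L ≤ L') :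
    gaussianTail N L u ≤ 2 * Real.exp (N * -(u ^ 2 / (2 * L'))) := by
  unfold gaussianTail
  split_ifs with hzero
  · positivity
  · have : 0 < L := lt_of_le_of_ne hL (Ne.symm hzero)
    rw [mul_neg, mul_div_assoc]
    gcongr

-- Borel–Cantelli: deviations with exponentially small probabilities vanish almost surely.
theorem ae_tendsto_zero_of_measureReal_abs_ge_le {Ω : Type*} [MeasurableSpace Ω] {P : Measure Ω}
    [IsFiniteMeasure P] {Y : ℕ → Ω → ℝ} {L : ℝ} (hL : 0 < L)
    (hY : ∀ u > 0, ∀ N, 1 ≤ N →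
      P.real {ω | u ≤ |Y N ω|} ≤ 2 * Real.exp (N * -(u ^ 2 / (2 * L)))) :
    ∀ᵐ ω ∂P, Tendsto (fun N => Y N ω) atTop (𝓝 0) := by
  have hsmall : ∀ u > 0, ∀ᵐ ω ∂P, ∀ᶠ N in atTop, |Y N ω| < u := fun u hu => by
    have hsummable : Summable fun N : ℕ => 2 * Real.exp (N * -(u ^ 2 / (2 * L))) :=
      (Real.summable_exp_nat_mul_iff.2 (neg_neg_of_pos (by positivity))).mul_left 2
    have hreal : Summable fun N => P.real {ω | u ≤ |Y N ω|} :=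
      hsummable.of_norm_bounded_eventually_nat (by
        filter_upwards [eventually_ge_atTop 1] with N hN
        rw [Real.norm_of_nonneg measureReal_nonneg]
        exact hY u hu N hN)
    have hfinite : ∑' N, P {ω | u ≤ |Y N ω|} ≠ ⊤ := by
      simpa only [ofReal_measureReal (measure_ne_top P _)] using hreal.tsum_ofReal_ne_top
    filter_upwards [ae_eventually_notMem hfinite] with ω hω
    filter_upwards [hω] with N hN
    exact not_le.1 hN
  filter_upwards [ae_all_iff.2 fun j : ℕ => hsmall (1 / ((j : ℝ) + 1)) (by positivity)] with ω hω
  refine Metric.tendsto_nhds.2 fun ε hε => ?_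
  obtain ⟨j, hj⟩ := exists_nat_one_div_lt hε
  filter_upwards [hω j] with N hN
  rw [Real.dist_eq, sub_zero]
  exact hN.trans hj

/-- The random free energy per site over a product of arbitrary spin spaces; `freeEnergy` is the
case of spins in `ℝⁿ`. -/
noncomputable def siteFreeEnergy {α Ω : Type*} [MeasurableSpace α] (ν : Measure α)
    (H : (N : ℕ) → (Fin N → α) → Ω → ℝ) (β : ℝ) (N : ℕ) (ω : Ω) : ℝ :=
  -(1 / (N * β))
    * Real.log (expIntegral (gibbsExponent H β N) (Measure.pi fun _ : Fin N => ν) ω)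

/-- The quenched free energy per site over a product of arbitrary spin spaces;
`quenchedFreeEnergy` is the case of spins in `ℝⁿ`. -/
noncomputable def quenchedSiteFreeEnergy {α Ω : Type*} [MeasurableSpace α] [MeasurableSpace Ω]
    (P : Measure Ω) (ν : Measure α) (H : (N : ℕ) → (Fin N → α) → Ω → ℝ) (β : ℝ)
    (N : ℕ) : ℝ :=
  -(1 / (N * β)) * meanLog (gibbsExponent H β N) (Measure.pi fun _ : Fin N => ν) P

namespace IsMeanFieldModel

variable {α Ω : Type*} [MeasurableSpace α] [MeasurableSpace Ω] {P : Measure Ω}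
  {H : (N : ℕ) → (Fin N → α) → Ω → ℝ} {k : ℕ} {M : ℝ} {g : (Fin k → ℝ) → ℝ}
  {m : Fin k → (N : ℕ) → (Fin N → α) → ℝ} {Cb : ℝ} {f : (Fin k → ℝ) → ℝ}
  {Q : Fin k → (N : ℕ) → (Fin N → α) → (Fin N → α) → ℝ} {Cc : ℝ}

theorem nonneg_of_variance_le [Nonempty α] (h : IsMeanFieldModel P H M g m Cb f Q Cc) {N : ℕ}
    (hN : 1 ≤ N) {L : ℝ} (hL : ∀ σ, cov[H N σ, H N σ; P] ≤ N * L) : 0 ≤ L := by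
  have hσ := hL fun _ => Classical.arbitrary α
  rw [covariance_self ((h.gaussian N hN).aemeasurable _)] at hσ
  exact nonneg_of_mul_nonneg_right ((variance_nonneg _ _).trans hσ) (by exact_mod_cast hN)

variable [IsProbabilityMeasure P] {ν : Measure α} [IsFiniteMeasure ν] [NeZero ν]

theorem measureReal_siteFreeEnergy_sub_le (h : IsMeanFieldModel P H M g m Cb f Q Cc) {β : ℝ}
    (hβ : 0 < β) {N : ℕ} (hN : 1 ≤ N) {L : ℝ} (hL : ∀ σ, cov[H N σ, H N σ; P] ≤ N * L) {u : ℝ}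
    (hu : 0 < u) :
    P.real {ω | u ≤ |siteFreeEnergy ν H β N ω - quenchedSiteFreeEnergy P ν H β N|}
      ≤ gaussianTail N L u := by
  have : Nonempty α := ν.nonempty_of_neZero
  have : (0 : ℝ) < N := by exact_mod_cast hN
  have hlog := (h.isBoundedGaussian_gibbsExponent hβ.le hN hL).hasSubgaussianMGF_log
    (Measure.pi fun _ : Fin N => ν)
  simp only [siteFreeEnergy, quenchedSiteFreeEnergy, ← mul_sub]
  refine measureReal_abs_ge_le_gaussianTail (hlog.const_mul _) hN ?_ hu
  change (N : ℝ) * ((-(1 / (N * β))) ^ 2 * (N * ((β ^ 2 * L).toNNReal : ℝ))) = L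
  rw [Real.coe_toNNReal _ (mul_nonneg (sq_nonneg β) (h.nonneg_of_variance_le hN hL))]
  field_simp

theorem ae_tendsto_siteFreeEnergy_sub (h : IsMeanFieldModel P H M g m Cb f Q Cc) {β : ℝ}
    (hβ : 0 < β) :
    ∀ᵐ ω ∂P, Tendsto (fun N => siteFreeEnergy ν H β N ω - quenchedSiteFreeEnergy P ν H β N)
      atTop (𝓝 0) := by
  have : Nonempty α := ν.nonempty_of_neZero
  have hL : 0 < maxAbsOnCube f M + |Cc| + 1 := by
    linarith [maxAbsOnCube_nonneg f M, abs_nonneg Cc]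
  refine ae_tendsto_zero_of_measureReal_abs_ge_le hL fun u hu N hN => ?_
  refine (h.measureReal_siteFreeEnergy_sub_le hβ hN (h.variance_le hN) hu).trans
    (gaussianTail_le_exp (h.nonneg_of_variance_le hN (h.variance_le hN)) ?_)
  linarith [le_abs_self (Cc / N), abs_div_natCast_le Cc N]

theorem exists_tendsto_quenchedSiteFreeEnergy (h : IsMeanFieldModel P H M g m Cb f Q Cc) {β : ℝ}
    (hβ : 0 < β) :
    ∃ l, Tendsto (fun N => quenchedSiteFreeEnergy P ν H β N) atTop (𝓝 l) := by
  obtain ⟨l, hl⟩ := (h.isGaussianBlockModel hβ.le).exists_tendsto_meanLog (ν := ν)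
  refine ⟨_, (hl.const_mul (-(1 / β))).congr fun N => ?_⟩
  rw [quenchedSiteFreeEnergy]
  ring

theorem ae_integrable_and_pos (h : IsMeanFieldModel P H M g m Cb f Q Cc) {β : ℝ} (hβ : 0 < β)
    {N : ℕ} (hN : 1 ≤ N) :
    (∀ᵐ ω ∂P, Integrable (fun σ => Real.exp (gibbsExponent H β N σ ω))
        (Measure.pi fun _ : Fin N => ν) ∧
      0 < expIntegral (gibbsExponent H β N) (Measure.pi fun _ : Fin N => ν) ω) ∧
    Integrable (fun ω =>
      Real.log (expIntegral (gibbsExponent H β N) (Measure.pi fun _ : Fin N => ν) ω)) P :=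
  have hX := h.isBoundedGaussian_gibbsExponent hβ.le hN (h.variance_le hN)
  ⟨(hX.ae_integrable_exp _).and (hX.ae_expIntegral_pos _), hX.integrable_log _⟩

end IsMeanFieldModel

end FreeEnergy

end SpinGlass

theorem theorem1_general {α Ω : Type*} [MeasurableSpace α] [MeasurableSpace Ω] (P : Measure Ω)
    [IsProbabilityMeasure P] (ν : Measure α) [IsFiniteMeasure ν] [NeZero ν]
    (H : (N : ℕ) → (Fin N → α) → Ω → ℝ) {k : ℕ} {M : ℝ} {g : (Fin k → ℝ) → ℝ}
    {m : Fin k → (N : ℕ) → (Fin N → α) → ℝ} {Cb : ℝ} {f : (Fin k → ℝ) → ℝ}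
    {Q : Fin k → (N : ℕ) → (Fin N → α) → (Fin N → α) → ℝ} {Cc : ℝ}
    (h : SpinGlass.IsMeanFieldModel P H M g m Cb f Q Cc) :
    ∃ fLim : ℝ → ℝ, ∀ β : ℝ, 0 < β →
      (∀ N : ℕ, 1 ≤ N →
        (∀ᵐ ω ∂P, Integrable (fun σ => Real.exp (SpinGlass.gibbsExponent H β N σ ω))
            (Measure.pi fun _ : Fin N => ν) ∧
          0 < SpinGlass.expIntegral (SpinGlass.gibbsExponent H β N)
            (Measure.pi fun _ : Fin N => ν) ω) ∧
        Integrable (fun ω => Real.log (SpinGlass.expIntegral (SpinGlass.gibbsExponent H β N)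
          (Measure.pi fun _ : Fin N => ν) ω)) P) ∧
      Tendsto (fun N => SpinGlass.quenchedSiteFreeEnergy P ν H β N) atTop (𝓝 (fLim β)) ∧
      (∀ᵐ ω ∂P, Tendsto (fun N => SpinGlass.siteFreeEnergy ν H β N ω) atTop (𝓝 (fLim β))) ∧
      (∀ N : ℕ, 1 ≤ N → ∀ u : ℝ, 0 < u →
        P.real {ω | u ≤ |SpinGlass.siteFreeEnergy ν H β N ω
            - SpinGlass.quenchedSiteFreeEnergy P ν H β N|} ≤
          SpinGlass.gaussianTail N (SpinGlass.maxAbsOnCube f M + Cc / N) u) ∧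
      (∀ N : ℕ, 1 ≤ N → (∀ σ, cov[H N σ, H N σ; P] ≤ N * SpinGlass.maxAbsOnCube f M) →
        ∀ u : ℝ, 0 < u →
        P.real {ω | u ≤ |SpinGlass.siteFreeEnergy ν H β N ω
            - SpinGlass.quenchedSiteFreeEnergy P ν H β N|} ≤
          SpinGlass.gaussianTail N (SpinGlass.maxAbsOnCube f M) u) := by
  choose! fLim hlim using fun β (hβ : 0 < β) =>
    h.exists_tendsto_quenchedSiteFreeEnergy (ν := ν) hβ
  refine ⟨fLim, fun β hβ => ⟨fun N hN => h.ae_integrable_and_pos hβ hN, hlim β hβ, ?_,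
    fun N hN u hu => h.measureReal_siteFreeEnergy_sub_le hβ hN (h.variance_le hN) hu,
    fun N hN hL u hu => h.measureReal_siteFreeEnergy_sub_le hβ hN hL hu⟩⟩
  filter_upwards [h.ae_tendsto_siteFreeEnergy_sub (ν := ν) hβ] with ω hω
  simpa only [sub_add_cancel, zero_add] using hω.add (hlim β hβ)

theorem theorem1
    -- spins: a set `S ⊆ ℝⁿ` with a finite nonzero a priori measure
    {n : ℕ} (S : Set (EuclideanSpace ℝ (Fin n)))
    (ν : Measure S) [IsFiniteMeasure ν] (hν : ν ≠ 0)
    -- disorder: a probability space carrying the Gaussian Hamiltonians of all sizes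
    {Ω : Type*} [MeasurableSpace Ω] (P : Measure Ω) [IsProbabilityMeasure P]
    (H : (N : ℕ) → SpinGlass.Config S N → Ω → ℝ)
    (hHmeas : ∀ N : ℕ, 1 ≤ N →
      Measurable (fun p : SpinGlass.Config S N × Ω => H N p.1 p.2))
    (hHgauss : ∀ N : ℕ, 1 ≤ N → IsGaussianProcess (H N) P)
    {k : ℕ} (M : ℝ)
    -- the mean
    (g : (Fin k → ℝ) → ℝ) (hg : ContDiff ℝ 1 g)
    (m : Fin k → (N : ℕ) → SpinGlass.Config S N → ℝ)
    (hmmeas : ∀ i, ∀ N : ℕ, 1 ≤ N → Measurable (m i N))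
    (hmbdd : ∀ i, ∀ N : ℕ, 1 ≤ N → ∀ σ, |m i N σ| ≤ M)
    (hmadd : ∀ i, SpinGlass.IsSizeAdditive (m i))
    (Cb : ℝ)
    (hmean : ∀ N : ℕ, 1 ≤ N → ∀ σ : SpinGlass.Config S N,
      |(∫ ω, H N σ ω ∂P) / N - g (fun i => m i N σ)| ≤ Cb / N)
    -- the covariance
    (f : (Fin k → ℝ) → ℝ) (hf : ContDiff ℝ 1 f) (hfconv : ConvexOn ℝ Set.univ f)
    (Q : Fin k → (N : ℕ) → SpinGlass.Config S N → SpinGlass.Config S N → ℝ)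
    (hQmeas : ∀ i, ∀ N : ℕ, 1 ≤ N →
      Measurable (fun p : SpinGlass.Config S N × SpinGlass.Config S N => Q i N p.1 p.2))
    (hQbdd : ∀ i, ∀ N : ℕ, 1 ≤ N → ∀ σ, |Q i N σ σ| ≤ M)
    (hQadd : ∀ i, SpinGlass.IsSizeAdditive₂ (Q i))
    (Cc : ℝ)
    (hcov : ∀ N : ℕ, 1 ≤ N → ∀ σ τ : SpinGlass.Config S N,
      |covariance (H N σ) (H N τ) P / N - f (fun i => Q i N σ τ)| ≤ Cc / N) :
    ∃ fLim : ℝ → ℝ, ∀ β : ℝ, 0 < β →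
      -- the partition function is almost surely finite and positive, and `E log Z_N` makes sense
      (∀ N : ℕ, 1 ≤ N →
        (∀ᵐ ω ∂P, Integrable (SpinGlass.boltzmannFactor H β N ω)
            (Measure.pi fun _ : Fin N => ν) ∧
          0 < SpinGlass.partitionFunction ν H β N ω) ∧
        Integrable (fun ω => Real.log (SpinGlass.partitionFunction ν H β N ω)) P) ∧
      -- convergence of the quenched free energy
      Tendsto (fun N : ℕ => SpinGlass.quenchedFreeEnergy P ν H β N) atTop (𝓝 (fLim β)) ∧
      -- almost sure convergence
      (∀ᵐ ω ∂P, Tendsto (fun N : ℕ => SpinGlass.freeEnergy ν H β N ω) atTop (𝓝 (fLim β))) ∧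
      -- fluctuations, the bounded correction of the covariance being taken into account
      (∀ N : ℕ, 1 ≤ N → ∀ u : ℝ, 0 < u →
        P.real {ω | u ≤ |SpinGlass.freeEnergy ν H β N ω
            - SpinGlass.quenchedFreeEnergy P ν H β N|} ≤
          SpinGlass.gaussianTail N (SpinGlass.maxAbsOnCube f M + Cc / N) u) ∧
      -- fluctuations, whenever that correction does not push a variance above `N L`
      (∀ N : ℕ, 1 ≤ N →
        (∀ σ : SpinGlass.Config S N,
          covariance (H N σ) (H N σ) P ≤ N * SpinGlass.maxAbsOnCube f M) →
        ∀ u : ℝ, 0 < u →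
        P.real {ω | u ≤ |SpinGlass.freeEnergy ν H β N ω
            - SpinGlass.quenchedFreeEnergy P ν H β N|} ≤
          SpinGlass.gaussianTail N (SpinGlass.maxAbsOnCube f M) u) := by
  have : NeZero ν := ⟨hν⟩
  exact theorem1_general (Q := Q) P ν H
    ⟨hHmeas, hHgauss, hg.continuous, hmmeas, hmbdd, hmadd, hmean, hfconv,
      fun i N hN => (hQmeas i N hN).comp (measurable_id.prodMk measurable_id), hQbdd, hQadd, hcov⟩
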